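/- Let $H$ be a finite dimensional complex Hilbert space, $\omega>0$, and let $L^2=L^2([0,\omega],H)$ carry the inner product $\langle x,y\rangle=\frac1\omega\int_0^\omega\langle x(s),y(s)\rangle_H\,ds$. Let $\mathcal V:[0,\omega]\to B(H)$ be strongly measurable with $s\mapsto\mathcal V(s)x$ in $L^2$ for every $x\in H$, and let $\widehat{\mathcal V}(n)\in B(H)$, $\widehat{\mathcal V}(n)x=\frac1\omega\int_0^\omega\mathcal V(s)x\,e^{-i\frac{2\pi n}{\omega}s}\,ds$, $n\in\mathbb Z$, be its Fourier coefficients. Assume that $$\sum_{n\in\mathbb Z}\|\widehat{\mathcal V}(n)\|^2<\infty\qquad\text{and}\qquad\sum_{j,\ell\in\mathbb Z}\Big\|\sum_{n\ne\ell}\frac{\widehat{\mathcal V}(j+n)\widehat{\mathcal V}(\ell+n)}{\ell-n}\Big\|^2<\infty .$$ Let $W_2^1([0,\omega],H)$ be the Sobolev space of continuous functions in $L^2$ with derivative in $L^2$, and let $L:D(L)\subset L^2\to L^2$ be the operator $$(Ly)(s)=\frac{dy}{ds}(s)-\mathcal V(s)y(\omega-s),\qquad D(L)=\{y\in W_2^1([0,\omega],H):\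 y(0)=y(\omega)\}.$$ Let $\varphi\in L^2$ and let $\widetilde u:\mathbb R\to L^2$ be a mild solution on $\mathbb R$ of $\widetilde u_t=L\widetilde u$, $\widetilde u(0)=\varphi$, that is, $\widetilde u$ is continuous and, for every $t\in\mathbb R$, $\int_0^t\widetilde u(s)\,ds\in D(L)$ and $\widetilde u(t)=\varphi+L\int_0^t\widetilde u(s)\,ds$. If $\widetilde u$ is bounded, i.e. $\sup_{t\in\mathbb R}\|\widetilde u(t)\|_{L^2}<\infty$, then $\widetilde u$ is Bohr almost periodic: it is continuous and for every $\varepsilon>0$ there is $l>0$ such that each interval $[a,a+l]$, $a\in\mathbb R$, contains a $\tau$ with $\|\widetilde u(t+\tau)-\widetilde u(t)\|_{L^2}<\varepsilon$ for all $t\in\mathbb R$. -/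

import Mathlib

open MeasureTheory Set

/-- Normalised Lebesgue measure `(1/ω) ds` on `[0, ω]`. -/
noncomputable def invMeasure (ω : ℝ) : Measure ℝ :=
  (ENNReal.ofReal ω)⁻¹ • (volume.restrict (Icc 0 ω))

/-- The space `L² = L²([0, ω], H)`, with the inner product
`⟨x, y⟩ = (1/ω) ∫₀^ω ⟨x s, y s⟩ ds`. -/
abbrev InvL2 (ω : ℝ) (H : Type*) [NormedAddCommGroup H] : Type _ :=
  Lp H 2 (invMeasure ω)

theorem invMeasure_ac (ω : ℝ) : invMeasure ω ≪ volume.restrict (Icc 0 ω) :=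
  Measure.smul_absolutelyContinuous

theorem ac_invMeasure (ω : ℝ) : volume.restrict (Icc 0 ω) ≪ invMeasure ω :=
  Measure.absolutelyContinuous_smul (ENNReal.inv_ne_zero.2 ENNReal.ofReal_ne_top)

instance invMeasure_finite (ω : ℝ) [hω : Fact (0 < ω)] : IsFiniteMeasure (invMeasure ω) := by
  constructor
  have h : ENNReal.ofReal ω ≠ 0 := by simpa using hω.out
  simp only [invMeasure, Measure.smul_apply, smul_eq_mul]
  exact ENNReal.mul_lt_top (ENNReal.inv_lt_top.2 (pos_iff_ne_zero.2 h)) (by simp)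

theorem MeasureTheory.Integrable.of_invMeasure {ω : ℝ} {E : Type*} [NormedAddCommGroup E]
    {f : ℝ → E} (hf : Integrable f (invMeasure ω)) : IntegrableOn f (Icc 0 ω) := by
  by_cases hω : 0 < ω
  · exact (integrable_smul_measure (ENNReal.inv_ne_zero.2 ENNReal.ofReal_ne_top)
      (ENNReal.inv_ne_top.2 (by simpa using hω))).1 hf
  · have h0 : volume (Icc 0 ω) = 0 := by simpa using not_lt.1 hω
    rw [IntegrableOn, Measure.restrict_eq_zero.2 h0]
    exact integrable_zero_measure

theorem integral_congr_invMeasure {ω : ℝ} {E : Type*} [NormedAddCommGroup E] [NormedSpace ℝ E]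
    {f g : ℝ → E} (h : f =ᵐ[invMeasure ω] g) {s : ℝ} (hs : s ∈ Icc 0 ω) :
    ∫ τ in (0 : ℝ)..s, f τ = ∫ τ in (0 : ℝ)..s, g τ := by
  apply intervalIntegral.integral_congr_ae_restrict
  rw [uIoc_of_le hs.1]
  have h1 : f =ᵐ[volume.restrict (Icc 0 ω)] g := (ac_invMeasure ω).ae_eq h
  exact ae_restrict_of_ae_restrict_of_subset
    (Ioc_subset_Icc_self.trans (Icc_subset_Icc le_rfl hs.2)) h1

theorem InvL2.intervalIntegrable {ω : ℝ} {H : Type*} [NormedAddCommGroup H] [Fact (0 < ω)]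
    (D : InvL2 ω H) {s : ℝ} (hs : s ∈ Icc 0 ω) :
    IntervalIntegrable D volume 0 s := by
  have h1 : Integrable D (invMeasure ω) := (Lp.memLp D).integrable (by norm_num)
  rw [intervalIntegrable_iff_integrableOn_Icc_of_le hs.1]
  exact h1.of_invMeasure.mono_set (Icc_subset_Icc le_rfl hs.2)

section Sobolev

variable {ω : ℝ} {H : Type*} [NormedAddCommGroup H] [InnerProductSpace ℂ H]

/-- `Y` is the continuous representative on `[0, ω]` of `y ∈ W₂¹([0, ω], H)`, and `D ∈ L²` is the
derivative of `y`: the function `Y` is the indefinite integral of `D`. -/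
structure IsSobolevRep (y : InvL2 ω H) (Y : ℝ → H) (D : InvL2 ω H) : Prop where
  continuousOn : ContinuousOn Y (Icc 0 ω)
  ae_eq : y =ᵐ[invMeasure ω] Y
  eq_integral : ∀ s ∈ Icc 0 ω, Y s = Y 0 + ∫ τ in (0 : ℝ)..s, D τ

theorem IsSobolevRep.add [Fact (0 < ω)] {y y' D D' : InvL2 ω H} {Y Y' : ℝ → H}
    (h : IsSobolevRep y Y D) (h' : IsSobolevRep y' Y' D') :
    IsSobolevRep (y + y') (Y + Y') (D + D') where
  continuousOn := h.continuousOn.add h'.continuousOn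
  ae_eq := (Lp.coeFn_add y y').trans (h.ae_eq.add h'.ae_eq)
  eq_integral s hs := by
    have e : ∫ τ in (0 : ℝ)..s, (D + D' : InvL2 ω H) τ = ∫ τ in (0 : ℝ)..s, (D τ + D' τ) := by
      exact integral_congr_invMeasure (Lp.coeFn_add D D') hs
    rw [e, intervalIntegral.integral_add (D.intervalIntegrable hs) (D'.intervalIntegrable hs)]
    simp only [Pi.add_apply]
    rw [h.eq_integral s hs, h'.eq_integral s hs]
    abel

theorem IsSobolevRep.smul (c : ℂ) {y D : InvL2 ω H} {Y : ℝ → H}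
    (h : IsSobolevRep y Y D) : IsSobolevRep (c • y) (c • Y) (c • D) where
  continuousOn := h.continuousOn.const_smul c
  ae_eq := (Lp.coeFn_smul c y).trans (h.ae_eq.const_smul c)
  eq_integral s hs := by
    have e : ∫ τ in (0 : ℝ)..s, (c • D : InvL2 ω H) τ = ∫ τ in (0 : ℝ)..s, c • D τ := by
      exact integral_congr_invMeasure (Lp.coeFn_smul c D) hs
    rw [e, intervalIntegral.integral_smul]
    simp only [Pi.smul_apply]
    rw [h.eq_integral s hs, smul_add]

theorem IsSobolevRep.zero : IsSobolevRep (0 : InvL2 ω H) (0 : ℝ → H) 0 := by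
  refine ⟨continuousOn_const, Lp.coeFn_zero _ _ _, fun s hs => ?_⟩
  have e : ∫ τ in (0 : ℝ)..s, (0 : InvL2 ω H) τ = ∫ τ in (0 : ℝ)..s, (0 : H) := by
    exact integral_congr_invMeasure (Lp.coeFn_zero H 2 (invMeasure ω)) hs
  rw [e]; simp

/-- The continuous representative is determined by `y`. -/
theorem IsSobolevRep.rep_unique [hω : Fact (0 < ω)] {y D D' : InvL2 ω H} {Y Y' : ℝ → H}
    (h : IsSobolevRep y Y D) (h' : IsSobolevRep y Y' D') : EqOn Y Y' (Icc 0 ω) := by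
  have e : Y =ᵐ[volume.restrict (Icc 0 ω)] Y' :=
    (ac_invMeasure ω).ae_le (h.ae_eq.symm.trans h'.ae_eq)
  exact Measure.eqOn_Icc_of_ae_eq volume hω.out.ne e h.continuousOn h'.continuousOn

/-- The derivative is determined by `y`. -/
theorem IsSobolevRep.deriv_unique [CompleteSpace H] [hω : Fact (0 < ω)] {y D D' : InvL2 ω H}
    {Y Y' : ℝ → H} (h : IsSobolevRep y Y D) (h' : IsSobolevRep y Y' D') : D = D' := by
  have hmem : ω ∈ Icc 0 ω := ⟨hω.out.le, le_rfl⟩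
  have e := h.rep_unique h'
  have d := (D.intervalIntegrable hmem).ae_hasDerivAt_integral
  have d' := (D'.intervalIntegrable hmem).ae_hasDerivAt_integral
  apply Lp.ext
  apply (invMeasure_ac ω).ae_eq
  rw [Filter.EventuallyEq, ← restrict_Ioo_eq_restrict_Icc, ae_restrict_iff' measurableSet_Ioo]
  filter_upwards [d, d'] with x hx hx' hxI
  have hxu : x ∈ uIcc 0 ω := by
    rw [uIcc_of_le hω.out.le]; exact Ioo_subset_Icc_self hxI
  have k := hx hxu 0 left_mem_uIcc
  have k' := hx' hxu 0 left_mem_uIcc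
  refine k.unique (k'.congr_of_eventuallyEq ?_)
  filter_upwards [Ioo_mem_nhds hxI.1 hxI.2] with s hs
  have hs' : s ∈ Icc 0 ω := Ioo_subset_Icc_self hs
  have h0 : (0 : ℝ) ∈ Icc 0 ω := ⟨le_rfl, hω.out.le⟩
  have a := h.eq_integral s hs'
  rw [e hs', e h0, h'.eq_integral s hs'] at a
  exact (add_left_cancel a).symm

end Sobolev

section Operator

variable (ω : ℝ) [hω : Fact (0 < ω)] {H : Type*} [NormedAddCommGroup H] [InnerProductSpace ℂ H]

/-- `D(L) = {y ∈ W₂¹([0, ω], H) : y 0 = y ω}`. -/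
def invDomain (H : Type*) [NormedAddCommGroup H] [InnerProductSpace ℂ H] :
    Submodule ℂ (InvL2 ω H) where
  carrier := {y | ∃ Y D, IsSobolevRep y Y D ∧ Y 0 = Y ω}
  add_mem' := by
    rintro _ _ ⟨Y, D, h, p⟩ ⟨Y', D', h', p'⟩
    exact ⟨_, _, h.add h', by simp [p, p']⟩
  zero_mem' := ⟨_, _, IsSobolevRep.zero, rfl⟩
  smul_mem' := by
    rintro c _ ⟨Y, D, h, p⟩
    exact ⟨_, _, h.smul c, by simp [p]⟩

variable {ω}

/-- The continuous representative of an element of `D(L)`. -/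
noncomputable def invRep (y : invDomain ω H) : ℝ → H := y.2.choose

/-- The derivative `dy/ds ∈ L²` of an element `y` of `D(L)`. -/
noncomputable def invDeriv (y : invDomain ω H) : InvL2 ω H := y.2.choose_spec.choose

theorem invRep_spec (y : invDomain ω H) : IsSobolevRep (y : InvL2 ω H) (invRep y) (invDeriv y) :=
  y.2.choose_spec.choose_spec.1

/-- Strong measurability and square integrability of the potential: every function
`s ↦ 𝒱(s) x`, `x ∈ H`, belongs to `L²([0, ω], H)`. -/
def IsL2Potential (ω : ℝ) (V : ℝ → H →L[ℂ] H) : Prop :=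
  ∀ x : H, MemLp (fun s => V s x) 2 (invMeasure ω)

theorem measurePreserving_reflect (ω : ℝ) :
    MeasurePreserving (fun s => ω - s) (invMeasure ω) (invMeasure ω) := by
  have h := ((Measure.measurePreserving_sub_left (volume : Measure ℝ) ω).restrict_preimage
    (measurableSet_Icc (a := (0 : ℝ)) (b := ω)))
  have e : (fun s => ω - s) ⁻¹' Icc 0 ω = Icc 0 ω := by
    ext s; simp only [mem_preimage, mem_Icc]; constructor <;> rintro ⟨a, b⟩ <;>
      constructor <;> linarith
  rw [e] at h
  exact h.smul_measure _

/-- The function `s ↦ 𝒱(s) y(ω - s)` is in `L²` for `y ∈ D(L)`. -/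
theorem memLp_potential [FiniteDimensional ℂ H] {V : ℝ → H →L[ℂ] H} (hV : IsL2Potential ω V)
    (y : invDomain ω H) :
    MemLp (fun s => V s (invRep y (ω - s))) 2 (invMeasure ω) := by
  let b := Module.finBasis ℂ H
  have hc : ∀ i, MemLp (fun s => b.repr (invRep y (ω - s)) i) ⊤ (invMeasure ω) := by
    intro i
    have hφ : Continuous fun x : H => b.repr x i :=
      (LinearMap.continuous_of_finiteDimensional (b.coord i))
    have hcont : ContinuousOn (fun s => b.repr (invRep y s) i) (Icc 0 ω) :=
      hφ.comp_continuousOn (invRep_spec y).continuousOn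
    obtain ⟨C, hC⟩ := isCompact_Icc.exists_bound_of_continuousOn hcont
    have h1 : MemLp (fun s => b.repr (invRep y s) i) ⊤ (invMeasure ω) := by
      refine memLp_top_of_bound ?_ C ?_
      · exact (hcont.aestronglyMeasurable measurableSet_Icc).mono_ac (invMeasure_ac ω)
      · exact (invMeasure_ac ω).ae_le (ae_restrict_of_forall_mem measurableSet_Icc hC)
    exact h1.comp_measurePreserving (measurePreserving_reflect ω)
  have key : (fun s => V s (invRep y (ω - s))) =
      fun s => ∑ i, b.repr (invRep y (ω - s)) i • V s (b i) := by
    funext s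
    conv_lhs => rw [← b.sum_repr (invRep y (ω - s)), map_sum]
    simp only [map_smul]
  rw [key]
  exact memLp_finsetSum _ fun i _ => (hV (b i)).smul (hc i)

/-- The differential operator `L : D(L) ⊆ L² → L²`, `(L y)(s) = y'(s) - 𝒱(s) y(ω - s)`. -/
noncomputable def invOperator [FiniteDimensional ℂ H] (V : ℝ → H →L[ℂ] H)
    (hV : IsL2Potential ω V) : InvL2 ω H →ₗ.[ℂ] InvL2 ω H where
  domain := invDomain ω H
  toFun :=
    { toFun := fun y => invDeriv y - (memLp_potential hV y).toLp _
      map_add' := by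
        intro y z
        have := FiniteDimensional.complete ℂ H
        have h := (invRep_spec y).add (invRep_spec z)
        have h' := invRep_spec (y + z)
        have e : invDeriv (y + z) = invDeriv y + invDeriv z := h'.deriv_unique h
        have f := h'.rep_unique h
        have g : (memLp_potential hV (y + z)).toLp _ =
            (memLp_potential hV y).toLp _ + (memLp_potential hV z).toLp _ := by
          rw [← MemLp.toLp_add]
          refine MemLp.toLp_congr _ _ ((invMeasure_ac ω).ae_le
            (ae_restrict_of_forall_mem measurableSet_Icc fun s hs => ?_))
          have hs' : ω - s ∈ Icc 0 ω := ⟨by linarith [hs.2], by linarith [hs.1]⟩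
          simp [f hs']
        rw [e, g]; abel
      map_smul' := by
        intro c y
        have := FiniteDimensional.complete ℂ H
        have h := (invRep_spec y).smul c
        have h' := invRep_spec (c • y)
        have e : invDeriv (c • y) = c • invDeriv y := h'.deriv_unique h
        have f := h'.rep_unique h
        have g : (memLp_potential hV (c • y)).toLp _ = c • (memLp_potential hV y).toLp _ := by
          rw [← MemLp.toLp_const_smul]
          refine MemLp.toLp_congr _ _ ((invMeasure_ac ω).ae_le
            (ae_restrict_of_forall_mem measurableSet_Icc fun s hs => ?_))
          have hs' : ω - s ∈ Icc 0 ω := ⟨by linarith [hs.2], by linarith [hs.1]⟩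
          simp [f hs']
        rw [e, g, RingHom.id_apply, smul_sub] }

/-- `e^{-i (2πn/ω) s}`. -/
noncomputable def invChar (ω : ℝ) (n : ℤ) (s : ℝ) : ℂ :=
  Complex.exp (-(Complex.I * (2 * Real.pi * n / ω) * s))

theorem integrable_invChar_smul {V : ℝ → H →L[ℂ] H} (hV : IsL2Potential ω V) (n : ℤ) (x : H) :
    IntervalIntegrable (fun s => invChar ω n s • V s x) volume 0 ω := by
  have h1 : IntegrableOn (fun s => V s x) (Icc 0 ω) :=
    ((hV x).integrable (by norm_num)).of_invMeasure
  rw [← intervalIntegrable_iff_integrableOn_Icc_of_le hω.out.le] at h1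
  refine h1.continuousOn_smul (Continuous.continuousOn ?_)
  unfold invChar
  fun_prop

/-- The Fourier coefficient `𝒱̂(n) ∈ B(H)`,
`𝒱̂(n) x = (1/ω) ∫₀^ω 𝒱(s) x e^{-i (2πn/ω) s} ds`. -/
noncomputable def potentialCoeff [FiniteDimensional ℂ H] (V : ℝ → H →L[ℂ] H)
    (hV : IsL2Potential ω V) (n : ℤ) : H →L[ℂ] H :=
  LinearMap.toContinuousLinearMap
    { toFun := fun x => (1 / ω : ℂ) • ∫ s in (0 : ℝ)..ω, invChar ω n s • V s x
      map_add' := fun x y => by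
        simp only [map_add, smul_add]
        rw [intervalIntegral.integral_add (integrable_invChar_smul hV n x)
          (integrable_invChar_smul hV n y), smul_add]
      map_smul' := fun c x => by
        simp only [map_smul, smul_comm _ c, RingHom.id_apply]
        rw [intervalIntegral.integral_smul, smul_comm] }

/-- `∑ₙ ‖𝒱̂(n)‖² < ∞`. -/
def CoeffSqSummable [FiniteDimensional ℂ H] (V : ℝ → H →L[ℂ] H) (hV : IsL2Potential ω V) : Prop :=
  Summable fun n : ℤ => ‖potentialCoeff V hV n‖ ^ 2

/-- `∑_{j, ℓ} ‖∑_{n ≠ ℓ} 𝒱̂(j + n) 𝒱̂(ℓ + n) / (ℓ - n)‖² < ∞`. -/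
def CoeffProdSummable [FiniteDimensional ℂ H] (V : ℝ → H →L[ℂ] H)
    (hV : IsL2Potential ω V) : Prop :=
  Summable fun p : ℤ × ℤ => ‖∑' n : {n : ℤ // n ≠ p.2},
    ((p.2 - (n : ℤ) : ℤ) : ℂ)⁻¹ •
      (potentialCoeff V hV (p.1 + n) * potentialCoeff V hV (p.2 + n))‖ ^ 2

/-- Mild solutions `u ∈ C(ℝ, L²)` of `u_t = L u`, `u 0 = φ`. -/
structure IsMildSolution [FiniteDimensional ℂ H] (V : ℝ → H →L[ℂ] H) (hV : IsL2Potential ω V)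
    (φ : InvL2 ω H) (u : ℝ → InvL2 ω H) : Prop where
  continuous : Continuous u
  integral_eq : ∀ t : ℝ, ∃ h : (∫ τ in (0 : ℝ)..t, u τ) ∈ (invOperator V hV).domain,
    u t = φ + invOperator V hV ⟨∫ τ in (0 : ℝ)..t, u τ, h⟩

end Operator

/-- Bohr almost periodic functions `ℝ → E`: continuous functions whose set of `ε`-almost periods is
relatively dense for every `ε > 0`. -/
def IsBohrAlmostPeriodic {E : Type*} [NormedAddCommGroup E] (f : ℝ → E) : Prop :=
  Continuous f ∧ ∀ ε > 0, ∃ l > 0, ∀ a : ℝ, ∃ τ ∈ Icc a (a + l), ∀ t : ℝ, ‖f (t + τ) - f t‖ < ε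

/-! ### Operators given by coordinates, and Hilbert–Schmidt operators -/

section HilbertBasisOperators

open scoped InnerProductSpace

variable {ι E : Type*} [NormedAddCommGroup E] [InnerProductSpace ℂ E]

/-! Put κ = 2π/ω. In the Fourier basis L = A - B, where A is diagonal with eigenvalues iκn, each of
multiplicity dim H, and B is the block Hankel matrix with blocks 𝒱̂(m + n), known only through its
rows.

Since B need not be bounded, it is first traded for a Hilbert–Schmidt perturbation. The commutator
equation [A, X] = B - J is solved entrywise by dividing by differences of eigenvalues; J collects
the entries with equal eigenvalues and finitely many more, removed so that ‖X‖ ≤ 1/4. The first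
summability hypothesis makes X and J Hilbert–Schmidt, the second does this for K = BX. Formally (A -
B)(1 + X) = (1 + X)(A - C) with C = (1 + X)⁻¹(J + K), so v = (1 + X)⁻¹u is a bounded solution of v'
= (A - C)v, read coordinatewise (`exists_isHS_perturbation`, `exists_resolvent_intertwining`,
`exists_similar_solution`).

For such v the Laplace transform solves the resolvent equation of A - C, and that resolvent is
meromorphic (`exists_meromorphic_resolvent`). Boundedness of v allows only simple poles on the
imaginary axis; the residue at iθ is the Abel mean x_θ of e^{-iθt}v(t), an eigenvector or zero.
Bessel's inequality gives ∑‖x_θ‖² < ∞. This alone does not make ∑ e^{iθt}x_θ converge, since the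
eigenvectors need not be orthogonal. Grouping the θ by the nearest κm repairs this: as C is
Hilbert–Schmidt, all but finitely many groups contain at most dim H frequencies and are almost
orthogonal to each other (`card_cluster_le`, `norm_sq_sum_cluster_le`), so the grouped series
converges uniformly in t to a bounded solution W.

Finally v - W has vanishing Abel means, so its two-sided Laplace transform extends to an entire
function bounded by a constant over |Re z|; it must vanish (`IsCoordSolution.eq_zero_of_abelMean`).
Thus v is a uniform limit of trigonometric polynomials, and so is u = (1 + X)v. -/

theorem HilbertBasis.hasSum_norm_sq (b : HilbertBasis ι ℂ E) (x : E) :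
    HasSum (fun i => ‖⟪b i, x⟫_ℂ‖ ^ 2) (‖x‖ ^ 2) := by
  have h := b.hasSum_inner_mul_inner x x
  have h2 := (Complex.reCLM.hasSum h)
  convert! h2 using 1
  · funext i
    have : ⟪x, b i⟫_ℂ = (starRingEnd ℂ) ⟪b i, x⟫_ℂ := (inner_conj_symm _ _).symm
    simp only [this, Complex.reCLM_apply, ← Complex.normSq_eq_conj_mul_self,
      Complex.ofReal_re, Complex.normSq_eq_norm_sq]
  · rw [inner_self_eq_norm_sq_to_K]
    norm_cast

theorem HilbertBasis.ext_inner (b : HilbertBasis ι ℂ E) {x y : E}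
    (h : ∀ i, ⟪b i, x⟫_ℂ = ⟪b i, y⟫_ℂ) : x = y := by
  apply b.repr.injective
  ext i
  simpa [b.repr_apply_apply] using h i

/-- The vector with prescribed square-summable coordinates. -/
noncomputable def HilbertBasis.ofCoords (b : HilbertBasis ι ℂ E) (c : ι → ℂ)
    (hc : Summable fun i => ‖c i‖ ^ 2) : E :=
  b.repr.symm ⟨c, by
    apply memℓp_gen
    simpa using hc⟩

theorem HilbertBasis.inner_ofCoords (b : HilbertBasis ι ℂ E) (c : ι → ℂ)
    (hc : Summable fun i => ‖c i‖ ^ 2) (i : ι) : ⟪b i, b.ofCoords c hc⟫_ℂ = c i := by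
  rw [← b.repr_apply_apply]
  simp [HilbertBasis.ofCoords]

/-- A bounded linear functional on every coordinate, with a uniform bound, defines an operator. -/
theorem HilbertBasis.exists_operator (b : HilbertBasis ι ℂ E) (f : ι → E →ₗ[ℂ] ℂ) (K : ℝ)
    (hf : ∀ x (s : Finset ι), ∑ i ∈ s, ‖f i x‖ ^ 2 ≤ K ^ 2 * ‖x‖ ^ 2) (hK : 0 ≤ K) :
    ∃ T : E →L[ℂ] E, (∀ x i, ⟪b i, T x⟫_ℂ = f i x) ∧ ‖T‖ ≤ K := by
  have hs : ∀ x, Summable fun i => ‖f i x‖ ^ 2 := fun x =>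
    summable_of_sum_le (fun _ => by positivity) (hf x)
  let T₀ : E →ₗ[ℂ] E :=
    { toFun := fun x => b.ofCoords (fun i => f i x) (hs x)
      map_add' := fun x y => b.ext_inner fun i => by simp [b.inner_ofCoords]
      map_smul' := fun c x => b.ext_inner fun i => by simp [b.inner_ofCoords] }
  have hT : ∀ x i, ⟪b i, T₀ x⟫_ℂ = f i x := fun x i => b.inner_ofCoords _ (hs x) i
  have hb : ∀ x, ‖T₀ x‖ ≤ K * ‖x‖ := fun x => by
    refine le_of_sq_le_sq ?_ (by positivity)
    rw [mul_pow]
    refine hasSum_le_of_sum_le (b.hasSum_norm_sq (T₀ x)) fun s => ?_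
    simpa only [hT] using hf x s
  exact ⟨T₀.mkContinuous K hb, fun x i => hT x i, T₀.mkContinuous_norm_le hK hb⟩

theorem HilbertBasis.exists_diagonal (b : HilbertBasis ι ℂ E) (a : ι → ℂ) (K : ℝ) (hK : 0 ≤ K)
    (ha : ∀ i, ‖a i‖ ≤ K) :
    ∃ T : E →L[ℂ] E, (∀ x i, ⟪b i, T x⟫_ℂ = a i * ⟪b i, x⟫_ℂ) ∧ ‖T‖ ≤ K := by
  refine b.exists_operator (fun i => a i • (innerSL ℂ (b i)).toLinearMap) K (fun x s => ?_) hK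
  calc ∑ i ∈ s, ‖a i * ⟪b i, x⟫_ℂ‖ ^ 2 ≤ ∑ i ∈ s, K ^ 2 * ‖⟪b i, x⟫_ℂ‖ ^ 2 := by
        gcongr with i
        rw [norm_mul, mul_pow]
        gcongr
        exact ha i
    _ ≤ K ^ 2 * ‖x‖ ^ 2 := by
        rw [← Finset.mul_sum]
        gcongr
        exact b.orthonormal.sum_inner_products_le x

/-- Each row is a bounded functional by Riesz, and Cauchy–Schwarz row by row bounds the operator
norm by the Hilbert–Schmidt norm. Operators are later made small by making this double sum small. -/
theorem HilbertBasis.exists_matrix (b : HilbertBasis ι ℂ E) (M : ι → ι → ℂ)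
    (hM : Summable fun p : ι × ι => ‖M p.1 p.2‖ ^ 2) :
    ∃ T : E →L[ℂ] E, (∀ i j, ⟪b i, T (b j)⟫_ℂ = M i j) ∧
      ‖T‖ ≤ √(∑' p : ι × ι, ‖M p.1 p.2‖ ^ 2) := by
  have hrow : ∀ i, Summable fun j => ‖(starRingEnd ℂ) (M i j)‖ ^ 2 := fun i => by
    simpa using hM.prod_factor i
  let r : ι → E := fun i => b.ofCoords _ (hrow i)
  have hr : ∀ i, ‖r i‖ ^ 2 = ∑' j, ‖M i j‖ ^ 2 := fun i => by
    rw [← (b.hasSum_norm_sq (r i)).tsum_eq]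
    simp [r, b.inner_ofCoords]
  have hr' : Summable fun i => ‖r i‖ ^ 2 := by
    simp_rw [hr]; exact hM.prod
  have htot : ∑' i, ‖r i‖ ^ 2 = ∑' p : ι × ι, ‖M p.1 p.2‖ ^ 2 := by
    simp_rw [hr]; exact (hM.tsum_prod).symm
  obtain ⟨T, hT, hn⟩ := b.exists_operator (fun i => (innerSL ℂ (r i)).toLinearMap)
    (√(∑' p : ι × ι, ‖M p.1 p.2‖ ^ 2)) (fun x s => by
      rw [Real.sq_sqrt (tsum_nonneg fun _ => by positivity), ← htot]
      calc ∑ i ∈ s, ‖⟪r i, x⟫_ℂ‖ ^ 2 ≤ ∑ i ∈ s, ‖r i‖ ^ 2 * ‖x‖ ^ 2 := by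
            gcongr with i
            rw [← mul_pow]
            gcongr
            exact norm_inner_le_norm _ _
        _ ≤ _ := by
            rw [← Finset.sum_mul]
            gcongr
            exact hr'.sum_le_tsum _ fun _ _ => by positivity) (by positivity)
  refine ⟨T, fun i j => ?_, hn⟩
  rw [hT]
  change ⟪r i, b j⟫_ℂ = _
  rw [← inner_conj_symm, b.inner_ofCoords]
  simp

theorem HilbertBasis.operator_ext (b : HilbertBasis ι ℂ E) {S T : E →L[ℂ] E}
    (h : ∀ i j, ⟪b i, S (b j)⟫_ℂ = ⟪b i, T (b j)⟫_ℂ) : S = T := by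
  refine ContinuousLinearMap.ext_on (s := Set.range b) ?_ ?_
  · exact Submodule.dense_iff_topologicalClosure_eq_top.2 b.dense_span
  · rintro _ ⟨j, rfl⟩
    exact b.ext_inner fun i => h i j

/-- The Hilbert–Schmidt condition on an operator, in the orthonormal basis `b`. -/
def HilbertBasis.IsHS (b : HilbertBasis ι ℂ E) (T : E →L[ℂ] E) : Prop :=
  Summable fun p : ι × ι => ‖⟪b p.1, T (b p.2)⟫_ℂ‖ ^ 2

/-- Summed by columns, the Hilbert–Schmidt norm is ∑ ‖T b_j‖², and S enlarges each column by at most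
‖S‖. -/
theorem HilbertBasis.IsHS.comp_left {b : HilbertBasis ι ℂ E} {T : E →L[ℂ] E} (hT : b.IsHS T)
    (S : E →L[ℂ] E) : b.IsHS (S ∘L T) := by
  have h1 : Summable fun p : ι × ι => ‖⟪b p.2, T (b p.1)⟫_ℂ‖ ^ 2 := (Equiv.prodComm ι ι).summable_iff.2 hT
  refine (Equiv.prodComm ι ι).summable_iff.1 ?_
  refine (summable_prod_of_nonneg fun _ => sq_nonneg _).2 ⟨fun j => ?_, ?_⟩
  · exact (b.hasSum_norm_sq (S (T (b j)))).summable
  · have h2 : Summable fun j => ‖T (b j)‖ ^ 2 := by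
      have := h1.prod
      convert! this using 2 with j
      exact (b.hasSum_norm_sq (T (b j))).tsum_eq.symm
    refine Summable.of_nonneg_of_le (fun _ => tsum_nonneg fun _ => sq_nonneg _) (fun j => ?_)
      (h2.mul_left (‖S‖ ^ 2))
    have := (b.hasSum_norm_sq (S (T (b j)))).tsum_eq
    simp only [Equiv.prodComm_apply, Prod.swap, ContinuousLinearMap.comp_apply]
    rw [this, ← mul_pow]
    gcongr
    exact S.le_opNorm _

theorem HilbertBasis.IsHS.add {b : HilbertBasis ι ℂ E} {S T : E →L[ℂ] E} (hS : b.IsHS S)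
    (hT : b.IsHS T) : b.IsHS (S + T) := by
  refine Summable.of_nonneg_of_le (fun _ => by positivity) (fun p => ?_)
    ((Summable.add hS hT).mul_left 2)
  simp only [add_apply, inner_add_right]
  refine (pow_le_pow_left₀ (norm_nonneg _) (norm_add_le _ _) 2).trans ?_
  nlinarith [sq_nonneg (‖⟪b p.1, S (b p.2)⟫_ℂ‖ - ‖⟪b p.1, T (b p.2)⟫_ℂ‖)]

/-- Summation by rows. This is the form used for C: ‖C* b_i‖ bounds the i-th coordinate of C g by a
multiple of ‖g‖. -/
theorem HilbertBasis.IsHS.summable_adjoint [CompleteSpace E] {b : HilbertBasis ι ℂ E} {T : E →L[ℂ] E}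
    (hT : b.IsHS T) : Summable fun i => ‖ContinuousLinearMap.adjoint T (b i)‖ ^ 2 := by
  have := Summable.prod hT
  convert! this using 2 with i
  rw [← (b.hasSum_norm_sq _).tsum_eq]
  congr 1 with j
  rw [ContinuousLinearMap.adjoint_inner_right, ← inner_conj_symm, RCLike.norm_conj]

end HilbertBasisOperators

/-! ### Laplace transforms of bounded solutions -/

section Laplace

open scoped InnerProductSpace Topology
open Filter

variable {ι E : Type*} [NormedAddCommGroup E] [InnerProductSpace ℂ E]

/-- The coordinate form of `v' = (A - C) v`, where `A (b i) = I * w i • b i`. -/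
def IsCoordSolution (b : HilbertBasis ι ℂ E) (w : ι → ℝ) (C : E →L[ℂ] E) (v : ℝ → E) : Prop :=
  ∀ i t, HasDerivAt (fun t => ⟪b i, v t⟫_ℂ)
    (Complex.I * w i * ⟪b i, v t⟫_ℂ - ⟪b i, C (v t)⟫_ℂ) t

/-- The coordinate form of the resolvent equation `(z - A + C) f = y`. -/
def IsResolventSolution (b : HilbertBasis ι ℂ E) (w : ι → ℝ) (C : E →L[ℂ] E) (z : ℂ)
    (y f : E) : Prop :=
  ∀ i, (z - Complex.I * w i) * ⟪b i, f⟫_ℂ + ⟪b i, C f⟫_ℂ = ⟪b i, y⟫_ℂ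

/-- The Laplace transform. -/
noncomputable def laplaceTransform (v : ℝ → E) (z : ℂ) : E :=
  ∫ t in Ioi (0 : ℝ), Complex.exp (-z * t) • v t

theorem norm_exp_neg_mul (z : ℂ) (t : ℝ) : ‖Complex.exp (-z * t)‖ = Real.exp (-z.re * t) := by
  rw [Complex.norm_exp]; simp

theorem integrableOn_laplace {v : ℝ → E} (hv : Continuous v) {K : ℝ} (hK : ∀ t, ‖v t‖ ≤ K)
    {z : ℂ} (hz : 0 < z.re) :
    IntegrableOn (fun t : ℝ => Complex.exp (-z * t) • v t) (Ioi 0) := by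
  have h1 : IntegrableOn (fun t : ℝ => Real.exp (-z.re * t) * K) (Ioi 0) :=
    (integrableOn_exp_mul_Ioi (by linarith) 0).mul_const K
  refine Integrable.mono' h1 (by fun_prop) (ae_of_all _ fun t => ?_)
  rw [norm_smul, norm_exp_neg_mul]
  gcongr
  exact hK t

theorem norm_laplaceTransform_le {v : ℝ → E} {K : ℝ} (hK : ∀ t, ‖v t‖ ≤ K)
    {z : ℂ} (hz : 0 < z.re) : ‖laplaceTransform v z‖ ≤ K / z.re := by
  have h1 : IntegrableOn (fun t : ℝ => Real.exp (-z.re * t) * K) (Ioi 0) :=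
    (integrableOn_exp_mul_Ioi (by linarith) 0).mul_const K
  refine (norm_integral_le_of_norm_le h1 (ae_of_all _ fun t => ?_)).trans_eq ?_
  · rw [norm_smul, norm_exp_neg_mul]
    gcongr
    exact hK t
  · rw [integral_mul_const, integral_exp_mul_Ioi (by linarith)]
    simp
    field_simp

theorem laplaceTransform_sub {u v : ℝ → E} (hu : Continuous u) {K : ℝ} (hK : ∀ t, ‖u t‖ ≤ K)
    (hv : Continuous v) {K' : ℝ} (hK' : ∀ t, ‖v t‖ ≤ K') {z : ℂ} (hz : 0 < z.re) :
    laplaceTransform (fun t => u t - v t) z = laplaceTransform u z - laplaceTransform v z := by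
  unfold laplaceTransform
  rw [← integral_sub (integrableOn_laplace hu hK hz) (integrableOn_laplace hv hK' hz)]
  simp only [smul_sub]

theorem laplaceTransform_exp_smul [CompleteSpace E] (θ : ℝ) (x : E) {z : ℂ} (hz : 0 < z.re) :
    laplaceTransform (fun t => Complex.exp (Complex.I * θ * t) • x) z
      = (z - Complex.I * θ)⁻¹ • x := by
  unfold laplaceTransform
  have h : ∀ t : ℝ, Complex.exp (-z * t) • Complex.exp (Complex.I * θ * t) • x =
      Complex.exp ((Complex.I * θ - z) * t) • x := fun t => by
    rw [smul_smul, ← Complex.exp_add]; ring_nf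
  simp only [h]
  rw [integral_smul_const, integral_exp_mul_complex_Ioi (by simpa using hz)]
  congr 1
  simp only [Complex.ofReal_zero, mul_zero, Complex.exp_zero]
  rw [← neg_sub z, neg_div_neg_eq, one_div]

theorem laplaceTransform_sum {κ : Type*} (s : Finset κ) {v : κ → ℝ → E}
    (hv : ∀ k ∈ s, Continuous (v k)) (hK : ∀ k ∈ s, ∃ K, ∀ t, ‖v k t‖ ≤ K)
    {z : ℂ} (hz : 0 < z.re) :
    laplaceTransform (fun t => ∑ k ∈ s, v k t) z = ∑ k ∈ s, laplaceTransform (v k) z := by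
  unfold laplaceTransform
  rw [← integral_finsetSum _ fun k hk => integrableOn_laplace (hv k hk) (hK k hk).choose_spec hz]
  simp only [Finset.smul_sum]

/-- Integrate the derivative of e^{-zt}⟪b_i, v(t)⟫ over the half-line; boundedness of v kills the
term at infinity, and the term at 0 gives the right-hand side. -/
theorem IsCoordSolution.laplace [CompleteSpace E] {b : HilbertBasis ι ℂ E} {w : ι → ℝ}
    {C : E →L[ℂ] E} {v : ℝ → E} (h : IsCoordSolution b w C v) (hv : Continuous v) {K : ℝ}
    (hK : ∀ t, ‖v t‖ ≤ K) {z : ℂ} (hz : 0 < z.re) :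
    IsResolventSolution b w C z (v 0) (laplaceTransform v z) := by
  intro i
  have hint := integrableOn_laplace hv hK hz
  have hd : ∀ t ∈ Ioi (0 : ℝ), HasDerivAt (fun t : ℝ => Complex.exp (-z * t) * ⟪b i, v t⟫_ℂ)
      (Complex.exp (-z * t) * (-z * 1) * ⟪b i, v t⟫_ℂ + Complex.exp (-z * t) *
        (Complex.I * w i * ⟪b i, v t⟫_ℂ - ⟪b i, C (v t)⟫_ℂ)) t := fun t _ => by
    refine HasDerivAt.mul ?_ (h i t)
    have h0 : HasDerivAt (fun t : ℝ => (t : ℂ)) 1 t := Complex.ofRealCLM.hasDerivAt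
    exact (h0.const_mul (-z)).cexp
  have e1 : ⟪b i, laplaceTransform v z⟫_ℂ = ∫ t in Ioi (0 : ℝ), Complex.exp (-z * t) * ⟪b i, v t⟫_ℂ := by
    have := (innerSL ℂ (b i)).integral_comp_comm hint
    simpa [inner_smul_right, laplaceTransform] using this.symm
  have e2 : ⟪b i, C (laplaceTransform v z)⟫_ℂ =
      ∫ t in Ioi (0 : ℝ), Complex.exp (-z * t) * ⟪b i, C (v t)⟫_ℂ := by
    have := (innerSL ℂ (b i) ∘L C).integral_comp_comm hint
    simpa [inner_smul_right, laplaceTransform] using this.symm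
  have i1 : IntegrableOn (fun t : ℝ => Complex.exp (-z * t) * ⟪b i, v t⟫_ℂ) (Ioi 0) := by
    simpa [inner_smul_right, IntegrableOn] using (innerSL ℂ (b i)).integrable_comp hint
  have i2 : IntegrableOn (fun t : ℝ => Complex.exp (-z * t) * ⟪b i, C (v t)⟫_ℂ) (Ioi 0) := by
    simpa [inner_smul_right, IntegrableOn] using (innerSL ℂ (b i) ∘L C).integrable_comp hint
  have hderiv : ∀ t : ℝ, (Complex.exp (-z * t) * (-z * 1) * ⟪b i, v t⟫_ℂ + Complex.exp (-z * t) *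
        (Complex.I * w i * ⟪b i, v t⟫_ℂ - ⟪b i, C (v t)⟫_ℂ)) =
      (Complex.I * w i - z) * (Complex.exp (-z * t) * ⟪b i, v t⟫_ℂ) -
        Complex.exp (-z * t) * ⟪b i, C (v t)⟫_ℂ := fun t => by ring
  have lim : Tendsto (fun t : ℝ => Complex.exp (-z * t) * ⟪b i, v t⟫_ℂ) atTop (𝓝 0) := by
    rw [tendsto_zero_iff_norm_tendsto_zero]
    have l1 : Tendsto (fun t : ℝ => Real.exp (-z.re * t) * K) atTop (𝓝 (0 * K)) := by
      refine Tendsto.mul_const K (Real.tendsto_exp_atBot.comp ?_)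
      exact tendsto_id.const_mul_atTop_of_neg (by linarith)
    rw [zero_mul] at l1
    refine squeeze_zero (fun _ => norm_nonneg _) (fun t => ?_) l1
    rw [norm_mul, norm_exp_neg_mul]
    gcongr
    refine (norm_inner_le_norm _ _).trans ?_
    rw [b.orthonormal.1 i, one_mul]
    exact hK t
  have key := integral_Ioi_of_hasDerivAt_of_tendsto (m := 0) (a := 0)
    (by fun_prop) hd (by simp only [hderiv]; exact (i1.const_mul _).sub i2) lim
  simp only [hderiv] at key
  rw [integral_sub (i1.const_mul _) i2, integral_const_mul, ← e1, ← e2] at key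
  simp at key
  linear_combination -key

/-- Time reversal carries the one-sided transform over to the left half-plane. -/
theorem IsCoordSolution.reverse {b : HilbertBasis ι ℂ E} {w : ι → ℝ} {C : E →L[ℂ] E} {v : ℝ → E}
    (h : IsCoordSolution b w C v) :
    IsCoordSolution b (fun i => -w i) (-C) (fun t => v (-t)) := by
  intro i t
  have h1 := (h i (-t)).scomp t (hasDerivAt_neg t)
  convert! h1 using 1
  simp
  ring

theorem IsCoordSolution.translate {b : HilbertBasis ι ℂ E} {w : ι → ℝ} {C : E →L[ℂ] E} {v : ℝ → E}
    (h : IsCoordSolution b w C v) (s : ℝ) : IsCoordSolution b w C (fun t => v (t + s)) :=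
  fun i t => (h i (t + s)).comp_add_const t s

theorem IsCoordSolution.sub {b : HilbertBasis ι ℂ E} {w : ι → ℝ} {C : E →L[ℂ] E} {u v : ℝ → E}
    (hu : IsCoordSolution b w C u) (hv : IsCoordSolution b w C v) :
    IsCoordSolution b w C (fun t => u t - v t) := by
  intro i t
  simp only [inner_sub_right, map_sub]
  convert! (hu i t).sub (hv i t) using 1
  ring

theorem IsCoordSolution.sum {b : HilbertBasis ι ℂ E} {w : ι → ℝ} {C : E →L[ℂ] E} {κ : Type*}
    (s : Finset κ) {v : κ → ℝ → E} (hv : ∀ k ∈ s, IsCoordSolution b w C (v k)) :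
    IsCoordSolution b w C (fun t => ∑ k ∈ s, v k t) := by
  intro i t
  simp only [inner_sum, map_sum, Finset.mul_sum, ← Finset.sum_sub_distrib]
  exact HasDerivAt.fun_sum fun k hk => hv k hk i t

/-- An eigenvector of `A - C` for the eigenvalue `I * θ` generates a solution. -/
theorem IsResolventSolution.isCoordSolution {b : HilbertBasis ι ℂ E} {w : ι → ℝ} {C : E →L[ℂ] E}
    {θ : ℝ} {x : E} (h : IsResolventSolution b w C (Complex.I * θ) 0 x) :
    IsCoordSolution b w C (fun t => Complex.exp (Complex.I * θ * t) • x) := by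
  intro i t
  simp only [inner_smul_right, map_smul]
  have h0 : HasDerivAt (fun t : ℝ => (t : ℂ)) 1 t := Complex.ofRealCLM.hasDerivAt
  convert! ((h0.const_mul (Complex.I * θ)).cexp).mul_const ⟪b i, x⟫_ℂ using 1
  have := h i
  rw [inner_zero_right] at this
  linear_combination (-Complex.exp (Complex.I * θ * t)) * this

/-- The two-sided (Carleman) transform of a bounded solution solves the resolvent equation off the
imaginary axis. -/
theorem IsCoordSolution.exists_carleman [CompleteSpace E] {b : HilbertBasis ι ℂ E} {w : ι → ℝ}
    {C : E →L[ℂ] E} {v : ℝ → E} (h : IsCoordSolution b w C v) (hv : Continuous v) {K : ℝ}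
    (hK : ∀ t, ‖v t‖ ≤ K) :
    ∃ F : ℂ → E, (∀ z : ℂ, z.re ≠ 0 → ‖F z‖ ≤ K / |z.re| ∧ IsResolventSolution b w C z (v 0) (F z)) ∧
      ∀ z : ℂ, 0 < z.re → F z = laplaceTransform v z := by
  -- On the left this is -∫₀^∞ e^{zt} v(-t) dt, the sign being the one for which both halves solve
  -- the same equation. The values on the imaginary axis play no role.
  refine ⟨fun z => if 0 < z.re then laplaceTransform v z
    else - laplaceTransform (fun t => v (-t)) (-z), fun z hz => ?_, fun z hz => if_pos hz⟩
  beta_reduce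
  by_cases h0 : 0 < z.re
  · rw [if_pos h0, abs_of_pos h0]
    exact ⟨norm_laplaceTransform_le hK h0, h.laplace hv hK h0⟩
  · have h1 : z.re < 0 := lt_of_le_of_ne (not_lt.1 h0) hz
    have h2 : 0 < (-z).re := by simpa using h1
    rw [if_neg h0, abs_of_neg h1, norm_neg]
    refine ⟨norm_laplaceTransform_le (fun t => hK (-t)) h2, fun i => ?_⟩
    have := h.reverse.laplace (by fun_prop) (fun t => hK (-t)) h2 i
    simp only [neg_zero, neg_apply, inner_neg_right, Complex.ofReal_neg, map_neg] at this ⊢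
    linear_combination this

end Laplace

/-! ### The resolvent of `A - C` is meromorphic -/

section MeromorphicResolvent

open scoped InnerProductSpace Topology
open Filter

theorem Matrix.analyticAt_det {n : Type*} [Fintype n] [DecidableEq n] {M : ℂ → Matrix n n ℂ} {z : ℂ}
    (hM : ∀ i j, AnalyticAt ℂ (fun z => M z i j) z) : AnalyticAt ℂ (fun z => (M z).det) z := by
  simp only [Matrix.det_apply']
  exact Finset.analyticAt_fun_sum _ fun σ _ =>
    analyticAt_const.mul (Finset.analyticAt_fun_prod _ fun i _ => hM _ _)

theorem Matrix.analyticAt_adjugate {n : Type*} [Fintype n] [DecidableEq n] {M : ℂ → Matrix n n ℂ}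
    {z : ℂ} (hM : ∀ i j, AnalyticAt ℂ (fun z => M z i j) z) (i j : n) :
    AnalyticAt ℂ (fun z => (M z).adjugate i j) z := by
  simp only [Matrix.adjugate_apply]
  refine Matrix.analyticAt_det fun k l => ?_
  by_cases h : k = j
  · simp only [Matrix.updateRow_apply, h, if_true]
    exact analyticAt_const
  · simp only [Matrix.updateRow_apply, h, if_false]
    exact hM k l

theorem AnalyticAt.continuousLinearMap_apply {F : Type*} [NormedAddCommGroup F] [NormedSpace ℂ F]
    {S : ℂ → F →L[ℂ] F} {g : ℂ → F} {z : ℂ} (hS : AnalyticAt ℂ S z) (hg : AnalyticAt ℂ g z) :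
    AnalyticAt ℂ (fun z => S z (g z)) z :=
  ((ContinuousLinearMap.id ℂ (F →L[ℂ] F)).analyticAt_bilinear (S z, g z)).comp₂ hS hg

variable {ι E : Type*} [NormedAddCommGroup E] [InnerProductSpace ℂ E]

/-- Since w is real, |Re z| ≤ |z - i w_i| in every coordinate. Hence eigenvalues satisfy |Re z| ≤
‖C‖. -/
theorem IsResolventSolution.norm_le {b : HilbertBasis ι ℂ E} {w : ι → ℝ} {C : E →L[ℂ] E} {z : ℂ}
    {x : E} (h : IsResolventSolution b w C z 0 x) : |z.re| * ‖x‖ ≤ ‖C‖ * ‖x‖ := by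
  refine le_trans ?_ (C.le_opNorm x)
  refine le_of_sq_le_sq ?_ (by positivity)
  rw [mul_pow]
  refine hasSum_le (fun i => ?_) ((b.hasSum_norm_sq x).mul_left (|z.re| ^ 2)) (b.hasSum_norm_sq (C x))
  have := h i
  rw [inner_zero_right, add_comm, add_eq_zero_iff_eq_neg] at this
  rw [this, norm_neg, norm_mul, mul_pow]
  gcongr
  simpa using Complex.abs_re_le_norm (z - Complex.I * w i)

/-- Schur complement: on a ball only the finitely many coordinates with small |w_i| can obstruct
solvability. The others are eliminated by a Neumann series, which leaves a finite system M(z)p =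
r(z) with analytic entries. Then d = det M detects eigenvalues, and Cramer's rule writes every
solution as an analytic function divided by d. -/
theorem exists_meromorphic_resolvent [CompleteSpace E] (b : HilbertBasis ι ℂ E) (w : ι → ℝ)
    (C : E →L[ℂ] E) (hw : ∀ K, {i | |w i| ≤ K}.Finite) {R : ℝ} (hR : 0 < R) :
    ∃ d : ℂ → ℂ, AnalyticOnNhd ℂ d (Metric.ball 0 R) ∧
      (∀ z ∈ Metric.ball (0 : ℂ) R, ‖C‖ < z.re → d z ≠ 0) ∧
      (∀ z ∈ Metric.ball (0 : ℂ) R, ∀ x ≠ 0, IsResolventSolution b w C z 0 x → d z = 0) ∧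
      ∀ y : E, ∃ G : ℂ → E, MeromorphicOn G (Metric.ball 0 R) ∧
        ∀ z ∈ Metric.ball (0 : ℂ) R, d z ≠ 0 → AnalyticAt ℂ G z ∧
          ∀ f, IsResolventSolution b w C z y f → f = G z := by
  classical
  have hC := norm_nonneg C
  set J : Finset ι := (hw (2 * (R + ‖C‖))).toFinset with hJ
  have hJm : ∀ i, i ∉ J → 2 * (R + ‖C‖) < |w i| := fun i hi => by
    simpa [hJ] using hi
  -- D inverts -A off J and vanishes on J. The cutoff 2(R + ‖C‖) in J makes ‖zD + DC‖ at most 1/2 on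
  -- the ball, so N(z) = 1 + zD + DC is invertible there.
  obtain ⟨D, hD, hDn⟩ := b.exists_diagonal (fun i => if i ∈ J then 0 else Complex.I / w i)
    (1 / (2 * (R + ‖C‖))) (by positivity) (fun i => by
      split_ifs with h
      · simp; positivity
      · have := hJm i h
        simp only [norm_div, Complex.norm_I, Complex.norm_real, Real.norm_eq_abs]
        gcongr)
  let N : ℂ → E →L[ℂ] E := fun z => 1 + (z • D + D * C)
  have hN : ∀ z ∈ Metric.ball (0 : ℂ) R, IsUnit (N z) := fun z hz => by
    have h1 : ‖-(z • D + D * C)‖ < 1 := by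
      rw [norm_neg]
      have hz' : ‖z‖ < R := by simpa using hz
      calc ‖z • D + D * C‖ ≤ ‖z‖ * ‖D‖ + ‖D‖ * ‖C‖ :=
            (norm_add_le _ _).trans (add_le_add (norm_smul_le _ _) (norm_mul_le _ _))
        _ = (‖z‖ + ‖C‖) * ‖D‖ := by ring
        _ ≤ (R + ‖C‖) * (1 / (2 * (R + ‖C‖))) := by gcongr
        _ = 1 / 2 := by field_simp
        _ < 1 := by norm_num
    have h2 := isUnit_one_sub_of_norm_lt_one h1
    rwa [sub_neg_eq_add] at h2
  let S : ℂ → E →L[ℂ] E := fun z => Ring.inverse (N z)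
  have hS : ∀ z ∈ Metric.ball (0 : ℂ) R, AnalyticAt ℂ S z := fun z hz => by
    obtain ⟨u, hu⟩ := hN z hz
    have h1 : AnalyticAt ℂ N z := by
      refine analyticAt_const.add ((analyticAt_id.smul analyticAt_const).add analyticAt_const)
    refine AnalyticAt.comp (g := Ring.inverse) ?_ h1
    rw [← hu]
    exact analyticAt_inverse u
  have hNS : ∀ z ∈ Metric.ball (0 : ℂ) R, ∀ x, N z (S z x) = x := fun z hz x => by
    change (N z * S z) x = x
    rw [Ring.mul_inverse_cancel _ (hN z hz)]; rfl
  have hSN : ∀ z ∈ Metric.ball (0 : ℂ) R, ∀ x, S z (N z x) = x := fun z hz x => by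
    change (S z * N z) x = x
    rw [Ring.inverse_mul_cancel _ (hN z hz)]; rfl
  have hNc : ∀ z x i, ⟪b i, N z x⟫_ℂ = ⟪b i, x⟫_ℂ +
      (if i ∈ J then 0 else Complex.I / w i) * (z * ⟪b i, x⟫_ℂ + ⟪b i, C x⟫_ℂ) := fun z x i => by
    have : N z x = x + (z • D x + D (C x)) := rfl
    rw [this, inner_add_right, inner_add_right, inner_smul_right, hD, hD]
    ring
  -- The J-rows of the resolvent equation after substituting f = S(z)(Dy + ∑ f_j b_j), the sum
  -- running over J.
  let M : ℂ → Matrix J J ℂ := fun z i j =>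
    (if i = j then z - Complex.I * w i else 0) + ⟪b i, C (S z (b j))⟫_ℂ
  let r : E → ℂ → J → ℂ := fun y z i => ⟪b i, y⟫_ℂ - ⟪b i, C (S z (D y))⟫_ℂ
  have hSx : ∀ (i : ι) (x : E), ∀ z ∈ Metric.ball (0 : ℂ) R,
      AnalyticAt ℂ (fun z => ⟪b i, C (S z x)⟫_ℂ) z := fun i x z hz =>
    ((innerSL ℂ (b i) ∘L C).analyticAt _).comp ((hS z hz).continuousLinearMap_apply analyticAt_const)
  have hMa : ∀ z ∈ Metric.ball (0 : ℂ) R, ∀ i j, AnalyticAt ℂ (fun z => M z i j) z :=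
    fun z hz i j => by
      refine AnalyticAt.add ?_ (hSx _ _ z hz)
      split_ifs
      · exact analyticAt_id.sub analyticAt_const
      · exact analyticAt_const
  -- a solution of the resolvent equation is determined by its coordinates in `J`
  have hsol : ∀ z ∈ Metric.ball (0 : ℂ) R, ∀ y f, IsResolventSolution b w C z y f →
      f = S z (D y + ∑ j : J, ⟪b j, f⟫_ℂ • b j) := fun z hz y f h => by
    rw [← hSN z hz f]
    congr 1
    rw [hSN z hz f]
    refine b.ext_inner fun i => ?_
    rw [hNc, inner_add_right, hD, inner_sum]
    simp only [inner_smul_right, orthonormal_iff_ite.1 b.orthonormal]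
    by_cases hi : i ∈ J
    · rw [Finset.sum_eq_single ⟨i, hi⟩]
      · simp [hi]
      · intro j _ hj
        have : i ≠ j := fun e => hj (Subtype.ext e.symm)
        simp [this]
      · simp
    · rw [Finset.sum_eq_zero]
      · have hwi : (w i : ℂ) ≠ 0 := by
          have := hJm i hi
          intro h0
          rw [Complex.ofReal_eq_zero.1 h0] at this
          simp at this
          linarith
        have := h i
        simp only [hi, if_false]
        rw [← this]
        field_simp
        linear_combination (w i * ⟪b i, f⟫_ℂ) * Complex.I_sq
      · intro j _
        have : i ≠ j := fun e => hi (e ▸ j.2)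
        simp [this]
  have hmv : ∀ z ∈ Metric.ball (0 : ℂ) R, ∀ y f, IsResolventSolution b w C z y f →
      (M z).mulVec (fun j : J => ⟪b j, f⟫_ℂ) = r y z := fun z hz y f h => by
    funext i
    have h1 := h i
    have h2 : ⟪b i, C f⟫_ℂ = ⟪b i, C (S z (D y))⟫_ℂ +
        ∑ j : J, ⟪b j, f⟫_ℂ * ⟪b i, C (S z (b j))⟫_ℂ := by
      conv_lhs => rw [hsol z hz y f h]
      simp only [map_add, map_sum, map_smul, inner_add_right, inner_sum, inner_smul_right]
    simp only [Matrix.mulVec, dotProduct, M, add_mul, ite_mul, zero_mul, Finset.sum_add_distrib,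
      Finset.sum_ite_eq, Finset.mem_univ, if_true, r]
    rw [← h1, h2]
    simp only [mul_comm ⟪b _, f⟫_ℂ]
    ring
  -- Conversely, a kernel vector p of M(z) consists of the J-coordinates of x = S(z)(∑ p_j b_j),
  -- which solves the homogeneous equation.
  have heig : ∀ z ∈ Metric.ball (0 : ℂ) R, ∀ p : J → ℂ, (M z).mulVec p = 0 →
      (∀ x, IsResolventSolution b w C z 0 x → x = 0) → p = 0 := fun z hz p hp hx => by
    set x := S z (∑ j : J, p j • b j) with hxdef
    have hNx : ∀ i, ⟪b i, N z x⟫_ℂ = ∑ j : J, p j * ⟪b i, b j⟫_ℂ := fun i => by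
      rw [hxdef, hNS z hz, inner_sum]
      simp only [inner_smul_right]
    have hxJ : ∀ i : J, ⟪b i, x⟫_ℂ = p i := fun i => by
      have := hNx i
      rw [hNc] at this
      simp only [i.2, if_true, zero_mul, add_zero] at this
      rw [this, Finset.sum_eq_single i]
      · simp [b.orthonormal.1]
      · intro j _ hj
        rw [b.orthonormal.2 (fun e => hj (Subtype.ext e.symm)), mul_zero]
      · simp
    have : x = 0 := hx x fun i => by
      rw [inner_zero_right]
      by_cases hi : i ∈ J
      · have h1 := congrFun hp ⟨i, hi⟩
        have h2 : ⟪b i, C x⟫_ℂ = ∑ j : J, p j * ⟪b i, C (S z (b j))⟫_ℂ := by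
          simp only [hxdef, map_sum, map_smul, inner_sum, inner_smul_right]
        simp only [Matrix.mulVec, dotProduct, M, add_mul, ite_mul, zero_mul, Finset.sum_add_distrib,
          Finset.sum_ite_eq, Finset.mem_univ, if_true, Pi.zero_apply] at h1
        rw [h2, hxJ ⟨i, hi⟩, ← h1]
        simp only [mul_comm (p _)]
      · have h1 := hNx i
        rw [hNc, Finset.sum_eq_zero] at h1
        · have hwi : (w i : ℂ) ≠ 0 := by
            have := hJm i hi
            intro h0
            rw [Complex.ofReal_eq_zero.1 h0] at this
            simp at this
            linarith
          simp only [hi, if_false] at h1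
          field_simp at h1
          linear_combination (-Complex.I) * h1 + (z * ⟪b i, x⟫_ℂ + ⟪b i, C x⟫_ℂ) * Complex.I_sq
        · intro j _
          have : i ≠ j := fun e => hi (e ▸ j.2)
          rw [b.orthonormal.2 this, mul_zero]
    funext i
    rw [← hxJ, this, inner_zero_right]; rfl
  refine ⟨fun z => (M z).det, fun z hz => Matrix.analyticAt_det (hMa z hz), fun z hz hzre h0 => ?_,
    fun z hz x hx h => ?_, fun y => ?_⟩
  · obtain ⟨p, hp, hp0⟩ := Matrix.exists_mulVec_eq_zero_iff.2 h0
    refine hp (heig z hz p hp0 fun x hx => ?_)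
    by_contra hne
    have := hx.norm_le
    have h3 := le_of_mul_le_mul_right this (norm_pos_iff.2 hne)
    exact absurd (hzre.trans_le (le_abs_self _)) (not_lt.2 h3)
  · refine Matrix.exists_mulVec_eq_zero_iff.1 ⟨fun j => ⟪b j, x⟫_ℂ, fun h0 => hx ?_, ?_⟩
    · rw [hsol z hz 0 x h]
      simp [congrFun h0]
    · rw [hmv z hz 0 x h]
      funext i
      simp [r]
  · let G₀ : ℂ → E := fun z => ∑ i : J, ((M z).adjugate.mulVec (r y z)) i • b i
    let G : ℂ → E := fun z => S z (D y) + ((M z).det)⁻¹ • S z (G₀ z)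
    have hG₀ : ∀ z ∈ Metric.ball (0 : ℂ) R, AnalyticAt ℂ G₀ z := fun z hz => by
      refine Finset.analyticAt_fun_sum _ fun i _ => AnalyticAt.smul ?_ analyticAt_const
      simp only [Matrix.mulVec, dotProduct]
      exact Finset.analyticAt_fun_sum _ fun j _ => (Matrix.analyticAt_adjugate (hMa z hz) i j).mul
        (analyticAt_const.sub (hSx _ _ z hz))
    refine ⟨G, fun z hz => ?_, fun z hz hd => ⟨?_, fun f hf => ?_⟩⟩
    · exact ((hS z hz).continuousLinearMap_apply analyticAt_const).meromorphicAt.add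
        ((Matrix.analyticAt_det (hMa z hz)).meromorphicAt.inv.smul
          ((hS z hz).continuousLinearMap_apply (hG₀ z hz)).meromorphicAt)
    · exact ((hS z hz).continuousLinearMap_apply analyticAt_const).add
        (((Matrix.analyticAt_det (hMa z hz)).inv hd).smul
          ((hS z hz).continuousLinearMap_apply (hG₀ z hz)))
    · have h1 : (fun j : J => ⟪b j, f⟫_ℂ) = ((M z).det)⁻¹ • (M z).adjugate.mulVec (r y z) := by
        rw [← hmv z hz y f hf, Matrix.mulVec_mulVec, Matrix.adjugate_mul, Matrix.smul_mulVec,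
          Matrix.one_mulVec, smul_smul, inv_mul_cancel₀ hd, one_smul]
      rw [hsol z hz y f hf]
      simp only [G, G₀, map_add, ← map_smul]
      congr 2
      rw [Finset.smul_sum]
      refine Finset.sum_congr rfl fun i _ => ?_
      rw [smul_smul, congrFun h1 i]; rfl

end MeromorphicResolvent

/-! ### Abel means and uniqueness of bounded solutions -/

section AbelMeans

open scoped InnerProductSpace Topology
open Filter

variable {ι E : Type*} [NormedAddCommGroup E] [InnerProductSpace ℂ E]

theorem tendsto_add_ofReal_nhdsNE (z : ℂ) :
    Tendsto (fun σ : ℝ => z + σ) (𝓝[>] 0) (𝓝[≠] z) := by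
  refine tendsto_nhdsWithin_iff.2 ⟨?_, ?_⟩
  · have : Tendsto (fun σ : ℝ => z + σ) (𝓝 0) (𝓝 (z + (0 : ℝ))) :=
      Continuous.tendsto (by fun_prop) _
    simp only [Complex.ofReal_zero, add_zero] at this
    exact this.mono_left nhdsWithin_le_nhds
  · filter_upwards [self_mem_nhdsWithin] with σ hσ
    have : (σ : ℂ) ≠ 0 := by exact_mod_cast (ne_of_gt hσ)
    simpa using this

/-- A meromorphic function which is `O(1/σ)` along a ray has at most a simple pole, which is absent
if the function is `o(1/σ)` along the ray. -/
theorem MeromorphicAt.exists_tendsto_of_bound {f : ℂ → E} {z : ℂ} (hf : MeromorphicAt f z) {K : ℝ}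
    (hK : ∀ᶠ σ : ℝ in 𝓝[>] 0, ‖(σ : ℂ) • f (z + σ)‖ ≤ K) :
    ∃ x, Tendsto (fun σ : ℝ => (σ : ℂ) • f (z + σ)) (𝓝[>] 0) (𝓝 x) ∧
      (x = 0 → 0 ≤ meromorphicOrderAt f z) := by
  let H : ℂ → E := (fun s => s - z) • f
  have hH1 : MeromorphicAt (fun s : ℂ => s - z) z := by fun_prop
  have hH : MeromorphicAt H z := hH1.smul hf
  have hτ := tendsto_add_ofReal_nhdsNE z
  have hHτ : ∀ σ : ℝ, H (z + σ) = (σ : ℂ) • f (z + σ) := fun σ => by simp [H]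
  have h0 : 0 ≤ meromorphicOrderAt H z := by
    by_contra hneg
    have h1 := (tendsto_cobounded_of_meromorphicOrderAt_neg (not_le.1 hneg)).comp hτ
    rw [← tendsto_norm_atTop_iff_cobounded] at h1
    obtain ⟨σ, h2, h3⟩ := (hK.and (h1.eventually_gt_atTop K)).exists
    simp only [Function.comp_apply, hHτ] at h3
    linarith
  obtain ⟨x, hx⟩ := tendsto_nhds_of_meromorphicOrderAt_nonneg hH h0
  have hx' := hx.comp hτ
  simp only [Function.comp_def, hHτ] at hx'
  refine ⟨x, hx', fun hx0 => ?_⟩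
  rw [hx0] at hx
  have h1 := (tendsto_zero_iff_meromorphicOrderAt_pos hH).1 hx
  rw [meromorphicOrderAt_smul hH1 hf, meromorphicOrderAt_id_sub_const] at h1
  cases h : meromorphicOrderAt f z with
  | top => exact le_top
  | coe n =>
    rw [h] at h1
    norm_cast at h1 ⊢
    omega

/-- `x` is the Abel mean of `t ↦ exp (-I θ t) v t` on the positive half-line. -/
def IsAbelMean (v : ℝ → E) (θ : ℝ) (x : E) : Prop :=
  Tendsto (fun σ : ℝ => (σ : ℂ) • laplaceTransform v (Complex.I * θ + σ)) (𝓝[>] 0) (𝓝 x)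

theorem norm_smul_laplaceTransform_le {v : ℝ → E} {K : ℝ} (hK : ∀ t, ‖v t‖ ≤ K) (θ : ℝ) {σ : ℝ}
    (hσ : 0 < σ) : ‖(σ : ℂ) • laplaceTransform v (Complex.I * θ + σ)‖ ≤ K := by
  have h := norm_laplaceTransform_le (z := Complex.I * θ + σ) hK (by simpa using hσ)
  have e : (Complex.I * θ + σ : ℂ).re = σ := by simp
  rw [e] at h
  rw [norm_smul, Complex.norm_real, Real.norm_of_nonneg hσ.le]
  calc σ * _ ≤ σ * (K / σ) := by gcongr
    _ = K := by field_simp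

variable [CompleteSpace E] {b : HilbertBasis ι ℂ E} {w : ι → ℝ} {C : E →L[ℂ] E} {v : ℝ → E}

/-- To the right of iθ the Laplace transform is the meromorphic resolvent applied to v(0), and it is
at most K/σ at distance σ. So the pole is at most simple, and the Abel mean is the residue. -/
theorem IsCoordSolution.exists_abelMean (hw : ∀ K, {i | |w i| ≤ K}.Finite)
    (h : IsCoordSolution b w C v) (hv : Continuous v) {K : ℝ} (hK : ∀ t, ‖v t‖ ≤ K) (θ : ℝ) :
    ∃ x, IsAbelMean v θ x := by
  -- The ball contains both iθ and ‖C‖ + 1. At the latter d ≠ 0, so d does not vanish identically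
  -- near iθ.
  obtain ⟨d, hd, hd1, -, hG⟩ := exists_meromorphic_resolvent b w C hw
    (R := |θ| + ‖C‖ + 2) (by positivity)
  obtain ⟨G, hGm, hGs⟩ := hG (v 0)
  have hmem : Complex.I * θ ∈ Metric.ball (0 : ℂ) (|θ| + ‖C‖ + 2) := by
    simp
    linarith [norm_nonneg C]
  have hmem1 : ((‖C‖ + 1 : ℝ) : ℂ) ∈ Metric.ball (0 : ℂ) (|θ| + ‖C‖ + 2) := by
    simp only [Metric.mem_ball, dist_zero_right, Complex.norm_real, Real.norm_eq_abs]
    rw [abs_of_nonneg (by positivity)]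
    linarith [abs_nonneg θ]
  have hdne : ∀ᶠ z in 𝓝[≠] (Complex.I * θ), d z ≠ 0 := by
    refine (hd _ hmem).eventually_eq_zero_or_eventually_ne_zero.resolve_left fun h0 => ?_
    have := hd.eqOn_zero_of_preconnected_of_eventuallyEq_zero
      (convex_ball (0 : ℂ) _).isPreconnected hmem h0 hmem1
    exact hd1 _ hmem1 (by simp) this
  have hball : ∀ᶠ z in 𝓝[≠] (Complex.I * θ), z ∈ Metric.ball (0 : ℂ) (|θ| + ‖C‖ + 2) :=
    nhdsWithin_le_nhds (Metric.isOpen_ball.mem_nhds hmem)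
  have hev : ∀ᶠ σ : ℝ in 𝓝[>] 0,
      laplaceTransform v (Complex.I * θ + σ) = G (Complex.I * θ + σ) := by
    filter_upwards [(tendsto_add_ofReal_nhdsNE (Complex.I * θ)).eventually (hdne.and hball),
      self_mem_nhdsWithin] with σ hσ hσ0
    exact (hGs _ hσ.2 hσ.1).2 _ (h.laplace hv hK (by simpa using hσ0))
  obtain ⟨x, hx, -⟩ := (hGm _ hmem).exists_tendsto_of_bound (K := K) (by
    filter_upwards [hev, self_mem_nhdsWithin] with σ hσ hσ0
    rw [← hσ]
    exact norm_smul_laplaceTransform_le hK θ hσ0)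
  refine ⟨x, hx.congr' ?_⟩
  filter_upwards [hev] with σ hσ
  rw [hσ]

/-- Multiply the resolvent equation at iθ + σ by σ and let σ → 0: the right-hand side σ v(0)
disappears. -/
theorem IsAbelMean.isResolventSolution {θ : ℝ} {x : E} (hx : IsAbelMean v θ x)
    (h : IsCoordSolution b w C v) (hv : Continuous v) {K : ℝ} (hK : ∀ t, ‖v t‖ ≤ K) :
    IsResolventSolution b w C (Complex.I * θ) 0 x := by
  intro i
  have h1 := ((innerSL ℂ (b i)).continuous.tendsto x).comp hx
  have h2 := ((innerSL ℂ (b i) ∘L C).continuous.tendsto x).comp hx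
  have h3 : Tendsto (fun σ : ℝ => Complex.I * θ + σ - Complex.I * w i) (𝓝[>] 0)
      (𝓝 (Complex.I * θ - Complex.I * w i)) :=
    (((tendsto_add_ofReal_nhdsNE (Complex.I * θ)).mono_right nhdsWithin_le_nhds)).sub_const _
  have h4 : Tendsto (fun σ : ℝ => (σ : ℂ) * ⟪b i, v 0⟫_ℂ) (𝓝[>] 0) (𝓝 0) := by
    have : Tendsto (fun σ : ℝ => (σ : ℂ) * ⟪b i, v 0⟫_ℂ) (𝓝 0) (𝓝 ((0 : ℝ) * ⟪b i, v 0⟫_ℂ)) :=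
      Continuous.tendsto (by fun_prop) _
    simp only [Complex.ofReal_zero, zero_mul] at this
    exact this.mono_left nhdsWithin_le_nhds
  have h5 := (h3.mul h1).add h2
  rw [inner_zero_right]
  refine tendsto_nhds_unique h5 (h4.congr' ?_)
  filter_upwards [self_mem_nhdsWithin] with σ hσ
  have := h.laplace hv hK (z := Complex.I * θ + σ) (by simpa using hσ) i
  simp only [Function.comp_apply, innerSL_apply_apply, ContinuousLinearMap.comp_apply, map_smul,
    smul_eq_mul]
  rw [← this]
  ring

/-- A bounded solution all of whose Abel means vanish starts at zero. -/
theorem IsCoordSolution.eq_zero_of_abelMean (hw : ∀ K, {i | |w i| ≤ K}.Finite)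
    (h : IsCoordSolution b w C v) (hv : Continuous v) {K : ℝ} (hK : ∀ t, ‖v t‖ ≤ K)
    (hmean : ∀ θ, IsAbelMean v θ 0) : v 0 = 0 := by
  obtain ⟨F, hF, hFl⟩ := h.exists_carleman hv hK
  have hK0 : 0 ≤ K := (norm_nonneg _).trans (hK 0)
  set a : ℝ := ‖C‖ + 1 with ha
  have ha0 : 0 < a := by positivity
  -- A Liouville argument: letting r → ∞ forces F(a) = 0, and the resolvent equation at a then gives
  -- v(0) = 0.
  have key : ∀ r : ℝ, a < r → (a ^ 2 + r ^ 2) * ‖F a‖ ≤ 2 * r * K := fun r hr => by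
    have hr0 : 0 < r := ha0.trans hr
    obtain ⟨d, hd, hd1, -, hG⟩ := exists_meromorphic_resolvent b w C hw
      (R := r + 1) (by positivity)
    obtain ⟨G, hGm, hGs⟩ := hG (v 0)
    set B := Metric.ball (0 : ℂ) (r + 1) with hB
    have hBo : IsOpen B := Metric.isOpen_ball
    have hmem1 : (a : ℂ) ∈ B := by
      simp only [hB, Metric.mem_ball, dist_zero_right, Complex.norm_real, Real.norm_eq_abs]
      rw [abs_of_nonneg ha0.le]
      linarith
    have hda : d a ≠ 0 := hd1 _ hmem1 (by simp [ha])
    have hdne : ∀ z ∈ B, ∀ᶠ s in 𝓝[≠] z, d s ≠ 0 := fun z hz => by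
      refine (hd _ hz).eventually_eq_zero_or_eventually_ne_zero.resolve_left fun h0 => ?_
      exact hda (hd.eqOn_zero_of_preconnected_of_eventuallyEq_zero
        (convex_ball (0 : ℂ) _).isPreconnected hz h0 hmem1)
    have hFG : ∀ z ∈ B, d z ≠ 0 → z.re ≠ 0 → F z = G z := fun z hz hdz hre =>
      (hGs z hz hdz).2 _ (hF z hre).2
    have hBev : ∀ z ∈ B, ∀ᶠ s in 𝓝[≠] z, s ∈ B := fun z hz =>
      nhdsWithin_le_nhds (hBo.mem_nhds hz)
    have hbound : ∀ z ∈ B, ∀ᶠ s in 𝓝[≠] z, |s.re| * ‖G s‖ ≤ K := fun z hz => by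
      filter_upwards [hdne z hz, hBev z hz] with s hs hsB
      by_cases hre : s.re = 0
      · simp [hre, hK0]
      · rw [← hFG s hsB hs hre]
        have := (hF s hre).1
        have h2 : 0 < |s.re| := abs_pos.2 hre
        rwa [le_div_iff₀ h2, mul_comm] at this
    -- On the axis the vanishing Abel mean removes the simple pole; off the axis the bound K/|Re z|
    -- excludes poles.
    have hord : ∀ z ∈ B, 0 ≤ meromorphicOrderAt G z := fun z hz => by
      by_cases hre : z.re = 0
      · have hz' : z = Complex.I * (z.im : ℝ) := by
          apply Complex.ext <;> simp [hre]
        have hev : ∀ᶠ σ : ℝ in 𝓝[>] 0, laplaceTransform v (z + σ) = G (z + σ) := by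
          filter_upwards [(tendsto_add_ofReal_nhdsNE z).eventually ((hdne z hz).and (hBev z hz)),
            self_mem_nhdsWithin] with σ hσ hσ0
          have hp : 0 < (z + σ).re := by simpa [hre] using hσ0
          rw [← hFG _ hσ.2 hσ.1 hp.ne', hFl _ hp]
        obtain ⟨x, hx, hx0⟩ := (hGm _ hz).exists_tendsto_of_bound (K := K) (by
          filter_upwards [hev, self_mem_nhdsWithin] with σ hσ hσ0
          rw [← hσ, hz']
          exact norm_smul_laplaceTransform_le hK z.im hσ0)
        refine hx0 (tendsto_nhds_unique hx ((hmean z.im).congr' ?_))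
        filter_upwards [hev] with σ hσ
        rw [← hσ, ← hz']
      · by_contra hneg
        have h1 := tendsto_cobounded_of_meromorphicOrderAt_neg (not_le.1 hneg)
        rw [← tendsto_norm_atTop_iff_cobounded] at h1
        have h2 : ∀ᶠ s in 𝓝[≠] z, |z.re| / 2 < |s.re| :=
          nhdsWithin_le_nhds ((Complex.continuous_re.abs.tendsto z).eventually_const_lt
            (by have := abs_pos.2 hre; linarith))
        obtain ⟨s, hs1, hs2, hs3⟩ :=
          ((hbound z hz).and (h2.and (h1.eventually_gt_atTop (K / (|z.re| / 2))))).exists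
        have h3 : 0 < |z.re| / 2 := by have := abs_pos.2 hre; linarith
        rw [div_lt_iff₀ h3] at hs3
        nlinarith [norm_nonneg (G s)]
    let g := toMeromorphicNFOn G B
    have hga : ∀ z ∈ B, AnalyticAt ℂ g z := fun z hz => by
      have h1 : MeromorphicNFAt g z := meromorphicNFOn_toMeromorphicNFOn G B hz
      rw [← h1.meromorphicOrderAt_nonneg_iff_analyticAt,
        meromorphicOrderAt_toMeromorphicNFOn hGm hz]
      exact hord z hz
    have hgG : ∀ z ∈ B, G =ᶠ[𝓝[≠] z] g := fun z hz =>
      (hGm.toMeromorphicNFOn_eq_self_on_nhdsNE hz).symm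
    have hgb : ∀ z ∈ B, |z.re| * ‖g z‖ ≤ K := fun z hz => by
      have h1 : ContinuousAt (fun z => |z.re| * ‖g z‖) z :=
        (Complex.continuous_re.abs.continuousAt).mul (hga z hz).continuousAt.norm
      refine le_of_tendsto (h1.tendsto.mono_left nhdsWithin_le_nhds : Tendsto _ (𝓝[≠] z) _) ?_
      filter_upwards [hbound z hz, hgG z hz] with s hs hs'
      rwa [← hs']
    have hga' : g a = F a := by
      rw [hFG a hmem1 hda (by simpa using ha0.ne')]
      have h1 : Tendsto g (𝓝[≠] (a : ℂ)) (𝓝 (g a)) :=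
        (hga a hmem1).continuousAt.tendsto.mono_left nhdsWithin_le_nhds
      have h2 : Tendsto G (𝓝[≠] (a : ℂ)) (𝓝 (G a)) :=
        (hGs a hmem1 hda).1.continuousAt.tendsto.mono_left nhdsWithin_le_nhds
      exact tendsto_nhds_unique h1 (h2.congr' (hgG a hmem1))
    -- On |z| = r one has z² + r² = z(z + z̄), of modulus 2r|Re z|. This factor cancels the singular
    -- bound K/|Re z| and permits the maximum principle.
    let p : ℂ → E := fun z => (z ^ 2 + (r : ℂ) ^ 2) • g z
    have hsub : Metric.closedBall (0 : ℂ) r ⊆ B := Metric.closedBall_subset_ball (by linarith)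
    have hpd : DiffContOnCl ℂ p (Metric.ball 0 r) := by
      refine DifferentiableOn.diffContOnCl_ball (U := B) (fun z hz => ?_) hsub
      exact (DifferentiableAt.smul (by fun_prop) (hga z hz).differentiableAt).differentiableWithinAt
    have hmax := Complex.norm_le_of_forall_mem_frontier_norm_le (C := 2 * r * K)
      Metric.isBounded_ball hpd (fun z hz => by
        rw [frontier_ball _ hr0.ne'] at hz
        have hz1 : ‖z‖ = r := by simpa using hz
        have e1 : z ^ 2 + (r : ℂ) ^ 2 = z * (2 * z.re) := by
          have : (r : ℂ) ^ 2 = z * (starRingEnd ℂ) z := by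
            rw [Complex.mul_conj, Complex.normSq_eq_norm_sq, hz1]; push_cast; rfl
          rw [this, ← Complex.ofReal_ofNat, ← Complex.ofReal_mul, ← Complex.add_conj]; ring
        have h2 := hgb z (hsub (by simpa using hz1.le))
        simp only [p]
        rw [norm_smul, e1, norm_mul, norm_mul, Complex.norm_real, hz1, Real.norm_eq_abs]
        simp only [Complex.norm_ofNat]
        nlinarith) (z := (a : ℂ)) (subset_closure (by
          simp only [Metric.mem_ball, dist_zero_right, Complex.norm_real, Real.norm_eq_abs]
          rwa [abs_of_nonneg ha0.le]))
    simp only [p] at hmax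
    rw [hga', norm_smul] at hmax
    have e2 : ‖(a : ℂ) ^ 2 + (r : ℂ) ^ 2‖ = a ^ 2 + r ^ 2 := by
      rw [← Complex.ofReal_pow, ← Complex.ofReal_pow, ← Complex.ofReal_add, Complex.norm_real,
        Real.norm_of_nonneg (by positivity)]
    rwa [e2] at hmax
  have hF0 : F a = 0 := by
    by_contra hne
    have hpos := norm_pos_iff.2 hne
    -- Chosen so that r‖F(a)‖ > 2K, against r²‖F(a)‖ ≤ 2rK.
    have h1 := key (a + 2 * K / ‖F a‖ + 1) (by
      have : 0 ≤ 2 * K / ‖F a‖ := by positivity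
      linarith)
    set r := a + 2 * K / ‖F a‖ + 1
    have h2 : 2 * K < r * ‖F a‖ := by
      have : 2 * K / ‖F a‖ < r := by simp only [r]; linarith
      rwa [div_lt_iff₀ hpos] at this
    have hr : 0 < r := by
      have : 0 ≤ 2 * K / ‖F a‖ := by positivity
      simp only [r]; linarith
    nlinarith [sq_nonneg a, mul_pos hr hr]
  refine b.ext_inner fun i => ?_
  have := (hF a (by simpa using ha0.ne')).2 i
  rw [hF0] at this
  simpa using this.symm

end AbelMeans

/-! ### Finiteness of frequencies and Bessel's inequality -/

section Bessel

open scoped InnerProductSpace Topology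
open Filter

variable {ι E : Type*} [NormedAddCommGroup E] [InnerProductSpace ℂ E]

/-- Each such iθ is a zero of the determinant d; an accumulation point would make d vanish
identically on the ball, against d(‖C‖ + 1) ≠ 0. -/
theorem finite_eigenfrequencies [CompleteSpace E] {b : HilbertBasis ι ℂ E} {w : ι → ℝ}
    {C : E →L[ℂ] E} (hw : ∀ K, {i | |w i| ≤ K}.Finite) (K : ℝ) :
    {θ : ℝ | |θ| ≤ K ∧ ∃ x ≠ 0, IsResolventSolution b w C (Complex.I * θ) 0 x}.Finite := by
  by_contra hinf
  obtain ⟨d, hd, hd1, hd2, -⟩ := exists_meromorphic_resolvent b w C hw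
    (R := |K| + ‖C‖ + 2) (by positivity)
  have hsub : {θ : ℝ | |θ| ≤ K ∧ ∃ x ≠ 0, IsResolventSolution b w C (Complex.I * θ) 0 x} ⊆ Icc (-K) K :=
    fun θ hθ => abs_le.1 hθ.1
  obtain ⟨θ₀, hθ₀, hacc⟩ := Set.Infinite.exists_accPt_of_subset_isCompact hinf isCompact_Icc hsub
  have hmem : ∀ θ : ℝ, |θ| ≤ K → Complex.I * θ ∈ Metric.ball (0 : ℂ) (|K| + ‖C‖ + 2) := fun θ hθ => by
    simp
    linarith [norm_nonneg C, le_abs_self K]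
  have hmem1 : ((‖C‖ + 1 : ℝ) : ℂ) ∈ Metric.ball (0 : ℂ) (|K| + ‖C‖ + 2) := by
    simp only [Metric.mem_ball, dist_zero_right, Complex.norm_real, Real.norm_eq_abs]
    rw [abs_of_nonneg (by positivity)]
    linarith [abs_nonneg K]
  have hθ₀' := hmem θ₀ (abs_le.2 hθ₀)
  have hfreq : ∃ᶠ z in 𝓝[≠] (Complex.I * θ₀), d z = 0 := by
    have hmap : Tendsto (fun θ : ℝ => Complex.I * θ) (𝓝[≠] θ₀) (𝓝[≠] (Complex.I * θ₀)) := by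
      refine tendsto_nhdsWithin_iff.2 ⟨?_, ?_⟩
      · exact (Continuous.tendsto (by fun_prop : Continuous fun θ : ℝ => Complex.I * θ) θ₀).mono_left
          nhdsWithin_le_nhds
      · filter_upwards [self_mem_nhdsWithin] with θ hθ
        simpa using hθ
    refine hmap.frequently ((accPt_iff_frequently_nhdsNE.1 hacc).mono fun θ hθ => ?_)
    obtain ⟨x, hx, hr⟩ := hθ.2
    exact hd2 _ (hmem θ hθ.1) x hx hr
  have := hd.eqOn_zero_of_preconnected_of_frequently_eq_zero
    (convex_ball (0 : ℂ) _).isPreconnected hθ₀' hfreq hmem1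
  exact hd1 _ hmem1 (by simp) this

theorem IsAbelMean.sub {u v : ℝ → E} {θ : ℝ} {x y : E} (hx : IsAbelMean u θ x)
    (hy : IsAbelMean v θ y) (hu : Continuous u) {K : ℝ} (hK : ∀ t, ‖u t‖ ≤ K)
    (hv : Continuous v) {K' : ℝ} (hK' : ∀ t, ‖v t‖ ≤ K') :
    IsAbelMean (fun t => u t - v t) θ (x - y) := by
  refine (Tendsto.sub hx hy).congr' ?_
  filter_upwards [self_mem_nhdsWithin] with σ hσ
  rw [laplaceTransform_sub hu hK hv hK' (by simpa using hσ), smul_sub]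

theorem IsAbelMean.norm_le {v : ℝ → E} {θ : ℝ} {x : E} (hx : IsAbelMean v θ x) {K : ℝ}
    (hK : ∀ t, ‖v t‖ ≤ K) : ‖x‖ ≤ K := by
  refine le_of_tendsto hx.norm ?_
  filter_upwards [self_mem_nhdsWithin] with σ hσ
  exact norm_smul_laplaceTransform_le hK θ hσ

theorem norm_exp_I_mul (θ t : ℝ) : ‖Complex.exp (Complex.I * θ * t)‖ = 1 := by
  rw [Complex.norm_exp]; simp

theorem norm_trigPoly_le (s : Finset ℝ) (x : ℝ → E) (t : ℝ) :
    ‖∑ θ ∈ s, Complex.exp (Complex.I * θ * t) • x θ‖ ≤ ∑ θ ∈ s, ‖x θ‖ := by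
  refine (norm_sum_le _ _).trans_eq ?_
  simp only [norm_smul, norm_exp_I_mul, one_mul]

/-- The factor σ/(σ + i(θ - θ')) tends to 1 if θ = θ' and to 0 otherwise. -/
theorem isAbelMean_trigPoly [CompleteSpace E] (s : Finset ℝ) (x : ℝ → E) (θ : ℝ) :
    IsAbelMean (fun t => ∑ θ' ∈ s, Complex.exp (Complex.I * θ' * t) • x θ') θ
      (if θ ∈ s then x θ else 0) := by
  have h1 : Tendsto (fun σ : ℝ => ∑ θ' ∈ s, ((σ : ℂ) * (Complex.I * θ + σ - Complex.I * θ')⁻¹) • x θ')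
      (𝓝[>] 0) (𝓝 (∑ θ' ∈ s, if θ = θ' then x θ' else 0)) := by
    refine tendsto_finsetSum _ fun θ' _ => ?_
    by_cases h : θ = θ'
    · subst h
      rw [if_pos rfl]
      refine tendsto_const_nhds.congr' ?_
      filter_upwards [self_mem_nhdsWithin] with σ hσ
      have : (σ : ℂ) ≠ 0 := by exact_mod_cast (ne_of_gt hσ)
      rw [add_sub_cancel_left, mul_inv_cancel₀ this, one_smul]
    · rw [if_neg h]
      have hne : Complex.I * θ + (0 : ℝ) - Complex.I * θ' ≠ 0 := by
        rw [Complex.ofReal_zero, add_zero, ← mul_sub]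
        refine mul_ne_zero Complex.I_ne_zero ?_
        rw [sub_ne_zero]
        exact_mod_cast h
      have hg : ContinuousAt (fun σ : ℝ => Complex.I * θ + σ - Complex.I * θ') 0 := by fun_prop
      have hc : ContinuousAt (fun σ : ℝ => ((σ : ℂ) * (Complex.I * θ + σ - Complex.I * θ')⁻¹) • x θ') 0 :=
        ((Complex.continuous_ofReal.continuousAt).mul (hg.inv₀ hne)).smul continuousAt_const
      have := hc.tendsto
      simp only [Complex.ofReal_zero, zero_mul, zero_smul] at this
      exact this.mono_left nhdsWithin_le_nhds
  rw [Finset.sum_ite_eq] at h1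
  refine h1.congr' ?_
  filter_upwards [self_mem_nhdsWithin] with σ hσ
  have hre : 0 < (Complex.I * θ + σ : ℂ).re := by simpa using hσ
  rw [laplaceTransform_sum s (fun θ' _ => by fun_prop) (fun θ' _ => ⟨‖x θ'‖, fun t => by
    rw [norm_smul, norm_exp_I_mul, one_mul]⟩) hre, Finset.smul_sum]
  refine Finset.sum_congr rfl fun θ' _ => ?_
  rw [laplaceTransform_exp_smul _ _ hre, smul_smul]

/-- σe^{-σt} is a probability density on the half-line. Averaging the pointwise bound against it and
letting σ → 0 turns the pairing with a trigonometric polynomial into a pairing with Abel means. -/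
theorem re_sum_inner_abelMean_le [CompleteSpace E] {q : ℝ → E} (hq : Continuous q) {K : ℝ}
    (hK : ∀ t, ‖q t‖ ≤ K) (s : Finset ℝ) {x y : ℝ → E} (hy : ∀ θ ∈ s, IsAbelMean q θ (y θ)) {M : ℝ}
    (hM : ∀ t : ℝ, (⟪∑ θ ∈ s, Complex.exp (Complex.I * θ * t) • x θ, q t⟫_ℂ).re ≤ M) :
    (∑ θ ∈ s, ⟪x θ, y θ⟫_ℂ).re ≤ M := by
  have h1 : Tendsto (fun σ : ℝ => (∑ θ ∈ s,
      ⟪x θ, (σ : ℂ) • laplaceTransform q (Complex.I * θ + σ)⟫_ℂ).re) (𝓝[>] 0)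
      (𝓝 (∑ θ ∈ s, ⟪x θ, y θ⟫_ℂ).re) :=
    (Complex.continuous_re.tendsto _).comp (tendsto_finsetSum _ fun θ hθ =>
      tendsto_const_nhds.inner (hy θ hθ))
  refine le_of_tendsto h1 ?_
  filter_upwards [self_mem_nhdsWithin] with σ hσ
  have hσ' : 0 < σ := hσ
  have hint : ∀ θ : ℝ, IntegrableOn (fun t : ℝ => Complex.exp (-(Complex.I * θ + σ) * t) • q t) (Ioi 0) :=
    fun θ => integrableOn_laplace hq hK (by simpa using hσ)
  have e1 : (∑ θ ∈ s, ⟪x θ, (σ : ℂ) • laplaceTransform q (Complex.I * θ + σ)⟫_ℂ) =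
      (σ : ℂ) * ∫ t in Ioi (0 : ℝ), Complex.exp (-σ * t) *
        ⟪∑ θ ∈ s, Complex.exp (Complex.I * θ * t) • x θ, q t⟫_ℂ := by
    have e2 : ∀ t : ℝ, Complex.exp (-σ * t) *
        ⟪∑ θ ∈ s, Complex.exp (Complex.I * θ * t) • x θ, q t⟫_ℂ =
        ∑ θ ∈ s, ⟪x θ, Complex.exp (-(Complex.I * θ + σ) * t) • q t⟫_ℂ := fun t => by
      rw [sum_inner, Finset.mul_sum]
      refine Finset.sum_congr rfl fun θ _ => ?_
      rw [inner_smul_left, inner_smul_right, ← Complex.exp_conj, ← mul_assoc, ← Complex.exp_add]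
      congr 2
      simp
      ring
    simp only [e2]
    have hint' : ∀ θ ∈ s, Integrable (fun t : ℝ =>
        ⟪x θ, Complex.exp (-(Complex.I * θ + σ) * t) • q t⟫_ℂ) (volume.restrict (Ioi 0)) :=
      fun θ _ => (innerSL ℂ (x θ)).integrable_comp (hint θ)
    rw [integral_finsetSum _ hint', Finset.mul_sum]
    refine Finset.sum_congr rfl fun θ _ => ?_
    rw [inner_smul_right]
    congr 1
    exact ((innerSL ℂ (x θ)).integral_comp_comm (hint θ)).symm
  have hint2 : IntegrableOn (fun t : ℝ => Complex.exp (-σ * t) *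
        ⟪∑ θ ∈ s, Complex.exp (Complex.I * θ * t) • x θ, q t⟫_ℂ) (Ioi 0) := by
    have := integrableOn_laplace (v := fun t : ℝ => ⟪∑ θ ∈ s, Complex.exp (Complex.I * θ * t) • x θ, q t⟫_ℂ)
      (K := (∑ θ ∈ s, ‖x θ‖) * K) (z := σ) (by fun_prop) (fun t => by
        refine (norm_inner_le_norm _ _).trans ?_
        gcongr
        · exact norm_trigPoly_le s x t
        · exact hK t) (by simpa using hσ)
    simpa using this
  rw [e1, Complex.re_ofReal_mul]
  have e3 : (∫ t in Ioi (0 : ℝ), Complex.exp (-σ * t) *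
        ⟪∑ θ ∈ s, Complex.exp (Complex.I * θ * t) • x θ, q t⟫_ℂ).re = ∫ t in Ioi (0 : ℝ),
        Real.exp (-σ * t) * (⟪∑ θ ∈ s, Complex.exp (Complex.I * θ * t) • x θ, q t⟫_ℂ).re := by
    rw [← Complex.reCLM_apply, ← Complex.reCLM.integral_comp_comm hint2]
    refine integral_congr_ae (ae_of_all _ fun t => ?_)
    have : Complex.exp (-σ * t) = (Real.exp (-σ * t) : ℝ) := by push_cast; rfl
    simp only [Complex.reCLM_apply, this, Complex.re_ofReal_mul]
  have hint3 : IntegrableOn (fun t : ℝ => Real.exp (-σ * t) *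
      (⟪∑ θ ∈ s, Complex.exp (Complex.I * θ * t) • x θ, q t⟫_ℂ).re) (Ioi 0) := by
    refine (Complex.reCLM.integrable_comp hint2).congr (ae_of_all _ fun t => ?_)
    have : Complex.exp (-σ * t) = (Real.exp (-σ * t) : ℝ) := by push_cast; rfl
    simp only [Complex.reCLM_apply, this, Complex.re_ofReal_mul]
  rw [e3]
  calc _ ≤ σ * ∫ t in Ioi (0 : ℝ), Real.exp (-σ * t) * M := by
        gcongr
        · exact (integrableOn_exp_mul_Ioi (by linarith) 0).mul_const M
        · exact measurableSet_Ioi.nullMeasurableSet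
        · exact hM _
    _ = M := by
        rw [integral_mul_const, integral_exp_mul_Ioi (by linarith)]
        simp
        field_simp

/-- Bessel's inequality for the Abel means of a bounded function. -/
theorem sum_norm_sq_abelMean_le [CompleteSpace E] {v : ℝ → E} (hv : Continuous v) {K : ℝ}
    (hK : ∀ t, ‖v t‖ ≤ K) (s : Finset ℝ) {x : ℝ → E} (hx : ∀ θ ∈ s, IsAbelMean v θ (x θ)) :
    ∑ θ ∈ s, ‖x θ‖ ^ 2 ≤ K ^ 2 := by
  have hK0 : 0 ≤ K := (norm_nonneg _).trans (hK 0)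
  let p : ℝ → E := fun t => ∑ θ ∈ s, Complex.exp (Complex.I * θ * t) • x θ
  have hp : Continuous p := by fun_prop
  have hpK : ∀ t, ‖p t‖ ≤ ∑ θ ∈ s, ‖x θ‖ := norm_trigPoly_le s x
  have hpvK : ∀ t, ‖p t - v t‖ ≤ (∑ θ ∈ s, ‖x θ‖) + K := fun t =>
    (norm_sub_le _ _).trans (add_le_add (hpK t) (hK t))
  -- q = 2v - p has the same Abel means x_θ as v for θ in s, and Re⟪p, 2v - p⟫ = ‖v‖² - ‖p - v‖² ≤
  -- K².
  have h1 := re_sum_inner_abelMean_le (q := fun t => v t - (p t - v t))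
    (K := K + ((∑ θ ∈ s, ‖x θ‖) + K)) (by fun_prop)
    (fun t => (norm_sub_le _ _).trans (add_le_add (hK t) (hpvK t))) s (x := x) (y := x)
    (M := K ^ 2) (fun θ hθ => by
      have h2 := isAbelMean_trigPoly s x θ
      rw [if_pos hθ] at h2
      have := (hx θ hθ).sub (h2.sub (hx θ hθ) hp hpK hv hK) hv hK (by fun_prop) hpvK
      simpa using this) (fun t => by
      change (⟪p t, v t - (p t - v t)⟫_ℂ).re ≤ K ^ 2
      have h3 : ‖p t - v t‖ ^ 2 = ‖p t‖ ^ 2 - 2 * (⟪p t, v t⟫_ℂ).re + ‖v t‖ ^ 2 :=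
        norm_sub_sq (𝕜 := ℂ) _ _
      have h4 : (⟪p t, p t⟫_ℂ).re = ‖p t‖ ^ 2 := inner_self_eq_norm_sq (𝕜 := ℂ) _
      have h5 : ‖v t‖ ^ 2 ≤ K ^ 2 := by gcongr; exact hK t
      simp only [inner_sub_right, Complex.sub_re]
      nlinarith [sq_nonneg ‖p t - v t‖])
  rw [Complex.re_sum] at h1
  refine le_trans (le_of_eq (Finset.sum_congr rfl fun θ _ => ?_)) h1
  exact (inner_self_eq_norm_sq (𝕜 := ℂ) _).symm

end Bessel

/-! ### Clusters of eigenvalues near a lattice point -/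

section Clusters

open scoped InnerProductSpace Topology
open Filter

variable {ι E : Type*} [NormedAddCommGroup E] [InnerProductSpace ℂ E]

/-- Eigenvectors for distinct eigenvalues are linearly independent. -/
theorem IsResolventSolution.eq_zero_of_sum_eq_zero {b : HilbertBasis ι ℂ E} {w : ι → ℝ}
    {C : E →L[ℂ] E} (s : Finset ℝ) : ∀ {x : ℝ → E},
    (∀ θ ∈ s, IsResolventSolution b w C (Complex.I * θ) 0 (x θ)) → ∑ θ ∈ s, x θ = 0 →
    ∀ θ ∈ s, x θ = 0 := by
  classical
  induction s using Finset.induction_on with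
  | empty => simp
  | insert θ₀ s h₀ ih =>
    intro x hx hsum
    -- Applying A - C - iθ₀ to the relation, coordinate by coordinate, eliminates the θ₀ term.
    have key : ∑ θ ∈ s, ((θ - θ₀ : ℝ) : ℂ) • x θ = 0 := by
      refine b.ext_inner fun i => ?_
      have h1 : ∑ θ ∈ insert θ₀ s, (Complex.I * θ) * ⟪b i, x θ⟫_ℂ =
          Complex.I * w i * ⟪b i, ∑ θ ∈ insert θ₀ s, x θ⟫_ℂ - ⟪b i, C (∑ θ ∈ insert θ₀ s, x θ)⟫_ℂ := by
        rw [map_sum, inner_sum, inner_sum, Finset.mul_sum, ← Finset.sum_sub_distrib]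
        refine Finset.sum_congr rfl fun θ hθ => ?_
        have := hx θ hθ i
        rw [inner_zero_right] at this
        linear_combination this
      have h2 : ∑ θ ∈ insert θ₀ s, ⟪b i, x θ⟫_ℂ = 0 := by
        rw [← inner_sum, hsum, inner_zero_right]
      rw [hsum, map_zero, inner_zero_right, mul_zero, sub_zero] at h1
      rw [Finset.sum_insert h₀] at h1 h2
      rw [inner_zero_right, inner_sum]
      have h3 : Complex.I * ∑ θ ∈ s, ⟪b i, ((θ - θ₀ : ℝ) : ℂ) • x θ⟫_ℂ = 0 := by
        have : Complex.I * ∑ θ ∈ s, ⟪b i, ((θ - θ₀ : ℝ) : ℂ) • x θ⟫_ℂ =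
            ∑ θ ∈ s, Complex.I * θ * ⟪b i, x θ⟫_ℂ - Complex.I * θ₀ * ∑ θ ∈ s, ⟪b i, x θ⟫_ℂ := by
          rw [Finset.mul_sum, Finset.mul_sum, ← Finset.sum_sub_distrib]
          refine Finset.sum_congr rfl fun θ _ => ?_
          rw [inner_smul_right]
          push_cast
          ring
        rw [this]
        linear_combination h1 - Complex.I * θ₀ * h2
      exact (mul_eq_zero.1 h3).resolve_left Complex.I_ne_zero
    have h4 : ∀ θ ∈ s, x θ = 0 := fun θ hθ => by
      have h5 := ih (x := fun θ => ((θ - θ₀ : ℝ) : ℂ) • x θ) (fun θ hθ i => by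
        have := hx θ (Finset.mem_insert_of_mem hθ) i
        simp only [inner_smul_right, map_smul, inner_zero_right] at this ⊢
        linear_combination ((θ - θ₀ : ℝ) : ℂ) * this) key θ hθ
      refine (smul_eq_zero.1 h5).resolve_left ?_
      have : θ ≠ θ₀ := fun e => h₀ (e ▸ hθ)
      exact_mod_cast sub_ne_zero.2 this
    intro θ hθ
    rcases Finset.mem_insert.1 hθ with rfl | hθ
    · rwa [Finset.sum_insert h₀, Finset.sum_eq_zero h4, add_zero] at hsum
    · exact h4 θ hθ

variable [CompleteSpace E] {b : HilbertBasis ι ℂ E} {κ : ℝ} {n : ι → ℤ} {C : E →L[ℂ] E}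

/-- The size of `C` seen from the frequency `κ m`. -/
noncomputable def clusterError (b : HilbertBasis ι ℂ E) (n : ι → ℤ) (C : E →L[ℂ] E) (m : ℤ) : ℝ :=
  ∑' i, ‖ContinuousLinearMap.adjoint C (b i)‖ ^ 2 / (max 1 |((n i - m : ℤ) : ℝ)|) ^ 2

theorem summable_clusterError_aux
    (hC : Summable fun i => ‖ContinuousLinearMap.adjoint C (b i)‖ ^ 2) (m : ℤ) :
    Summable fun i => ‖ContinuousLinearMap.adjoint C (b i)‖ ^ 2 / (max 1 |((n i - m : ℤ) : ℝ)|) ^ 2 := by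
  refine Summable.of_nonneg_of_le (fun i => by positivity) (fun i => ?_) hC
  refine div_le_self (by positivity) (one_le_pow₀ (le_max_left _ _))

theorem summable_inv_max_sq : Summable fun m : ℤ => 1 / (max 1 |(m : ℝ)|) ^ 2 := by
  have h := (Real.summable_one_div_int_pow (p := 2)).2 (by norm_num)
  have h0 : Summable fun m : ℤ => if m = 0 then (1 : ℝ) else 0 :=
    summable_of_ne_finset_zero (s := {0}) (by simp +contextual)
  refine Summable.of_nonneg_of_le (fun m => by positivity) (fun m => ?_) (h.add h0)
  by_cases hm : m = 0
  · subst hm; simp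
  · have h1 : (1 : ℝ) ≤ |(m : ℝ)| := by
      exact_mod_cast Int.one_le_abs hm
    rw [max_eq_right h1, sq_abs]
    simp [hm]

/-- Summing over m first gives ‖C* b_i‖² times a constant independent of i. Hence the error is small
for all but finitely many m. -/
theorem summable_clusterError
    (hC : Summable fun i => ‖ContinuousLinearMap.adjoint C (b i)‖ ^ 2) :
    Summable (clusterError b n C) := by
  have hS : Summable fun p : ι × ℤ => ‖ContinuousLinearMap.adjoint C (b p.1)‖ ^ 2 /
      (max 1 |((n p.1 - p.2 : ℤ) : ℝ)|) ^ 2 := by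
    have hsh : ∀ i, HasSum (fun m : ℤ => ‖ContinuousLinearMap.adjoint C (b i)‖ ^ 2 /
        (max 1 |((n i - m : ℤ) : ℝ)|) ^ 2) (‖ContinuousLinearMap.adjoint C (b i)‖ ^ 2 *
        ∑' m : ℤ, 1 / (max 1 |(m : ℝ)|) ^ 2) := fun i => by
      have := ((Equiv.subLeft (n i)).hasSum_iff.2 summable_inv_max_sq.hasSum).mul_left
        (‖ContinuousLinearMap.adjoint C (b i)‖ ^ 2)
      convert! this using 2 with m
      simp [div_eq_mul_inv]
    refine (summable_prod_of_nonneg fun p => by positivity).2 ⟨fun i => (hsh i).summable, ?_⟩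
    have e : (fun i => ∑' m : ℤ, ‖ContinuousLinearMap.adjoint C (b i)‖ ^ 2 /
        (max 1 |((n i - m : ℤ) : ℝ)|) ^ 2) = fun i => ‖ContinuousLinearMap.adjoint C (b i)‖ ^ 2 *
        ∑' m : ℤ, 1 / (max 1 |(m : ℝ)|) ^ 2 := funext fun i => (hsh i).tsum_eq
    rw [e]
    exact hC.mul_right _
  exact ((Equiv.prodComm ℤ ι).summable_iff.2 hS).prod

theorem clusterError_nonneg (m : ℤ) : 0 ≤ clusterError b n C m :=
  tsum_nonneg fun _ => by positivity

/-- The radius 3κ/4 lies between κ/2, which confines the frequencies of a cluster, and the lattice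
spacing κ. So the circle surrounds the cluster and stays κ/4 away from every lattice point. -/
theorem le_norm_sub_on_circle (hκ : 0 < κ) {m k : ℤ} {z : ℂ}
    (hz : z ∈ Metric.sphere (Complex.I * (κ * m : ℝ)) (3 / 4 * κ)) :
    κ / 4 * max 1 |((k - m : ℤ) : ℝ)| ≤ ‖z - Complex.I * (κ * k : ℝ)‖ := by
  have hz' : ‖z - Complex.I * (κ * m : ℝ)‖ = 3 / 4 * κ := by simpa [dist_eq_norm] using hz
  by_cases h : k = m
  · subst h
    rw [hz']
    simp
    linarith
  · have h1 : (1 : ℝ) ≤ |((k - m : ℤ) : ℝ)| := by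
      exact_mod_cast Int.one_le_abs (sub_ne_zero.2 h)
    rw [max_eq_right h1]
    have h2 : ‖Complex.I * (κ * k : ℝ) - Complex.I * (κ * m : ℝ)‖ = κ * |((k - m : ℤ) : ℝ)| := by
      rw [← mul_sub, norm_mul, Complex.norm_I, one_mul, ← Complex.ofReal_sub, Complex.norm_real,
        ← mul_sub, norm_mul, Real.norm_of_nonneg hκ.le]
      push_cast
      rfl
    have h3 : ‖Complex.I * (κ * k : ℝ) - Complex.I * (κ * m : ℝ)‖ ≤
        ‖z - Complex.I * (κ * m : ℝ)‖ + ‖z - Complex.I * (κ * k : ℝ)‖ := by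
      have := norm_sub_le (z - Complex.I * (κ * m : ℝ)) (z - Complex.I * (κ * k : ℝ))
      simpa using this
    rw [h2, hz'] at h3
    nlinarith

theorem norm_inner_apply_le (i : ι) (g : E) :
    ‖⟪b i, C g⟫_ℂ‖ ≤ ‖ContinuousLinearMap.adjoint C (b i)‖ * ‖g‖ := by
  rw [← ContinuousLinearMap.adjoint_inner_left]
  exact norm_inner_le_norm _ _

/-- Solve for each coordinate of g by dividing by z - iκn_i. The terms with C contribute at most
32/κ² times the cluster error times ‖g‖², hence at most ‖g‖²/2, which is absorbed on the left. -/
theorem IsResolventSolution.norm_le_on_circle (hκ : 0 < κ)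
    (hC : Summable fun i => ‖ContinuousLinearMap.adjoint C (b i)‖ ^ 2) {m : ℤ}
    (hm : 64 * clusterError b n C m ≤ κ ^ 2) {z : ℂ}
    (hz : z ∈ Metric.sphere (Complex.I * (κ * m : ℝ)) (3 / 4 * κ)) {x g : E}
    (h : IsResolventSolution b (fun i => κ * n i) C z x g) : ‖g‖ ≤ 8 / κ * ‖x‖ := by
  have h1 : ‖g‖ ^ 2 ≤ 32 / κ ^ 2 * (‖x‖ ^ 2 + clusterError b n C m * ‖g‖ ^ 2) := by
    refine hasSum_le (fun i => ?_) (b.hasSum_norm_sq g) (((b.hasSum_norm_sq x).add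
      ((summable_clusterError_aux hC m).hasSum.mul_right (‖g‖ ^ 2))).mul_left (32 / κ ^ 2))
    have hlow := le_norm_sub_on_circle (k := n i) hκ hz
    set ρ := max 1 |((n i - m : ℤ) : ℝ)| with hρ
    have hρ1 : 1 ≤ ρ := le_max_left _ _
    have e : (z - Complex.I * (κ * n i : ℝ)) * ⟪b i, g⟫_ℂ = ⟪b i, x⟫_ℂ - ⟪b i, C g⟫_ℂ := by
      rw [← h i]; ring
    have h2 : κ / 4 * ρ * ‖⟪b i, g⟫_ℂ‖ ≤ ‖⟪b i, x⟫_ℂ‖ +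
        ‖ContinuousLinearMap.adjoint C (b i)‖ * ‖g‖ := by
      calc _ ≤ ‖z - Complex.I * (κ * n i : ℝ)‖ * ‖⟪b i, g⟫_ℂ‖ := by gcongr
        _ = ‖⟪b i, x⟫_ℂ - ⟪b i, C g⟫_ℂ‖ := by rw [← norm_mul, e]
        _ ≤ _ := (norm_sub_le _ _).trans (by gcongr; exact norm_inner_apply_le i g)
    have h3 : ‖⟪b i, g⟫_ℂ‖ ≤ 4 / κ * (‖⟪b i, x⟫_ℂ‖ +
        ‖ContinuousLinearMap.adjoint C (b i)‖ / ρ * ‖g‖) := by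
      have h4 : ‖⟪b i, g⟫_ℂ‖ ≤ (‖⟪b i, x⟫_ℂ‖ +
        ‖ContinuousLinearMap.adjoint C (b i)‖ * ‖g‖) / (κ / 4 * ρ) := by
        rw [le_div_iff₀ (by positivity), mul_comm]; exact h2
      refine h4.trans ?_
      have h5 : ‖⟪b i, x⟫_ℂ‖ / ρ ≤ ‖⟪b i, x⟫_ℂ‖ := div_le_self (norm_nonneg _) hρ1
      calc _ = 4 / κ * (‖⟪b i, x⟫_ℂ‖ / ρ + ‖ContinuousLinearMap.adjoint C (b i)‖ / ρ * ‖g‖) := by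
            field_simp
        _ ≤ _ := by gcongr
    calc ‖⟪b i, g⟫_ℂ‖ ^ 2 ≤ (4 / κ * (‖⟪b i, x⟫_ℂ‖ +
        ‖ContinuousLinearMap.adjoint C (b i)‖ / ρ * ‖g‖)) ^ 2 := by gcongr
      _ = 16 / κ ^ 2 * (‖⟪b i, x⟫_ℂ‖ + ‖ContinuousLinearMap.adjoint C (b i)‖ / ρ * ‖g‖) ^ 2 := by
        ring
      _ ≤ 16 / κ ^ 2 * (2 * (‖⟪b i, x⟫_ℂ‖ ^ 2 +
          (‖ContinuousLinearMap.adjoint C (b i)‖ / ρ * ‖g‖) ^ 2)) := by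
        gcongr; exact add_sq_le
      _ = _ := by ring
  have h2 : ‖g‖ ^ 2 ≤ (8 / κ * ‖x‖) ^ 2 := by
    have h3 : κ ^ 2 * ‖g‖ ^ 2 ≤ 32 * (‖x‖ ^ 2 + clusterError b n C m * ‖g‖ ^ 2) := by
      have := mul_le_mul_of_nonneg_left h1 (sq_nonneg κ)
      have e : κ ^ 2 * (32 / κ ^ 2 * (‖x‖ ^ 2 + clusterError b n C m * ‖g‖ ^ 2)) =
        32 * (‖x‖ ^ 2 + clusterError b n C m * ‖g‖ ^ 2) := by field_simp
      linarith
    have h4 : (64 * clusterError b n C m) * ‖g‖ ^ 2 ≤ κ ^ 2 * ‖g‖ ^ 2 := by gcongr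
    have h5 : κ ^ 2 * ‖g‖ ^ 2 ≤ 64 * ‖x‖ ^ 2 := by linarith
    have e : (8 / κ * ‖x‖) ^ 2 = 64 * ‖x‖ ^ 2 / κ ^ 2 := by ring
    rw [e, le_div_iff₀ (by positivity)]
    linarith
  exact le_of_sq_le_sq h2 (by positivity)

/-- A comparison of Riesz projections. The resolvent g(z) = ∑ (z - iθ)⁻¹x_θ of X = ∑ x_θ integrates
around the circle to 2πi X, while its unperturbed counterpart (z - iκn_i)⁻¹⟪b_i, X⟫ integrates to 0
because iκn_i lies outside. The difference is -⟪b_i, C g⟫/(z - iκn_i), and the constant is 24/κ =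
(3κ/4)(8/κ)(4/κ). -/
theorem norm_inner_cluster_le (hκ : 0 < κ)
    (hC : Summable fun i => ‖ContinuousLinearMap.adjoint C (b i)‖ ^ 2) {m : ℤ}
    (hm : 64 * clusterError b n C m ≤ κ ^ 2) (s : Finset ℝ) {x : ℝ → E}
    (hs : ∀ θ ∈ s, |θ - κ * m| ≤ κ / 2)
    (hx : ∀ θ ∈ s, IsResolventSolution b (fun i => κ * n i) C (Complex.I * θ) 0 (x θ))
    {i : ι} (hi : n i ≠ m) :
    ‖⟪b i, ∑ θ ∈ s, x θ⟫_ℂ‖ ≤ 24 / κ * (‖ContinuousLinearMap.adjoint C (b i)‖ /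
      max 1 |((n i - m : ℤ) : ℝ)|) * ‖∑ θ ∈ s, x θ‖ := by
  set X := ∑ θ ∈ s, x θ with hX
  set c : ℂ := Complex.I * (κ * m : ℝ) with hc
  set r : ℝ := 3 / 4 * κ with hr
  have hr0 : 0 < r := by positivity
  let g : ℂ → E := fun z => ∑ θ ∈ s, (z - Complex.I * θ)⁻¹ • x θ
  have hball : ∀ θ ∈ s, Complex.I * (θ : ℂ) ∈ Metric.ball c r := fun θ hθ => by
    rw [Metric.mem_ball, dist_eq_norm, hc, ← mul_sub, norm_mul, Complex.norm_I, one_mul,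
      ← Complex.ofReal_sub, Complex.norm_real, Real.norm_eq_abs]
    refine (hs θ hθ).trans_lt ?_
    rw [hr]; linarith
  have hne : ∀ z ∈ Metric.sphere c r, ∀ θ ∈ s, z - Complex.I * θ ≠ 0 := fun z hz θ hθ h0 => by
    have h1 := hball θ hθ
    rw [← sub_eq_zero.1 h0] at h1
    exact absurd (Metric.mem_sphere.1 hz) (ne_of_lt (Metric.mem_ball.1 h1))
  have hg : ∀ z ∈ Metric.sphere c r, IsResolventSolution b (fun i => κ * n i) C z X (g z) :=
    fun z hz j => by
      simp only [g, hX, map_sum, inner_sum, map_smul, inner_smul_right, Finset.mul_sum,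
        ← Finset.sum_add_distrib]
      refine Finset.sum_congr rfl fun θ hθ => ?_
      have h1 := hx θ hθ j
      rw [inner_zero_right] at h1
      have h2 := hne z hz θ hθ
      field_simp
      linear_combination h1
  have hgn : ∀ z ∈ Metric.sphere c r, ‖g z‖ ≤ 8 / κ * ‖X‖ := fun z hz =>
    (hg z hz).norm_le_on_circle hκ hC hm hz
  have hni : (1 : ℝ) ≤ |((n i - m : ℤ) : ℝ)| := by
    exact_mod_cast Int.one_le_abs (sub_ne_zero.2 hi)
  have hlow : ∀ z ∈ Metric.sphere c r, κ / 4 * max 1 |((n i - m : ℤ) : ℝ)| ≤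
      ‖z - Complex.I * (κ * n i : ℝ)‖ := fun z hz => le_norm_sub_on_circle hκ hz
  have hne' : ∀ z ∈ Metric.sphere c r, z - Complex.I * (κ * n i : ℝ) ≠ 0 := fun z hz h0 => by
    have := hlow z hz
    rw [h0, norm_zero] at this
    have : 0 < κ / 4 * max 1 |((n i - m : ℤ) : ℝ)| := by positivity
    linarith
  have hout : ∀ z ∈ Metric.closedBall c r, z - Complex.I * (κ * n i : ℝ) ≠ 0 := fun z hz h0 => by
    rw [sub_eq_zero.1 h0, Metric.mem_closedBall, dist_eq_norm, hc, ← mul_sub, norm_mul,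
      Complex.norm_I, one_mul, ← Complex.ofReal_sub, Complex.norm_real, ← mul_sub, norm_mul,
      Real.norm_of_nonneg hκ.le, Real.norm_eq_abs, hr] at hz
    push_cast at hni
    nlinarith
  have I1 : (∮ z in C(c, r), ⟪b i, g z⟫_ℂ) = 2 * Real.pi * Complex.I * ⟪b i, X⟫_ℂ := by
    simp only [g, inner_sum, inner_smul_right]
    rw [circleIntegral.integral_fun_sum]
    · rw [hX, inner_sum, Finset.mul_sum]
      refine Finset.sum_congr rfl fun θ hθ => ?_
      have : ∀ z : ℂ, (z - Complex.I * θ)⁻¹ * ⟪b i, x θ⟫_ℂ = ⟪b i, x θ⟫_ℂ • (z - Complex.I * θ)⁻¹ :=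
        fun z => mul_comm _ _
      simp only [this]
      rw [circleIntegral.integral_smul, circleIntegral.integral_sub_inv_of_mem_ball (hball θ hθ),
        smul_eq_mul, mul_comm]
    · intro θ hθ
      refine ContinuousOn.circleIntegrable hr0.le ?_
      exact (ContinuousOn.inv₀ (by fun_prop) fun z hz => hne z hz θ hθ).mul continuousOn_const
  have I2 : (∮ z in C(c, r), (z - Complex.I * (κ * n i : ℝ))⁻¹ * ⟪b i, X⟫_ℂ) = 0 := by
    refine Complex.circleIntegral_eq_zero_of_differentiable_on_off_countable hr0.le
      Set.countable_empty ?_ ?_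
    · exact (ContinuousOn.inv₀ (by fun_prop) hout).mul continuousOn_const
    · intro z hz
      have hd : DifferentiableAt ℂ (fun z : ℂ => z - Complex.I * (κ * n i : ℝ)) z := by fun_prop
      exact (hd.inv (hout z (Metric.ball_subset_closedBall hz.1))).mul (differentiableAt_const _)
  have I3 : (∮ z in C(c, r), (⟪b i, g z⟫_ℂ - (z - Complex.I * (κ * n i : ℝ))⁻¹ * ⟪b i, X⟫_ℂ)) =
      2 * Real.pi * Complex.I * ⟪b i, X⟫_ℂ := by
    rw [circleIntegral.integral_sub, I1, I2, sub_zero]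
    · refine ContinuousOn.circleIntegrable hr0.le ?_
      simp only [g, inner_sum, inner_smul_right]
      exact continuousOn_finsetSum _ fun θ hθ =>
        (ContinuousOn.inv₀ (by fun_prop) fun z hz => hne z hz θ hθ).mul continuousOn_const
    · refine ContinuousOn.circleIntegrable hr0.le ?_
      exact (ContinuousOn.inv₀ (by fun_prop) hne').mul continuousOn_const
  have I4 := circleIntegral.norm_integral_le_of_norm_le_const (c := c) (R := r) hr0.le
    (f := fun z => ⟪b i, g z⟫_ℂ - (z - Complex.I * (κ * n i : ℝ))⁻¹ * ⟪b i, X⟫_ℂ)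
    (C := ‖ContinuousLinearMap.adjoint C (b i)‖ * (8 / κ * ‖X‖) /
      (κ / 4 * max 1 |((n i - m : ℤ) : ℝ)|)) (fun z hz => by
      have e : ⟪b i, g z⟫_ℂ - (z - Complex.I * (κ * n i : ℝ))⁻¹ * ⟪b i, X⟫_ℂ =
          -⟪b i, C (g z)⟫_ℂ / (z - Complex.I * (κ * n i : ℝ)) := by
        have h2 := hne' z hz
        rw [← hg z hz i]
        field_simp
        ring
      rw [e, norm_div, norm_neg]
      gcongr
      · exact (norm_inner_apply_le i _).trans (by gcongr; exact hgn z hz)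
      · exact hlow z hz)
  rw [I3] at I4
  simp only [norm_mul, Complex.norm_ofNat, Complex.norm_real, Complex.norm_I, mul_one,
    Real.norm_of_nonneg Real.pi_pos.le] at I4
  rw [mul_assoc (2 * Real.pi)] at I4
  refine (le_of_mul_le_mul_left I4 (by positivity)).trans_eq ?_
  rw [hr]
  field_simp
  ring

end Clusters

/-! ### Size of clusters and almost orthogonality -/

section ClusterSums

open scoped InnerProductSpace Topology
open Filter

variable {ι E : Type*} [NormedAddCommGroup E] [InnerProductSpace ℂ E] [CompleteSpace E]
  {b : HilbertBasis ι ℂ E} {κ : ℝ} {n : ι → ℤ} {C : E →L[ℂ] E}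

/-- A cluster far out contains at most as many eigenvalues as the unperturbed one. -/
theorem card_cluster_le (hκ : 0 < κ)
    (hC : Summable fun i => ‖ContinuousLinearMap.adjoint C (b i)‖ ^ 2) {m : ℤ}
    (hm : 2304 * clusterError b n C m ≤ κ ^ 2) (s : Finset ℝ) {x : ℝ → E}
    (hs : ∀ θ ∈ s, |θ - κ * m| ≤ κ / 2) (hx0 : ∀ θ ∈ s, x θ ≠ 0)
    (hx : ∀ θ ∈ s, IsResolventSolution b (fun i => κ * n i) C (Complex.I * θ) 0 (x θ))
    (J : Finset ι) (hJ : ∀ i, n i = m → i ∈ J) : s.card ≤ J.card := by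
  by_contra! hlt
  -- With more eigenvectors than indices in J, some nontrivial combination X has no J-coordinates.
  -- The remaining coordinates give ‖X‖² ≤ ‖X‖²/4, as 2304 = 4 · 24², so X = 0, contrary to linear
  -- independence.
  let f : (s → ℂ) →ₗ[ℂ] (J → ℂ) :=
    { toFun := fun c j => ⟪b j, ∑ θ : s, c θ • x θ⟫_ℂ
      map_add' := fun c c' => by
        funext j
        simp [add_smul, Finset.sum_add_distrib]
      map_smul' := fun a c => by
        funext j
        simp [mul_smul, ← Finset.smul_sum] }
  have hker : LinearMap.ker f ≠ ⊥ := f.ker_ne_bot_of_finrank_lt (by simpa using hlt)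
  obtain ⟨c, hc, hc0⟩ := (Submodule.ne_bot_iff _).1 hker
  let y : ℝ → E := fun θ => if h : θ ∈ s then c ⟨θ, h⟩ • x θ else 0
  have hyc : ∀ θ : s, y θ = c θ • x θ := fun θ => by simp [y]
  have hsum : ∑ θ ∈ s, y θ = ∑ θ : s, c θ • x θ := by
    rw [← Finset.sum_coe_sort]
    exact Finset.sum_congr rfl fun θ _ => hyc θ
  have hy : ∀ θ ∈ s, IsResolventSolution b (fun i => κ * n i) C (Complex.I * θ) 0 (y θ) :=
    fun θ hθ i => by
      have h1 := hx θ hθ i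
      rw [hyc ⟨θ, hθ⟩]
      simp only [inner_smul_right, map_smul, inner_zero_right] at h1 ⊢
      linear_combination (c ⟨θ, hθ⟩) * h1
  set X := ∑ θ ∈ s, y θ with hX
  have h64 : 64 * clusterError b n C m ≤ κ ^ 2 := by
    have := clusterError_nonneg (b := b) (n := n) (C := C) m
    linarith
  have hbound : ‖X‖ ^ 2 ≤ 576 / κ ^ 2 * (clusterError b n C m * ‖X‖ ^ 2) := by
    refine hasSum_le (fun i => ?_) (b.hasSum_norm_sq X)
      (((summable_clusterError_aux hC m).hasSum.mul_right (‖X‖ ^ 2)).mul_left (576 / κ ^ 2))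
    by_cases hi : n i = m
    · have : ⟪b i, X⟫_ℂ = 0 := by
        rw [hsum]
        exact congrFun (LinearMap.mem_ker.1 hc) ⟨i, hJ i hi⟩
      rw [this, norm_zero, zero_pow two_ne_zero]
      positivity
    · have := norm_inner_cluster_le hκ hC h64 s hs hy hi
      refine (pow_le_pow_left₀ (norm_nonneg _) this 2).trans_eq ?_
      ring
  have hX0 : X = 0 := by
    by_contra hne
    have hpos : 0 < ‖X‖ ^ 2 := by positivity
    have h1 := mul_le_mul_of_nonneg_left hbound (sq_nonneg κ)
    have e : κ ^ 2 * (576 / κ ^ 2 * (clusterError b n C m * ‖X‖ ^ 2)) =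
      576 * clusterError b n C m * ‖X‖ ^ 2 := by field_simp
    rw [e] at h1
    have h2 : 2304 * clusterError b n C m * ‖X‖ ^ 2 ≤ κ ^ 2 * ‖X‖ ^ 2 := by gcongr
    have h3 : 0 < κ ^ 2 * ‖X‖ ^ 2 := by positivity
    linarith
  refine hc0 (funext fun θ => ?_)
  have := IsResolventSolution.eq_zero_of_sum_eq_zero s hy hX0 θ θ.2
  rw [hyc] at this
  exact (smul_eq_zero.1 this).resolve_right (hx0 θ θ.2)

/-- Sums over distinct clusters are almost orthogonal. -/
theorem norm_sq_sum_cluster_le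
    (hC : Summable fun i => ‖ContinuousLinearMap.adjoint C (b i)‖ ^ 2) (T : Finset ℤ) (X : ℤ → E)
    (hX : ∀ m ∈ T, ∀ i, n i ≠ m → ‖⟪b i, X m⟫_ℂ‖ ≤ 24 / κ *
      (‖ContinuousLinearMap.adjoint C (b i)‖ / max 1 |((n i - m : ℤ) : ℝ)|) * ‖X m‖) :
    ‖∑ m ∈ T, X m‖ ^ 2 ≤ (2 + 1152 / κ ^ 2 * (∑' m : ℤ, 1 / (max 1 |(m : ℝ)|) ^ 2) *
      ∑' i, ‖ContinuousLinearMap.adjoint C (b i)‖ ^ 2) * ∑ m ∈ T, ‖X m‖ ^ 2 := by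
  set S := ∑' m : ℤ, 1 / (max 1 |(m : ℝ)|) ^ 2 with hS
  set Q := ∑ m ∈ T, ‖X m‖ ^ 2 with hQ
  have hS0 : 0 ≤ S := tsum_nonneg fun _ => by positivity
  have hQ0 : 0 ≤ Q := Finset.sum_nonneg fun _ _ => by positivity
  have hST : ∀ i, ∑ m ∈ T, (1 / max 1 |((n i - m : ℤ) : ℝ)|) ^ 2 ≤ S := fun i => by
    have h1 := ((Equiv.subLeft (n i)).summable_iff.2 summable_inv_max_sq).sum_le_tsum T
      fun m _ => by simp only [Function.comp_apply]; positivity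
    have h2 := (Equiv.subLeft (n i)).tsum_eq (fun m : ℤ => 1 / (max 1 |(m : ℝ)|) ^ 2)
    refine le_trans (le_of_eq (Finset.sum_congr rfl fun m _ => ?_)) (h1.trans_eq h2)
    simp
  have hrhs : HasSum (fun i => 2 * ∑ m ∈ T, ‖⟪b i, X m⟫_ℂ‖ ^ 2 +
      1152 / κ ^ 2 * S * Q * ‖ContinuousLinearMap.adjoint C (b i)‖ ^ 2)
      (2 * Q + 1152 / κ ^ 2 * S * Q * ∑' i, ‖ContinuousLinearMap.adjoint C (b i)‖ ^ 2) :=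
    ((hasSum_sum fun m _ => b.hasSum_norm_sq (X m)).mul_left 2).add (hC.hasSum.mul_left _)
  refine (hasSum_le (fun i => ?_) (b.hasSum_norm_sq (∑ m ∈ T, X m)) hrhs).trans_eq (by ring)
  rw [inner_sum]
  -- Only m = n_i contributes a main term to the i-th coordinate; all other m are controlled by the
  -- hypothesis and Cauchy–Schwarz in m.
  have hsplit : ‖∑ m ∈ T, ⟪b i, X m⟫_ℂ‖ ≤ √(∑ m ∈ T, ‖⟪b i, X m⟫_ℂ‖ ^ 2) +
      24 / |κ| * ‖ContinuousLinearMap.adjoint C (b i)‖ * √(S * Q) := by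
    classical
    rw [← Finset.sum_filter_add_sum_filter_not T (fun m => n i = m)]
    refine (norm_add_le _ _).trans (add_le_add ?_ ?_)
    · rw [Finset.sum_filter, Finset.sum_ite_eq]
      split_ifs with h
      · refine Real.le_sqrt_of_sq_le ?_
        exact Finset.single_le_sum (f := fun m => ‖⟪b i, X m⟫_ℂ‖ ^ 2) (fun m _ => by positivity) h
      · simp
    · have hcs := Finset.sum_mul_sq_le_sq_mul_sq T (fun m => 1 / max 1 |((n i - m : ℤ) : ℝ)|)
        (fun m => ‖X m‖)
      calc ‖∑ m ∈ T with ¬n i = m, ⟪b i, X m⟫_ℂ‖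
          ≤ ∑ m ∈ T with ¬n i = m, 24 / |κ| * ‖ContinuousLinearMap.adjoint C (b i)‖ *
            (1 / max 1 |((n i - m : ℤ) : ℝ)| * ‖X m‖) := by
            refine norm_sum_le_of_le _ fun m hm => ?_
            rw [Finset.mem_filter] at hm
            refine (hX m hm.1 i hm.2).trans ?_
            calc _ = 24 / κ * ‖ContinuousLinearMap.adjoint C (b i)‖ *
                  (1 / max 1 |((n i - m : ℤ) : ℝ)| * ‖X m‖) := by ring
              _ ≤ _ := by
                gcongr ?_ * _ * _
                refine (le_abs_self _).trans_eq ?_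
                rw [abs_div, abs_of_nonneg (by norm_num : (0 : ℝ) ≤ 24)]
        _ ≤ ∑ m ∈ T, 24 / |κ| * ‖ContinuousLinearMap.adjoint C (b i)‖ *
            (1 / max 1 |((n i - m : ℤ) : ℝ)| * ‖X m‖) :=
            Finset.sum_le_sum_of_subset_of_nonneg (Finset.filter_subset _ _) fun _ _ _ => by
              positivity
        _ ≤ _ := by
            rw [← Finset.mul_sum]
            gcongr
            refine Real.le_sqrt_of_sq_le (hcs.trans ?_)
            gcongr
            exact hST i
  calc ‖∑ m ∈ T, ⟪b i, X m⟫_ℂ‖ ^ 2 ≤ (√(∑ m ∈ T, ‖⟪b i, X m⟫_ℂ‖ ^ 2) +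
      24 / |κ| * ‖ContinuousLinearMap.adjoint C (b i)‖ * √(S * Q)) ^ 2 := by gcongr
    _ ≤ 2 * (√(∑ m ∈ T, ‖⟪b i, X m⟫_ℂ‖ ^ 2) ^ 2 +
      (24 / |κ| * ‖ContinuousLinearMap.adjoint C (b i)‖ * √(S * Q)) ^ 2) := add_sq_le
    _ = _ := by
      rw [Real.sq_sqrt (Finset.sum_nonneg fun _ _ => by positivity), mul_pow, mul_pow, div_pow,
        sq_abs, Real.sq_sqrt (by positivity)]
      ring

end ClusterSums

/-! ### Abel means of translates -/

section Translation

open scoped Topology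
open Filter

variable {E : Type*} [NormedAddCommGroup E] [InnerProductSpace ℂ E]

theorem laplaceTransform_translate {v : ℝ → E} (hv : Continuous v) {K : ℝ} (hK : ∀ t, ‖v t‖ ≤ K)
    {z : ℂ} (hz : 0 < z.re) (s : ℝ) :
    laplaceTransform (fun t => v (t + s)) z =
      Complex.exp (z * s) • (laplaceTransform v z - ∫ t in (0 : ℝ)..s, Complex.exp (-z * t) • v t) := by
  have hint : ∀ c, IntegrableOn (fun t : ℝ => Complex.exp (-z * t) • v t) (Ioi c) := fun c => by
    have h1 : IntegrableOn (fun t : ℝ => Real.exp (-z.re * t) * K) (Ioi c) :=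
      (integrableOn_exp_mul_Ioi (by linarith) c).mul_const K
    refine Integrable.mono' h1 (by fun_prop) (ae_of_all _ fun t => ?_)
    rw [norm_smul, norm_exp_neg_mul]
    gcongr
    exact hK t
  unfold laplaceTransform
  rw [← intervalIntegral.integral_Ioi_sub_Ioi' (hint 0) (hint s), sub_sub_cancel, ← integral_smul]
  have h := (measurePreserving_add_right volume s).setIntegral_preimage_emb
    (measurableEmbedding_addRight s) (fun t : ℝ => Complex.exp (z * s) • Complex.exp (-z * t) • v t)
    (Ioi s)
  have e : (fun t => t + s) ⁻¹' Ioi s = Ioi 0 := by ext t; simp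
  rw [e] at h
  rw [← h]
  refine integral_congr_ae (ae_of_all _ fun t => ?_)
  simp only [smul_smul, ← Complex.exp_add]
  congr 2
  push_cast
  ring

/-- Translation multiplies the Laplace transform by e^{zs} after subtracting an integral over [0,
s]; the factor σ makes that integral negligible. This lets uniqueness at time 0 be used at every
time. -/
theorem IsAbelMean.translate_zero {v : ℝ → E} (hv : Continuous v) {K : ℝ} (hK : ∀ t, ‖v t‖ ≤ K)
    {θ : ℝ} (h : IsAbelMean v θ 0) (s : ℝ) : IsAbelMean (fun t => v (t + s)) θ 0 := by
  have h1 : Tendsto (fun σ : ℝ => Complex.exp ((Complex.I * θ + σ) * s) •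
      ((σ : ℂ) • laplaceTransform v (Complex.I * θ + σ) -
        (σ : ℂ) • ∫ t in (0 : ℝ)..s, Complex.exp (-(Complex.I * θ + σ) * t) • v t)) (𝓝[>] 0)
      (𝓝 (Complex.exp ((Complex.I * θ + (0 : ℝ)) * s) • ((0 : E) - ((0 : ℝ) : ℂ) •
        ∫ t in (0 : ℝ)..s, Complex.exp (-(Complex.I * θ + (0 : ℝ)) * t) • v t))) := by
    have hc : Continuous fun σ : ℝ => Complex.exp ((Complex.I * θ + σ) * s) := by fun_prop
    have hi : Continuous fun σ : ℝ => (σ : ℂ) •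
        ∫ t in (0 : ℝ)..s, Complex.exp (-(Complex.I * θ + σ) * t) • v t := by
      refine Complex.continuous_ofReal.smul ?_
      exact intervalIntegral.continuous_parametric_intervalIntegral_of_continuous'
        (by fun_prop) 0 s
    exact ((hc.tendsto 0).mono_left nhdsWithin_le_nhds).smul
      (Tendsto.sub h ((hi.tendsto 0).mono_left nhdsWithin_le_nhds))
  simp only [Complex.ofReal_zero, zero_smul, sub_zero, smul_zero] at h1
  refine h1.congr' ?_
  filter_upwards [self_mem_nhdsWithin] with σ hσ
  rw [laplaceTransform_translate hv hK (by simpa using hσ), smul_comm (σ : ℂ), ← smul_sub]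

end Translation

/-! ### Uniform approximation by trigonometric polynomials -/

section TrigonometricApproximation

open scoped InnerProductSpace Topology BoundedContinuousFunction
open Filter

variable {ι E : Type*} [NormedAddCommGroup E] [InnerProductSpace ℂ E]

/-- `f` is a uniform limit of trigonometric polynomials. -/
def IsTrigApproximable (f : ℝ → E) : Prop :=
  ∀ ε > 0, ∃ (s : Finset ℝ) (x : ℝ → E),
    ∀ t : ℝ, ‖f t - ∑ θ ∈ s, Complex.exp (Complex.I * θ * t) • x θ‖ ≤ ε

theorem IsTrigApproximable.clm_comp {f : ℝ → E} (hf : IsTrigApproximable f) (S : E →L[ℂ] E) :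
    IsTrigApproximable (fun t => S (f t)) := by
  intro ε hε
  obtain ⟨s, x, h⟩ := hf (ε / (‖S‖ + 1)) (by positivity)
  refine ⟨s, fun θ => S (x θ), fun t => ?_⟩
  have e : S (f t) - ∑ θ ∈ s, Complex.exp (Complex.I * θ * t) • S (x θ) =
      S (f t - ∑ θ ∈ s, Complex.exp (Complex.I * θ * t) • x θ) := by simp
  rw [e]
  calc _ ≤ ‖S‖ * (ε / (‖S‖ + 1)) := (S.le_opNorm _).trans (by gcongr; exact h t)
    _ ≤ (‖S‖ + 1) * (ε / (‖S‖ + 1)) := by gcongr; linarith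
    _ = ε := by field_simp

/-- Finitely many exponentials have a relatively dense set of common almost periods. -/
theorem exists_common_almostPeriods (s : Finset ℝ) {δ : ℝ} (hδ : 0 < δ) :
    ∃ l > 0, ∀ a : ℝ, ∃ τ ∈ Icc a (a + l), ∀ θ ∈ s,
      ‖Complex.exp (Complex.I * θ * τ) - 1‖ < δ := by
  let F : ℝ → (s → ℂ) := fun τ θ => Complex.exp (Complex.I * θ * τ)
  have hF : TotallyBounded (range F) := by
    refine (isCompact_closedBall (0 : s → ℂ) 1).totallyBounded.subset ?_
    rintro _ ⟨τ, rfl⟩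
    rw [mem_closedBall_zero_iff, pi_norm_le_iff_of_nonneg zero_le_one]
    intro θ
    simp only [F, norm_exp_I_mul, le_refl]
  obtain ⟨T, hT, hTfin, hcov⟩ := Metric.finite_approx_of_totallyBounded hF δ hδ
  have hT' : ∀ y, ∃ τ, y ∈ T → F τ = y := fun y => by
    by_cases hy : y ∈ T
    · obtain ⟨τ, hτ⟩ := hT hy
      exact ⟨τ, fun _ => hτ⟩
    · exact ⟨0, fun h => absurd h hy⟩
  choose τ hτ using hT'
  obtain ⟨M, hM⟩ : ∃ M, ∀ y ∈ T, |τ y| ≤ M := by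
    obtain ⟨M, hM⟩ := (hTfin.image fun y => |τ y|).bddAbove
    exact ⟨M, fun y hy => hM (mem_image_of_mem _ hy)⟩
  have hM' : ∀ y ∈ T, |τ y| ≤ |M| := fun y hy => (hM y hy).trans (le_abs_self M)
  -- The orbit F has a finite δ-net of points F(τ_y) with |τ_y| ≤ |M|. If F(a + |M|) is close to
  -- F(τ_y), then a + |M| - τ_y is an almost period in [a, a + 2|M|]; the extra 1 keeps the length
  -- positive.
  refine ⟨2 * |M| + 1, by positivity, fun a => ?_⟩
  obtain ⟨y, hy, hya⟩ := mem_iUnion₂.1 (hcov (mem_range_self (a + |M|)))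
  have h1 := abs_le.1 (hM' y hy)
  refine ⟨a + |M| - τ y, ⟨by linarith, by linarith⟩, fun θ hθ => ?_⟩
  rw [← hτ y hy, Metric.mem_ball, dist_pi_lt_iff hδ] at hya
  have h2 := hya ⟨θ, hθ⟩
  rw [dist_eq_norm] at h2
  have e : Complex.exp (Complex.I * θ * (a + |M| - τ y : ℝ)) - 1 =
      Complex.exp (-(Complex.I * θ * (τ y : ℝ))) * (F (a + |M|) ⟨θ, hθ⟩ - F (τ y) ⟨θ, hθ⟩) := by
    simp only [F]
    rw [mul_sub, ← Complex.exp_add, ← Complex.exp_add, neg_add_cancel, Complex.exp_zero]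
    congr 2
    push_cast
    ring
  rw [e, norm_mul]
  have e2 : ‖Complex.exp (-(Complex.I * θ * (τ y : ℝ)))‖ = 1 := by
    rw [Complex.exp_neg, norm_inv, norm_exp_I_mul, inv_one]
  rwa [e2, one_mul]

theorem IsTrigApproximable.isBohrAlmostPeriodic {f : ℝ → E} (hf : IsTrigApproximable f)
    (hc : Continuous f) : IsBohrAlmostPeriodic f := by
  refine ⟨hc, fun ε hε => ?_⟩
  obtain ⟨s, x, h⟩ := hf (ε / 4) (by positivity)
  set M := ∑ θ ∈ s, ‖x θ‖ with hM
  have hM0 : 0 ≤ M := Finset.sum_nonneg fun _ _ => norm_nonneg _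
  obtain ⟨l, hl, hper⟩ := exists_common_almostPeriods s (δ := ε / (4 * (M + 1))) (by positivity)
  refine ⟨l, hl, fun a => ?_⟩
  obtain ⟨τ, hτ, hτs⟩ := hper a
  refine ⟨τ, hτ, fun t => ?_⟩
  set p : ℝ → E := fun t => ∑ θ ∈ s, Complex.exp (Complex.I * θ * t) • x θ with hp
  have h1 : ‖p (t + τ) - p t‖ ≤ ε / 4 := by
    have e : p (t + τ) - p t = ∑ θ ∈ s, Complex.exp (Complex.I * θ * t) •
        (Complex.exp (Complex.I * θ * τ) - 1) • x θ := by
      simp only [hp]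
      rw [← Finset.sum_sub_distrib]
      refine Finset.sum_congr rfl fun θ _ => ?_
      rw [smul_smul, mul_sub, ← Complex.exp_add, mul_one, sub_smul]
      congr 3
      push_cast
      ring
    rw [e]
    calc _ ≤ ∑ θ ∈ s, ε / (4 * (M + 1)) * ‖x θ‖ := by
          refine norm_sum_le_of_le _ fun θ hθ => ?_
          rw [norm_smul, norm_exp_I_mul, one_mul, norm_smul]
          gcongr
          exact (hτs θ hθ).le
      _ = ε / 4 * (M / (M + 1)) := by rw [← Finset.mul_sum, ← hM]; field_simp
      _ ≤ ε / 4 * 1 := by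
          gcongr
          rw [div_le_one (by positivity)]
          linarith
      _ = ε / 4 := mul_one _
  have e : f (t + τ) - f t = (f (t + τ) - p (t + τ)) + (p (t + τ) - p t) - (f t - p t) := by abel
  rw [e]
  calc _ ≤ ‖f (t + τ) - p (t + τ)‖ + ‖p (t + τ) - p t‖ + ‖f t - p t‖ :=
        (norm_sub_le _ _).trans (add_le_add (norm_add_le _ _) le_rfl)
    _ ≤ ε / 4 + ε / 4 + ε / 4 := add_le_add (add_le_add (h _) h1) (h _)
    _ < ε := by linarith

variable {b : HilbertBasis ι ℂ E} {C : E →L[ℂ] E}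

/-- For fixed i the derivative of the i-th coordinate is a bounded functional of the solution, so
uniform convergence of the sums entails uniform convergence of these derivatives. -/
theorem IsCoordSolution.of_hasSum {κ : Type*} {w : ι → ℝ} {V : κ → ℝ →ᵇ E} {W : ℝ →ᵇ E}
    (hV : ∀ k, IsCoordSolution b w C (V k)) (hW : HasSum V W) : IsCoordSolution b w C W := by
  intro i t
  have hu : TendstoUniformly (fun (T : Finset κ) t => (∑ k ∈ T, V k) t) W atTop :=
    BoundedContinuousFunction.tendsto_iff_tendstoUniformly.1 hW
  let Λ : E →L[ℂ] ℂ := (Complex.I * w i) • innerSL ℂ (b i) - innerSL ℂ (b i) ∘L C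
  have h1 : TendstoUniformly (fun (T : Finset κ) t => Λ ((∑ k ∈ T, V k) t)) (fun t => Λ (W t)) atTop :=
    Λ.uniformContinuous.comp_tendstoUniformly hu
  have h2 := hasDerivAt_of_tendstoUniformly (𝕜 := ℝ)
    (f := fun (T : Finset κ) t => ⟪b i, (∑ k ∈ T, V k) t⟫_ℂ) (g := fun t => ⟪b i, W t⟫_ℂ) h1
    (Eventually.of_forall fun T t => ?_) (fun t => ?_) t
  · simpa [Λ] using h2
  · have h3 := IsCoordSolution.sum T (fun k _ => hV k) i t
    simpa [Λ, BoundedContinuousFunction.coe_sum, Finset.sum_apply, Finset.mul_sum] using h3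
  · exact ((innerSL ℂ (b i)).continuous.tendsto _).comp (hu.tendsto_at t)

/-- Bounded solutions of `v' = (A - C) v`, `A` diagonal with spectrum in `I κ ℤ` of bounded
multiplicity and `C` Hilbert–Schmidt, are uniform limits of trigonometric polynomials. -/
theorem IsCoordSolution.isTrigApproximable [CompleteSpace E] {κ : ℝ} {n : ι → ℤ} (hκ : 0 < κ)
    (hC : Summable fun i => ‖ContinuousLinearMap.adjoint C (b i)‖ ^ 2)
    (J : ℤ → Finset ι) (hJ : ∀ i, i ∈ J (n i)) {N : ℕ} (hN : ∀ m, (J m).card ≤ N)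
    {v : ℝ → E} (h : IsCoordSolution b (fun i => κ * n i) C v) (hv : Continuous v) {K : ℝ}
    (hK : ∀ t, ‖v t‖ ≤ K) : IsTrigApproximable v := by
  classical
  have hw : ∀ K, {i | |κ * n i| ≤ K}.Finite := fun K => by
    have hf : {m : ℤ | |κ * m| ≤ K}.Finite := by
      refine (Set.finite_Icc (-⌈K / κ⌉) ⌈K / κ⌉).subset fun m hm => ?_
      have hm' : |κ * (m : ℝ)| ≤ K := hm
      rw [abs_mul, abs_of_pos hκ, mul_comm, ← le_div_iff₀ hκ] at hm'
      have h1 := abs_le.1 (hm'.trans (Int.le_ceil _))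
      exact ⟨by exact_mod_cast h1.1, by exact_mod_cast h1.2⟩
    refine (hf.biUnion fun m _ => (J m).finite_toSet).subset fun i hi => ?_
    exact mem_biUnion (x := n i) hi (hJ i)
  choose x hx using h.exists_abelMean hw hv hK
  have hxe : ∀ θ : ℝ, IsResolventSolution b (fun i => κ * n i) C (Complex.I * θ) 0 (x θ) := fun θ =>
    (hx θ).isResolventSolution h hv hK
  have hround : ∀ θ : ℝ, |θ - κ * round (θ / κ)| ≤ κ / 2 := fun θ => by
    have h1 := abs_sub_round (θ / κ)
    have e : θ - κ * round (θ / κ) = κ * (θ / κ - round (θ / κ)) := by field_simp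
    rw [e, abs_mul, abs_of_pos hκ]
    nlinarith
  have hsfin : ∀ m : ℤ, {θ : ℝ | x θ ≠ 0 ∧ round (θ / κ) = m}.Finite := fun m => by
    refine (finite_eigenfrequencies (b := b) (C := C) hw (|κ * m| + κ / 2)).subset ?_
    rintro θ ⟨hθ, rfl⟩
    refine ⟨?_, x θ, hθ, hxe θ⟩
    have h1 := hround θ
    have h2 := abs_sub_abs_le_abs_sub θ (κ * round (θ / κ))
    linarith
  let s : ℤ → Finset ℝ := fun m => (hsfin m).toFinset
  have hs : ∀ m θ, θ ∈ s m ↔ x θ ≠ 0 ∧ round (θ / κ) = m := fun m θ => by simp [s]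
  have hsm : ∀ m, ∀ θ ∈ s m, |θ - κ * m| ≤ κ / 2 := fun m θ hθ => by
    rw [← ((hs m θ).1 hθ).2]; exact hround θ
  have hdisj : ∀ T : Finset ℤ, (T : Set ℤ).PairwiseDisjoint s := fun T m _ m' _ hmm => by
    refine Finset.disjoint_left.2 fun θ h1 h2 => hmm ?_
    rw [← ((hs m θ).1 h1).2, ((hs m' θ).1 h2).2]
  let a : ℤ → ℝ := fun m => ∑ θ ∈ s m, ‖x θ‖ ^ 2
  have ha : Summable a := by
    refine summable_of_sum_le (c := K ^ 2) (fun m => Finset.sum_nonneg fun _ _ => by positivity)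
      fun T => ?_
    rw [← Finset.sum_biUnion (hdisj T)]
    exact sum_norm_sq_abelMean_le hv hK _ fun θ _ => hx θ
  let V : ℤ → ℝ →ᵇ E := fun m => BoundedContinuousFunction.ofNormedAddCommGroup
    (fun t => ∑ θ ∈ s m, Complex.exp (Complex.I * θ * t) • x θ) (by fun_prop) (∑ θ ∈ s m, ‖x θ‖)
    (norm_trigPoly_le _ _)
  have hVapp : ∀ m t, V m t = ∑ θ ∈ s m, Complex.exp (Complex.I * θ * t) • x θ := fun m t => rfl
  have hVsol : ∀ m, IsCoordSolution b (fun i => κ * n i) C (V m) := fun m =>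
    IsCoordSolution.sum (s m) fun θ _ => (hxe θ).isCoordSolution
  have hgood : ∀ᶠ m in cofinite, 2304 * clusterError b n C m ≤ κ ^ 2 := by
    have h1 := ((summable_clusterError (n := n) hC).tendsto_cofinite_zero).const_mul 2304
    rw [mul_zero] at h1
    exact h1.eventually_le_const (by positivity)
  set B := 2 + 1152 / κ ^ 2 * (∑' m : ℤ, 1 / (max 1 |(m : ℝ)|) ^ 2) *
      ∑' i, ‖ContinuousLinearMap.adjoint C (b i)‖ ^ 2 with hB
  have hB0 : 0 ≤ B := by
    have h1 : 0 ≤ ∑' m : ℤ, 1 / (max 1 |(m : ℝ)|) ^ 2 := tsum_nonneg fun _ => by positivity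
    have h2 : 0 ≤ ∑' i, ‖ContinuousLinearMap.adjoint C (b i)‖ ^ 2 :=
      tsum_nonneg fun _ => by positivity
    positivity
  -- The vectors e^{iθt}x_θ are again eigenvectors or zero, with norms independent of t, so the
  -- cluster estimates hold uniformly in t. The factor N comes from Cauchy–Schwarz within a cluster.
  have hsum : ∀ T : Finset ℤ, (∀ m ∈ T, 2304 * clusterError b n C m ≤ κ ^ 2) → ∀ t,
      ‖∑ m ∈ T, V m t‖ ^ 2 ≤ B * N * ∑ m ∈ T, a m := fun T hT t => by
    have hXe : ∀ θ : ℝ, IsResolventSolution b (fun i => κ * n i) C (Complex.I * θ) 0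
        (Complex.exp (Complex.I * θ * t) • x θ) := fun θ i => by
      have := hxe θ i
      simp only [map_smul, inner_smul_right, inner_zero_right] at this ⊢
      linear_combination Complex.exp (Complex.I * θ * t) * this
    have h1 := norm_sq_sum_cluster_le (κ := κ) (n := n) hC T (fun m => V m t) fun m hm i hi =>
      norm_inner_cluster_le hκ hC (by
        have := clusterError_nonneg (b := b) (n := n) (C := C) m
        linarith [hT m hm]) (s m) (hsm m) (fun θ _ => hXe θ) hi
    refine h1.trans ?_
    rw [← hB, mul_assoc]
    gcongr
    rw [Finset.mul_sum]
    refine Finset.sum_le_sum fun m hm => ?_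
    have hcard : (s m).card ≤ N := (card_cluster_le hκ hC (hT m hm) (s m) (hsm m)
      (fun θ hθ => ((hs m θ).1 hθ).1) (fun θ _ => hxe θ) (J m) (fun i hi => hi ▸ hJ i)).trans (hN m)
    calc ‖V m t‖ ^ 2 ≤ (∑ θ ∈ s m, ‖x θ‖) ^ 2 := by
          gcongr; exact norm_trigPoly_le _ _ _
      _ ≤ (s m).card * ∑ θ ∈ s m, ‖x θ‖ ^ 2 := sq_sum_le_card_mul_sum_sq
      _ ≤ N * a m := by
          have : 0 ≤ a m := Finset.sum_nonneg fun _ _ => by positivity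
          have h2 : ((s m).card : ℝ) ≤ N := by exact_mod_cast hcard
          exact mul_le_mul_of_nonneg_right h2 this
  have hVs : Summable V := by
    rw [summable_iff_vanishing_norm]
    intro ε hε
    obtain ⟨S, hS⟩ := (summable_iff_vanishing_norm.1 ha) ((ε / 2) ^ 2 / (B * N + 1)) (by positivity)
    -- The finitely many clusters without estimates are put into the exceptional set of the Cauchy
    -- criterion.
    refine ⟨S ∪ (eventually_cofinite.1 hgood).toFinset, fun T hT => ?_⟩
    rw [Finset.disjoint_union_right] at hT
    have hTg : ∀ m ∈ T, 2304 * clusterError b n C m ≤ κ ^ 2 := fun m hm => by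
      by_contra hbad
      exact Finset.disjoint_left.1 hT.2 hm (by simpa using hbad)
    have h1 := (le_abs_self _).trans (hS T hT.1).le
    refine lt_of_le_of_lt (b := ε / 2) ?_ (by linarith)
    rw [BoundedContinuousFunction.norm_le (by positivity)]
    intro t
    refine le_of_sq_le_sq ?_ (by positivity)
    rw [BoundedContinuousFunction.coe_sum, Finset.sum_apply]
    refine (hsum T hTg t).trans ?_
    calc B * N * ∑ m ∈ T, a m ≤ B * N * ((ε / 2) ^ 2 / (B * N + 1)) := by gcongr
      _ ≤ (B * N + 1) * ((ε / 2) ^ 2 / (B * N + 1)) := by gcongr; linarith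
      _ = (ε / 2) ^ 2 := by field_simp
  obtain ⟨W, hW⟩ := hVs
  have hWsol := IsCoordSolution.of_hasSum hVsol hW
  have hWb : ∀ t, ‖W t‖ ≤ ‖W‖ := W.norm_coe_le_norm
  have hpart : ∀ (T : Finset ℤ) (t : ℝ), (∑ m ∈ T, V m) t =
      ∑ θ ∈ T.biUnion s, Complex.exp (Complex.I * θ * t) • x θ := fun T t => by
    rw [Finset.sum_biUnion (hdisj T), BoundedContinuousFunction.coe_sum, Finset.sum_apply]
    rfl
  have hclose : ∀ ε > 0, ∃ S : Finset ℤ, ∀ T, S ⊆ T → ∀ t, ‖W t - ∑ θ ∈ T.biUnion s,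
      Complex.exp (Complex.I * θ * t) • x θ‖ ≤ ε := fun ε hε => by
    obtain ⟨S, hS⟩ := mem_atTop_sets.1 (hW (Metric.ball_mem_nhds W hε))
    refine ⟨S, fun T hT t => ?_⟩
    have h1 : dist (∑ m ∈ T, V m) W < ε := hS T hT
    rw [← hpart, ← dist_eq_norm, dist_comm]
    exact (BoundedContinuousFunction.dist_coe_le_dist t).trans h1.le
  have hWmean : ∀ θ, IsAbelMean W θ (x θ) := fun θ => by
    obtain ⟨y, hy⟩ := hWsol.exists_abelMean hw W.continuous hWb θ
    suffices y = x θ from this ▸ hy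
    rw [← sub_eq_zero, ← norm_eq_zero]
    refine le_antisymm (le_of_forall_pos_le_add fun ε hε => ?_) (norm_nonneg _)
    obtain ⟨S, hS⟩ := hclose ε hε
    have h1 := isAbelMean_trigPoly ((insert (round (θ / κ)) S).biUnion s) x θ
    -- Enlarging S by the cluster of θ ensures that the partial sum already has Abel mean x_θ at θ.
    have h2 : (if θ ∈ (insert (round (θ / κ)) S).biUnion s then x θ else 0) = x θ := by
      by_cases hθ : x θ = 0
      · simp [hθ]
      · refine if_pos (Finset.mem_biUnion.2 ⟨round (θ / κ), Finset.mem_insert_self _ _, ?_⟩)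
        exact (hs _ _).2 ⟨hθ, rfl⟩
    rw [h2] at h1
    have h3 := hy.sub h1 W.continuous hWb (by fun_prop) (norm_trigPoly_le _ _)
    rw [zero_add]
    exact h3.norm_le (hS _ (Finset.subset_insert _ _))
  have hvW : ∀ t, v t = W t := fun t₀ => by
    have hbd : ∀ t, ‖v t - W t‖ ≤ K + ‖W‖ := fun t =>
      (norm_sub_le _ _).trans (add_le_add (hK t) (hWb t))
    have hcont : Continuous fun t => v t - W t := hv.sub W.continuous
    have h1 : ∀ θ, IsAbelMean (fun t => v t - W t) θ 0 := fun θ => by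
      simpa using (hx θ).sub (hWmean θ) hv hK W.continuous hWb
    have h2 := ((h.sub hWsol).translate t₀).eq_zero_of_abelMean hw (by fun_prop)
      (fun t => hbd (t + t₀)) fun θ => (h1 θ).translate_zero hcont hbd t₀
    rw [zero_add] at h2
    exact sub_eq_zero.1 h2
  intro ε hε
  obtain ⟨S, hS⟩ := hclose ε hε
  refine ⟨S.biUnion s, x, fun t => ?_⟩
  rw [hvW]
  exact hS S le_rfl t

end TrigonometricApproximation

/-! ### Similarity to a Hilbert–Schmidt perturbation -/

section Similarity

open scoped InnerProductSpace Topology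
open Filter

theorem summable_norm_sq_add {α : Type*} {f g : α → ℂ} (hf : Summable fun a => ‖f a‖ ^ 2)
    (hg : Summable fun a => ‖g a‖ ^ 2) : Summable fun a => ‖f a + g a‖ ^ 2 := by
  refine Summable.of_nonneg_of_le (fun _ => by positivity) (fun a => ?_) ((hf.add hg).mul_left 2)
  exact (pow_le_pow_left₀ (norm_nonneg _) (norm_add_le _ _) 2).trans add_sq_le

theorem summable_norm_sq_sum {α γ : Type*} (s : Finset γ) {f : γ → α → ℂ}
    (hf : ∀ k ∈ s, Summable fun a => ‖f k a‖ ^ 2) : Summable fun a => ‖∑ k ∈ s, f k a‖ ^ 2 := by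
  classical
  induction s using Finset.induction_on with
  | empty => simp [summable_zero]
  | insert k s hk ih =>
    simp only [Finset.sum_insert hk]
    exact summable_norm_sq_add (hf k (Finset.mem_insert_self _ _))
      (ih fun j hj => hf j (Finset.mem_insert_of_mem hj))

theorem exists_finset_tsum_norm_sq_le {α : Type*} [DecidableEq α] {f : α → ℂ}
    (hf : Summable fun a => ‖f a‖ ^ 2) {ε : ℝ} (hε : 0 < ε) :
    ∃ F : Finset α, Summable (fun a => ‖if a ∈ F then 0 else f a‖ ^ 2) ∧
      ∑' a, ‖if a ∈ F then 0 else f a‖ ^ 2 ≤ ε := by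
  have h1 := hf.hasSum
  obtain ⟨F, hF⟩ := (h1.eventually_const_le (sub_lt_self _ hε)).exists
  have h2 : HasSum (fun a => if a ∈ F then ‖f a‖ ^ 2 else 0) (∑ a ∈ F, ‖f a‖ ^ 2) := by
    have h : HasSum (fun a => if a ∈ F then ‖f a‖ ^ 2 else 0)
        (∑ a ∈ F, if a ∈ F then ‖f a‖ ^ 2 else 0) :=
      hasSum_sum_of_ne_finset_zero fun a ha => if_neg ha
    rwa [Finset.sum_congr rfl fun a ha => if_pos ha] at h
  have h3 : HasSum (fun a => ‖if a ∈ F then 0 else f a‖ ^ 2)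
      (∑' a, ‖f a‖ ^ 2 - ∑ a ∈ F, ‖f a‖ ^ 2) := by
    convert! h1.sub h2 using 2 with a
    split_ifs <;> simp
  exact ⟨F, h3.summable, by rw [h3.tsum_eq]; linarith⟩

variable {ι E : Type*} [NormedAddCommGroup E] [InnerProductSpace ℂ E]

theorem HilbertBasis.clm_ext {F : Type*} [NormedAddCommGroup F] [NormedSpace ℂ F]
    (b : HilbertBasis ι ℂ E) {S T : E →L[ℂ] F} (h : ∀ j, S (b j) = T (b j)) : S = T := by
  refine ContinuousLinearMap.ext_on (s := Set.range b)
    (Submodule.dense_iff_topologicalClosure_eq_top.2 b.dense_span) ?_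
  rintro _ ⟨j, rfl⟩
  exact h j

theorem HilbertBasis.diagonal_apply_self (b : HilbertBasis ι ℂ E) {T : E →L[ℂ] E} {a : ι → ℂ}
    (hT : ∀ x i, ⟪b i, T x⟫_ℂ = a i * ⟪b i, x⟫_ℂ) (j : ι) : T (b j) = a j • b j := by
  refine b.ext_inner fun i => ?_
  rw [hT, inner_smul_right]
  by_cases h : i = j
  · rw [h]
  · rw [b.orthonormal.2 h, mul_zero, mul_zero]

/-- Each coordinate of A - C is a bounded functional, even though A is unbounded, so the integrated
equation may be differentiated coordinatewise. -/
theorem isCoordSolution_of_integral_eq [CompleteSpace E] {b : HilbertBasis ι ℂ E} {w : ι → ℝ}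
    {C : E →L[ℂ] E} {v : ℝ → E} (hv : Continuous v)
    (h : ∀ t i, ⟪b i, v t⟫_ℂ = ⟪b i, v 0⟫_ℂ + (Complex.I * w i * ⟪b i, ∫ τ in (0 : ℝ)..t, v τ⟫_ℂ -
      ⟪b i, C (∫ τ in (0 : ℝ)..t, v τ)⟫_ℂ)) : IsCoordSolution b w C v := by
  intro i t
  let Λ : E →L[ℂ] ℂ := (Complex.I * w i) • innerSL ℂ (b i) - innerSL ℂ (b i) ∘L C
  have h1 : HasDerivAt (fun t => ∫ τ in (0 : ℝ)..t, v τ) (v t) t :=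
    intervalIntegral.integral_hasDerivAt_right (hv.intervalIntegrable _ _)
      hv.stronglyMeasurable.stronglyMeasurableAtFilter hv.continuousAt
  have h2 := ((Λ.restrictScalars ℝ).hasFDerivAt.comp_hasDerivAt t h1).const_add ⟪b i, v 0⟫_ℂ
  refine h2.congr_of_eventuallyEq (Eventually.of_forall fun s => ?_)
  simp only [h s i]
  rfl

/-- A commutator estimate for `X = Γ B`, formulated as an intertwining relation with the resolvent of
the diagonal operator `A`. -/
theorem exists_resolvent_intertwining (b : HilbertBasis ι ℂ E) (w : ι → ℝ) (β : ι → E)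
    (hβ : Summable fun p : ι × ι => ‖⟪β p.1, b p.2⟫_ℂ‖ ^ 2 / (1 + w p.2 ^ 2))
    {X J : E →L[ℂ] E}
    (hJβ : ∀ i j, ⟪b i, J (b j)⟫_ℂ = 0 ∨ ⟪b i, J (b j)⟫_ℂ = ⟪β i, b j⟫_ℂ)
    (hXJ : ∀ i j, ⟪b i, X (b j)⟫_ℂ * (Complex.I * (w i - w j)) =
      ⟪β i, b j⟫_ℂ - ⟪b i, J (b j)⟫_ℂ) :
    ∃ (c : ℝ) (R T : E →L[ℂ] E), 1 ≤ c ∧ ‖T‖ ≤ 1 / 4 ∧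
      (∀ x i, ⟪b i, R x⟫_ℂ = (c - Complex.I * w i)⁻¹ * ⟪b i, x⟫_ℂ) ∧ X * R = R * (X + T) ∧
      ∀ x i, ⟪b i, T x⟫_ℂ = ⟪b i, J (R x)⟫_ℂ - ⟪β i, R x⟫_ℂ := by
  have hnorm : ∀ (c : ℝ) j, ‖(c : ℂ) - Complex.I * w j‖ ^ 2 = c ^ 2 + w j ^ 2 := fun c j => by
    rw [← Complex.normSq_eq_norm_sq, Complex.normSq_apply]
    simp
    ring
  -- The squared Hilbert–Schmidt norm of B(c - A)⁻¹ tends to 0 as c → ∞, so T = (J - B)(c - A)⁻¹ can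
  -- be made small.
  have hlim : Tendsto (fun c : ℝ => ∑' p : ι × ι, ‖⟪β p.1, b p.2⟫_ℂ‖ ^ 2 / (c ^ 2 + w p.2 ^ 2))
      atTop (𝓝 (∑' _ : ι × ι, 0)) := by
    refine tendsto_tsum_of_dominated_convergence hβ (fun p => ?_) ?_
    · refine Tendsto.div_atTop tendsto_const_nhds ?_
      exact tendsto_atTop_add_const_right _ _ (tendsto_pow_atTop two_ne_zero)
    · filter_upwards [eventually_ge_atTop 1] with c hc p
      rw [Real.norm_of_nonneg (by positivity)]
      gcongr
      nlinarith
  rw [tsum_zero] at hlim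
  obtain ⟨c, hc1, hc⟩ := ((eventually_ge_atTop (1 : ℝ)).and
    (hlim.eventually_le_const (show (0 : ℝ) < (1 / 4) ^ 2 by norm_num))).exists
  have hne : ∀ i, (c : ℂ) - Complex.I * w i ≠ 0 := fun i h0 => by
    have := hnorm c i
    rw [h0, norm_zero] at this
    nlinarith [sq_nonneg (w i)]
  obtain ⟨R, hR, -⟩ := b.exists_diagonal (fun i => (c - Complex.I * w i)⁻¹) 1 zero_le_one fun i => by
    rw [norm_inv]
    refine inv_le_one_of_one_le₀ ?_
    refine le_of_sq_le_sq ?_ (norm_nonneg _)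
    rw [hnorm]
    nlinarith [sq_nonneg (w i)]
  have hsc : Summable fun p : ι × ι => ‖⟪β p.1, b p.2⟫_ℂ‖ ^ 2 / (c ^ 2 + w p.2 ^ 2) :=
    Summable.of_nonneg_of_le (fun p => by positivity) (fun p => by gcongr; nlinarith) hβ
  have hle : ∀ p : ι × ι, ‖(⟪b p.1, J (b p.2)⟫_ℂ - ⟪β p.1, b p.2⟫_ℂ) * (c - Complex.I * w p.2)⁻¹‖ ^ 2 ≤
      ‖⟪β p.1, b p.2⟫_ℂ‖ ^ 2 / (c ^ 2 + w p.2 ^ 2) := fun p => by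
    rw [norm_mul, mul_pow, norm_inv, inv_pow, hnorm, ← div_eq_mul_inv]
    gcongr
    rcases hJβ p.1 p.2 with h | h <;> rw [h] <;> simp
  have hsT := Summable.of_nonneg_of_le (fun p => by positivity) hle hsc
  obtain ⟨T, hT, hTn⟩ := b.exists_matrix
    (fun i j => (⟪b i, J (b j)⟫_ℂ - ⟪β i, b j⟫_ℂ) * (c - Complex.I * w j)⁻¹) hsT
  have hRb := b.diagonal_apply_self hR
  refine ⟨c, R, T, hc1, hTn.trans ?_, hR, ?_, fun x i => ?_⟩
  · rw [Real.sqrt_le_left (by norm_num)]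
    exact (hsT.tsum_le_tsum hle hsc).trans hc
  -- With R = (c - A)⁻¹ this is [A, X] = B - J multiplied by R on both sides; it expresses that X
  -- preserves the domain of A, the range of R.
  · refine b.operator_ext fun i j => ?_
    change ⟪b i, X (R (b j))⟫_ℂ = ⟪b i, R (X (b j) + T (b j))⟫_ℂ
    rw [hRb, map_smul, inner_smul_right, hR, inner_add_right, hT]
    have h1 := hne i
    have h2 := hne j
    field_simp
    linear_combination -hXJ i j
  · have : innerSL ℂ (b i) ∘L T = innerSL ℂ (b i) ∘L J ∘L R - innerSL ℂ (β i) ∘L R := by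
      refine b.clm_ext fun j => ?_
      change ⟪b i, T (b j)⟫_ℂ = ⟪b i, J (R (b j))⟫_ℂ - ⟪β i, R (b j)⟫_ℂ
      rw [hT, hRb, map_smul, inner_smul_right, inner_smul_right]
      ring
    exact congrArg (fun f : E →L[ℂ] ℂ => f x) this

theorem HilbertBasis.sub_apply_of_finset [DecidableEq ι] (b : HilbertBasis ι ℂ E) {F : Finset (ι × ι)}
    {X₀ : ι → ι → ℂ} {X Y : E →L[ℂ] E} (hYm : ∀ i j, ⟪b i, Y (b j)⟫_ℂ = X₀ i j)
    (hXm : ∀ i j, ⟪b i, X (b j)⟫_ℂ = if (i, j) ∈ F then 0 else X₀ i j) (j : ι) :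
    Y (b j) - X (b j) = ∑ p ∈ F, (if p.2 = j then X₀ p.1 p.2 else 0) • b p.1 := by
  refine b.ext_inner fun i => ?_
  rw [inner_sub_right, hYm, hXm, inner_sum]
  simp only [inner_smul_right, orthonormal_iff_ite.1 b.orthonormal]
  by_cases h : (i, j) ∈ F
  · rw [Finset.sum_eq_single (i, j)]
    · simp [h]
    · intro p _ hp
      by_cases h1 : p.2 = j
      · have : i ≠ p.1 := fun e => hp (by rw [e, ← h1])
        simp [this]
      · simp [h1]
    · exact fun h' => absurd h h'
  · rw [Finset.sum_eq_zero]
    · simp [h]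
    · intro p hp
      by_cases h1 : p.2 = j
      · have : i ≠ p.1 := fun e => h (by rw [e, ← h1]; exact hp)
        simp [this]
      · simp [h1]

/-- X is X₀ with the entries in a finite set F deleted to make it small. J receives the entries of B
with equal eigenvalues and those in F, so that the commutator equation stays exact. K = BX differs
from BX₀ by finitely many multiples of columns of B, which are square summable. -/
theorem exists_isHS_perturbation [CompleteSpace E] (b : HilbertBasis ι ℂ E) (w : ι → ℝ) (β : ι → E)
    (X₀ : ι → ι → ℂ)
    (hX₀ : ∀ i j, X₀ i j = if w i = w j then 0 else ⟪β i, b j⟫_ℂ / (Complex.I * (w i - w j)))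
    (hX : Summable fun p : ι × ι => ‖X₀ p.1 p.2‖ ^ 2)
    (hdiag : Summable fun p : ι × ι => ‖if w p.1 = w p.2 then ⟪β p.1, b p.2⟫_ℂ else 0‖ ^ 2)
    (hcol : ∀ j, Summable fun i => ‖⟪β i, b j⟫_ℂ‖ ^ 2)
    (hprod : Summable fun p : ι × ι => ‖∑' j, ⟪β p.1, b j⟫_ℂ * X₀ j p.2‖ ^ 2) :
    ∃ X J K : E →L[ℂ] E, ‖X‖ ≤ 1 / 4 ∧
      (∀ i j, ⟪b i, J (b j)⟫_ℂ = 0 ∨ ⟪b i, J (b j)⟫_ℂ = ⟪β i, b j⟫_ℂ) ∧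
      (∀ i j, ⟪b i, X (b j)⟫_ℂ * (Complex.I * (w i - w j)) = ⟪β i, b j⟫_ℂ - ⟪b i, J (b j)⟫_ℂ) ∧
      b.IsHS (J + K) ∧ ∀ x i, ⟪b i, K x⟫_ℂ = ⟪β i, X x⟫_ℂ := by
  classical
  obtain ⟨F, hF, hFle⟩ := exists_finset_tsum_norm_sq_le hX (show (0 : ℝ) < (1 / 4) ^ 2 by norm_num)
  obtain ⟨X, hXm, hXn⟩ := b.exists_matrix (fun i j => if (i, j) ∈ F then 0 else X₀ i j) hF
  obtain ⟨Y, hYm, -⟩ := b.exists_matrix X₀ hX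
  have hJs : Summable fun p : ι × ι =>
      ‖if w p.1 = w p.2 ∨ (p.1, p.2) ∈ F then ⟪β p.1, b p.2⟫_ℂ else 0‖ ^ 2 := by
    refine Summable.of_nonneg_of_le (fun _ => by positivity) (fun p => ?_) (hdiag.add
      (summable_of_ne_finset_zero (s := F) (f := fun p => if p ∈ F then ‖⟪β p.1, b p.2⟫_ℂ‖ ^ 2 else 0)
        fun p hp => if_neg hp))
    by_cases h1 : w p.1 = w p.2 <;> by_cases h2 : p ∈ F <;> simp [h1, h2]
  obtain ⟨J, hJ, -⟩ := b.exists_matrix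
    (fun i j => if w i = w j ∨ (i, j) ∈ F then ⟪β i, b j⟫_ℂ else 0) hJs
  have hYX := b.sub_apply_of_finset hYm hXm
  have hKs : Summable fun p : ι × ι => ‖⟪β p.1, X (b p.2)⟫_ℂ‖ ^ 2 := by
    have e : ∀ p : ι × ι, ⟪β p.1, X (b p.2)⟫_ℂ = (∑' j, ⟪β p.1, b j⟫_ℂ * X₀ j p.2) +
        ∑ q ∈ F, (if q.2 = p.2 then -X₀ q.1 q.2 * ⟪β p.1, b q.1⟫_ℂ else 0) := fun p => by
      have h1 : X (b p.2) = Y (b p.2) - (Y (b p.2) - X (b p.2)) := by abel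
      rw [h1, inner_sub_right, hYX, inner_sum, sub_eq_add_neg, ← Finset.sum_neg_distrib,
        ← b.tsum_inner_mul_inner]
      congr 1
      · simp only [hYm]
      · refine Finset.sum_congr rfl fun q _ => ?_
        rw [inner_smul_right]
        split_ifs <;> ring
    simp only [e]
    refine summable_norm_sq_add hprod (summable_norm_sq_sum F fun q _ => ?_)
    have hinj : Function.Injective fun i : ι => (i, q.2) := fun i i' h => (Prod.ext_iff.1 h).1
    refine (hinj.summable_iff ?_).1 ?_
    · rintro ⟨i, j⟩ hp
      have : q.2 ≠ j := fun e => hp ⟨i, by rw [e]⟩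
      simp [this]
    · simp only [Function.comp_def, if_true, norm_mul, mul_pow]
      exact (hcol q.1).mul_left _
  obtain ⟨K, hK, -⟩ := b.exists_matrix (fun i j => ⟪β i, X (b j)⟫_ℂ) hKs
  refine ⟨X, J, K, hXn.trans ?_, fun i j => ?_, fun i j => ?_, ?_, fun x i => ?_⟩
  · rw [Real.sqrt_le_left (by norm_num)]
    exact hFle
  · rw [hJ]
    split_ifs
    · exact Or.inr rfl
    · exact Or.inl rfl
  · rw [hXm, hJ, hX₀]
    by_cases h1 : w i = w j
    · simp [h1]
    · by_cases h2 : (i, j) ∈ F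
      · simp [h2]
      · have : (w i : ℂ) - w j ≠ 0 := by
          rw [sub_ne_zero]; exact_mod_cast h1
        simp only [h1, h2, if_false, or_self, sub_zero]
        field_simp
  · refine HilbertBasis.IsHS.add (?_ : Summable _) (?_ : Summable _)
    · simpa only [hJ] using hJs
    · simpa only [hK] using hKs
  · have : innerSL ℂ (b i) ∘L K = innerSL ℂ (β i) ∘L X := b.clm_ext fun j => hK i j
    exact congrArg (fun f : E →L[ℂ] ℂ => f x) this

/-- Similarity of `A - B`, `B` given by the rows `β`, to a Hilbert–Schmidt perturbation of `A`, on
the level of bounded mild solutions. -/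
theorem exists_similar_solution [CompleteSpace E] (b : HilbertBasis ι ℂ E) (w : ι → ℝ) (β : ι → E)
    (X₀ : ι → ι → ℂ)
    (hX₀ : ∀ i j, X₀ i j = if w i = w j then 0 else ⟪β i, b j⟫_ℂ / (Complex.I * (w i - w j)))
    (hX : Summable fun p : ι × ι => ‖X₀ p.1 p.2‖ ^ 2)
    (hdiag : Summable fun p : ι × ι => ‖if w p.1 = w p.2 then ⟪β p.1, b p.2⟫_ℂ else 0‖ ^ 2)
    (hβ : Summable fun p : ι × ι => ‖⟪β p.1, b p.2⟫_ℂ‖ ^ 2 / (1 + w p.2 ^ 2))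
    (hcol : ∀ j, Summable fun i => ‖⟪β i, b j⟫_ℂ‖ ^ 2)
    (hprod : Summable fun p : ι × ι => ‖∑' j, ⟪β p.1, b j⟫_ℂ * X₀ j p.2‖ ^ 2)
    {u : ℝ → E} (hu : Continuous u)
    (hD : ∀ t, ∃ D : E, ∀ i, ⟪b i, D⟫_ℂ = Complex.I * w i * ⟪b i, ∫ τ in (0 : ℝ)..t, u τ⟫_ℂ)
    (hsol : ∀ t i, ⟪b i, u t⟫_ℂ = ⟪b i, u 0⟫_ℂ + (Complex.I * w i * ⟪b i, ∫ τ in (0 : ℝ)..t, u τ⟫_ℂ -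
      ⟪β i, ∫ τ in (0 : ℝ)..t, u τ⟫_ℂ)) :
    ∃ S Y C : E →L[ℂ] E, (∀ x, S (Y x) = x) ∧
      (Summable fun i => ‖ContinuousLinearMap.adjoint C (b i)‖ ^ 2) ∧
      IsCoordSolution b w C (fun t => Y (u t)) := by
  obtain ⟨X, J, K, hXn, hJβ, hXJ, hHS, hK⟩ := exists_isHS_perturbation b w β X₀ hX₀ hX hdiag hcol hprod
  obtain ⟨c, R, T, hc1, hTn, hR, hXR, hT⟩ := exists_resolvent_intertwining b w β hβ hJβ hXJ
  have hunit : ∀ A : E →L[ℂ] E, ‖A‖ < 1 → IsUnit (1 + A) := fun A hA => by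
    have := isUnit_one_sub_of_norm_lt_one (x := -A) (by rwa [norm_neg])
    rwa [sub_neg_eq_add] at this
  have hUX := hunit X (by linarith)
  have hUXT := hunit (X + T) (lt_of_le_of_lt (norm_add_le _ _) (by linarith))
  set Y := Ring.inverse (1 + X) with hY
  set Z := Ring.inverse (1 + (X + T)) with hZ
  have hSY : ∀ x, (1 + X) (Y x) = x := fun x => by
    change ((1 + X) * Y) x = x
    rw [Ring.mul_inverse_cancel _ hUX]; rfl
  have hYS : ∀ x, Y ((1 + X) x) = x := fun x => by
    change (Y * (1 + X)) x = x
    rw [Ring.inverse_mul_cancel _ hUX]; rfl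
  have hZ1 : ∀ x, (1 + (X + T)) (Z x) = x := fun x => by
    change ((1 + (X + T)) * Z) x = x
    rw [Ring.mul_inverse_cancel _ hUXT]; rfl
  have hne : ∀ i, (c : ℂ) - Complex.I * w i ≠ 0 := fun i h0 => by
    have := congrArg Complex.re h0
    simp at this
    linarith
  refine ⟨1 + X, Y, Y ∘L (J + K), hSY, (hHS.comp_left Y).summable_adjoint,
    isCoordSolution_of_integral_eq (Y.continuous.comp hu) fun t i => ?_⟩
  rw [Y.intervalIntegral_comp_comm (hu.intervalIntegrable _ _)]
  obtain ⟨D, hDi⟩ := hD t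
  have hsolt := hsol t
  set U := ∫ τ in (0 : ℝ)..t, u τ with hU
  -- D stands for AU, so z' = (1 + X + T)⁻¹(c - A)U. Then y = Rz' satisfies (1 + X)y = R(1 + X +
  -- T)z' = U: thus YU = y lies in the domain of A, with Ay = cy - z'.
  set z' := Z ((c : ℂ) • U - D) with hz'
  set y := R z' with hy
  have hz : z' + (X z' + T z') = (c : ℂ) • U - D := hZ1 _
  have hyU : y + X y = U := by
    have h1 : X y = R (X z' + T z') := congrArg (fun f : E →L[ℂ] E => f z') hXR
    rw [h1, hy, ← map_add, hz]
    refine b.ext_inner fun i => ?_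
    rw [hR, inner_sub_right, inner_smul_right, hDi]
    have := hne i
    field_simp
  have hYU : Y U = y := by
    rw [← hyU]
    exact hYS y
  -- The similarity (A - B)(1 + X)y = (1 + X)Ay - (J + K)y.
  have hmain : u t - u 0 = (1 + X) ((c : ℂ) • y - z') - (J y + K y) := by
    refine b.ext_inner fun i => ?_
    have e1 : (1 + X) ((c : ℂ) • y - z') = (c : ℂ) • U - (z' + X z') := by
      change ((c : ℂ) • y - z') + X ((c : ℂ) • y - z') = _
      rw [map_sub, map_smul, ← hyU, smul_add]
      abel
    have e2 : ⟪b i, z'⟫_ℂ + (⟪b i, X z'⟫_ℂ + ⟪b i, T z'⟫_ℂ) = c * ⟪b i, U⟫_ℂ - ⟪b i, D⟫_ℂ := by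
      rw [← inner_add_right, ← inner_add_right, hz, inner_sub_right, inner_smul_right]
    have e3 : ⟪β i, U⟫_ℂ = ⟪β i, y⟫_ℂ + ⟪b i, K y⟫_ℂ := by
      rw [hK, ← inner_add_right, hyU]
    have e4 := hT z' i
    rw [← hy] at e4
    have e5 := hDi i
    rw [e1]
    simp only [inner_sub_right, inner_add_right, inner_smul_right]
    rw [hsolt i, e3]
    linear_combination e2 - e4 - e5
  have hv : Y (u t) = Y (u 0) + (((c : ℂ) • y - z') - Y (J y + K y)) := by
    have h1 := congrArg Y hmain
    rw [map_sub, map_sub, hYS] at h1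
    rw [← h1]; abel
  rw [hv, hYU, inner_add_right]
  congr 1
  change _ = _ - ⟪b i, Y (J y + K y)⟫_ℂ
  rw [inner_sub_right]
  congr 1
  have h1 := hR z' i
  rw [← hy] at h1
  have h2 := hne i
  rw [inner_sub_right, inner_smul_right]
  have h3 : (c - Complex.I * w i) * ⟪b i, y⟫_ℂ = ⟪b i, z'⟫_ℂ := by
    rw [h1, mul_inv_cancel_left₀ h2]
  linear_combination h3

end Similarity

/-! ### Summability conditions for the block Hankel matrix -/

section Coefficients

open scoped InnerProductSpace Topology
open Filter

theorem Summable.comp_fst_of_finite {α γ : Type*} [Finite γ] {f : α → ℝ} (hf : Summable f) :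
    Summable fun q : α × γ => f q.1 := by
  have h : Summable fun q : α × γ => f q.1 * (fun _ => (1 : ℝ)) q.2 :=
    summable_mul_of_summable_norm (g := fun _ : γ => (1 : ℝ)) hf.norm Summable.of_finite
  simpa using h

theorem summable_of_le_fst_fst {d : ℕ} {f : (ℤ × Fin d) × (ℤ × Fin d) → ℝ} {G : ℤ × ℤ → ℝ} (hG : Summable G)
    (hf : ∀ p, 0 ≤ f p) (hfG : ∀ p, f p ≤ G (p.1.1, p.2.1)) : Summable f := by
  have h2 : Summable fun p : (ℤ × Fin d) × (ℤ × Fin d) => G (p.1.1, p.2.1) :=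
    (hG.comp_fst_of_finite (γ := Fin d × Fin d)).comp_injective
      (Equiv.prodProdProdComm ℤ (Fin d) ℤ (Fin d)).injective
  exact Summable.of_nonneg_of_le hf hfG h2

/-- The double sums needed for X₀, for the diagonal blocks and for B(c - A)⁻¹ become products of
single sums after an injective substitution (j, ℓ) ↦ (j + ℓ, j - ℓ) or (j + ℓ, ℓ). -/
theorem summable_mul_inv_max_sq_comp {g : ℤ → ℝ} (hg : Summable g) {e : ℤ × ℤ → ℤ × ℤ}
    (he : Function.Injective e) :
    Summable fun p => g (e p).1 * (1 / (max 1 |((e p).2 : ℝ)|) ^ 2) :=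
  (summable_mul_of_summable_norm (f := g) (g := fun m : ℤ => 1 / (max 1 |(m : ℝ)|) ^ 2) hg.norm
    summable_inv_max_sq.norm).comp_injective he

variable {H : Type*} [NormedAddCommGroup H] [InnerProductSpace ℂ H]

theorem OrthonormalBasis.norm_inner_apply_le {ι : Type*} [Fintype ι] (h : OrthonormalBasis ι ℂ H)
    (T : H →L[ℂ] H) (k l : ι) : ‖⟪h k, T (h l)⟫_ℂ‖ ≤ ‖T‖ := by
  refine (norm_inner_le_norm _ _).trans ?_
  rw [h.norm_eq_one, one_mul]
  simpa [h.norm_eq_one] using T.le_opNorm (h l)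

variable {d : ℕ} {h : OrthonormalBasis (Fin d) ℂ H} {W : ℤ → H →L[ℂ] H} {κ : ℝ}
  {M X₀ : ℤ × Fin d → ℤ × Fin d → ℂ}

theorem norm_hankel_le (hM : ∀ i j, M i j = ⟪h i.2, W (i.1 + j.1) (h j.2)⟫_ℂ) (i j : ℤ × Fin d) :
    ‖M i j‖ ^ 2 ≤ ‖W (i.1 + j.1)‖ ^ 2 := by
  rw [hM]
  gcongr
  exact h.norm_inner_apply_le _ _ _

theorem injective_add_sub : Function.Injective fun p : ℤ × ℤ => (p.1 + p.2, p.1 - p.2) := by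
  rintro ⟨a, b⟩ ⟨c, e⟩ h
  simp only [Prod.mk.injEq] at h ⊢
  omega

theorem injective_add_snd : Function.Injective fun p : ℤ × ℤ => (p.1 + p.2, p.2) := by
  rintro ⟨a, b⟩ ⟨c, e⟩ h
  simp only [Prod.mk.injEq] at h ⊢
  omega

theorem norm_commutator_solution_sq_le (hκ : 0 < κ)
    (hM : ∀ i j, M i j = ⟪h i.2, W (i.1 + j.1) (h j.2)⟫_ℂ)
    (hX₀ : ∀ i j, X₀ i j = if κ * i.1 = κ * j.1 then 0 else
      M i j / (Complex.I * ((κ * i.1 : ℝ) - (κ * j.1 : ℝ)))) (i j : ℤ × Fin d) :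
    ‖X₀ i j‖ ^ 2 ≤ κ⁻¹ ^ 2 * (‖W (i.1 + j.1)‖ ^ 2 * (1 / (max 1 |((i.1 - j.1 : ℤ) : ℝ)|) ^ 2)) := by
  rw [hX₀]
  split_ifs with h1
  · rw [norm_zero, zero_pow two_ne_zero]
    positivity
  · have h2 : i.1 ≠ j.1 := fun e => h1 (by rw [e])
    have h3 : (1 : ℝ) ≤ |((i.1 - j.1 : ℤ) : ℝ)| := by
      exact_mod_cast Int.one_le_abs (sub_ne_zero.2 h2)
    have h4 : Complex.I * (((κ * i.1 : ℝ) : ℂ) - (κ * j.1 : ℝ)) =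
        Complex.I * ((κ * ((i.1 - j.1 : ℤ) : ℝ) : ℝ) : ℂ) := by
      push_cast
      ring
    rw [h4, max_eq_right h3, norm_div, norm_mul, Complex.norm_I, one_mul, Complex.norm_real, norm_mul,
      Real.norm_of_nonneg hκ.le, Real.norm_eq_abs, div_pow, mul_pow, inv_pow]
    have h5 := norm_hankel_le hM i j
    have h6 : 0 < |((i.1 - j.1 : ℤ) : ℝ)| := by linarith
    calc _ ≤ ‖W (i.1 + j.1)‖ ^ 2 / (κ ^ 2 * |((i.1 - j.1 : ℤ) : ℝ)| ^ 2) := by gcongr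
      _ = _ := by field_simp

theorem summable_commutator_solution (hκ : 0 < κ) (hW : Summable fun n => ‖W n‖ ^ 2)
    (hM : ∀ i j, M i j = ⟪h i.2, W (i.1 + j.1) (h j.2)⟫_ℂ)
    (hX₀ : ∀ i j, X₀ i j = if κ * i.1 = κ * j.1 then 0 else
      M i j / (Complex.I * ((κ * i.1 : ℝ) - (κ * j.1 : ℝ)))) :
    Summable fun p : (ℤ × Fin d) × (ℤ × Fin d) => ‖X₀ p.1 p.2‖ ^ 2 :=
  summable_of_le_fst_fst ((summable_mul_inv_max_sq_comp hW injective_add_sub).mul_left _)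
    (fun _ => sq_nonneg _) fun p => norm_commutator_solution_sq_le hκ hM hX₀ p.1 p.2

theorem summable_hankel_diagonal (hκ : 0 < κ) (hW : Summable fun n => ‖W n‖ ^ 2)
    (hM : ∀ i j, M i j = ⟪h i.2, W (i.1 + j.1) (h j.2)⟫_ℂ) :
    Summable fun p : (ℤ × Fin d) × (ℤ × Fin d) =>
      ‖if κ * p.1.1 = κ * p.2.1 then M p.1 p.2 else 0‖ ^ 2 := by
  refine summable_of_le_fst_fst (summable_mul_inv_max_sq_comp hW injective_add_sub)
    (fun _ => sq_nonneg _) fun p => ?_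
  dsimp only
  split_ifs with h1
  · have h2 : p.1.1 = p.2.1 := by exact_mod_cast mul_left_cancel₀ hκ.ne' h1
    refine (norm_hankel_le hM p.1 p.2).trans ?_
    simp [h2]
  · rw [norm_zero, zero_pow two_ne_zero]
    positivity

theorem summable_hankel_div (hκ : 0 < κ) (hW : Summable fun n => ‖W n‖ ^ 2)
    (hM : ∀ i j, M i j = ⟪h i.2, W (i.1 + j.1) (h j.2)⟫_ℂ) :
    Summable fun p : (ℤ × Fin d) × (ℤ × Fin d) => ‖M p.1 p.2‖ ^ 2 / (1 + (κ * p.2.1) ^ 2) := by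
  refine summable_of_le_fst_fst ((summable_mul_inv_max_sq_comp hW injective_add_snd).mul_left
    (1 + κ⁻¹ ^ 2)) (fun _ => by positivity) fun p => ?_
  dsimp only
  have h1 : (max 1 |(p.2.1 : ℝ)|) ^ 2 ≤ (1 + κ⁻¹ ^ 2) * (1 + (κ * p.2.1) ^ 2) := by
    have e : (1 + κ⁻¹ ^ 2) * (1 + (κ * p.2.1) ^ 2) = 1 + κ⁻¹ ^ 2 + (κ * p.2.1) ^ 2 + (p.2.1 : ℝ) ^ 2 := by
      field_simp
      ring
    rw [e]
    rcases max_choice (1 : ℝ) |(p.2.1 : ℝ)| with h | h <;> rw [h]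
    · nlinarith [sq_nonneg κ⁻¹, sq_nonneg (κ * p.2.1), sq_nonneg (p.2.1 : ℝ)]
    · rw [sq_abs]
      nlinarith [sq_nonneg κ⁻¹, sq_nonneg (κ * p.2.1)]
  calc ‖M p.1 p.2‖ ^ 2 / (1 + (κ * p.2.1) ^ 2) ≤ ‖W (p.1.1 + p.2.1)‖ ^ 2 / (1 + (κ * p.2.1) ^ 2) := by
        exact div_le_div_of_nonneg_right (norm_hankel_le hM _ _) (by positivity)
    _ ≤ _ := by
        rw [← mul_assoc, mul_comm (1 + κ⁻¹ ^ 2), mul_assoc, div_eq_mul_one_div]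
        gcongr
        rw [div_le_iff₀ (by positivity), mul_one_div, div_mul_eq_mul_div, le_div_iff₀ (by positivity), one_mul]
        exact h1

theorem summable_hankel_column (hW : Summable fun n => ‖W n‖ ^ 2)
    (hM : ∀ i j, M i j = ⟪h i.2, W (i.1 + j.1) (h j.2)⟫_ℂ) (j : ℤ × Fin d) :
    Summable fun i => ‖M i j‖ ^ 2 := by
  have h1 : Summable fun n : ℤ => ‖W (n + j.1)‖ ^ 2 := hW.comp_injective (add_left_injective j.1)
  exact Summable.of_nonneg_of_le (fun _ => sq_nonneg _) (fun i => norm_hankel_le hM i j)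
    (h1.comp_fst_of_finite (γ := Fin d))

/-- Up to the factor i/κ, the (j, ℓ) block of BX₀ is the sum over n ≠ ℓ in the second hypothesis.
Absolute convergence, from square summability of W, allows summing over `Fin d` first and taking
matrix entries through the series. -/
theorem summable_hankel_product [CompleteSpace H] (hκ : 0 < κ) (hW : Summable fun n => ‖W n‖ ^ 2)
    (hM : ∀ i j, M i j = ⟪h i.2, W (i.1 + j.1) (h j.2)⟫_ℂ)
    (hX₀ : ∀ i j, X₀ i j = if κ * i.1 = κ * j.1 then 0 else
      M i j / (Complex.I * ((κ * i.1 : ℝ) - (κ * j.1 : ℝ))))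
    (hWW : Summable fun p : ℤ × ℤ => ‖∑' n : {n : ℤ // n ≠ p.2},
      ((p.2 - (n : ℤ) : ℤ) : ℂ)⁻¹ • (W (p.1 + n) * W (p.2 + n))‖ ^ 2) :
    Summable fun p : (ℤ × Fin d) × (ℤ × Fin d) => ‖∑' j, M p.1 j * X₀ j p.2‖ ^ 2 := by
  refine summable_of_le_fst_fst (hWW.mul_left (κ⁻¹ ^ 2)) (fun _ => sq_nonneg _) ?_
  rintro ⟨⟨j, k⟩, ⟨ℓ, l⟩⟩
  dsimp only
  rw [← mul_pow]
  gcongr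
  have ha : ∀ m : ℤ, Summable fun n : ℤ => ‖W (m + n)‖ ^ 2 := fun m =>
    hW.comp_injective (add_right_injective m)
  have hab : Summable fun n : ℤ => ‖W (j + n)‖ * ‖W (ℓ + n)‖ := by
    refine Summable.of_nonneg_of_le (fun _ => by positivity) (fun n => ?_) ((ha j).add (ha ℓ))
    nlinarith [sq_nonneg (‖W (j + n)‖ - ‖W (ℓ + n)‖), norm_nonneg (W (j + n)), norm_nonneg (W (ℓ + n)),
      mul_nonneg (norm_nonneg (W (j + n))) (norm_nonneg (W (ℓ + n)))]
  let P : ℤ → H →L[ℂ] H := fun n => ((ℓ - n : ℤ) : ℂ)⁻¹ • (W (j + n) * W (ℓ + n))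
  have hPn : ∀ n, ‖P n‖ ≤ ‖W (j + n)‖ * ‖W (ℓ + n)‖ := fun n => by
    refine (norm_smul_le _ _).trans ((mul_le_mul_of_nonneg_left (norm_mul_le _ _) (norm_nonneg _)).trans ?_)
    refine mul_le_of_le_one_left (by positivity) ?_
    rw [norm_inv]
    by_cases h0 : ℓ - n = 0
    · simp [h0]
    · refine inv_le_one_of_one_le₀ ?_
      rw [Complex.norm_intCast]
      exact_mod_cast Int.one_le_abs h0
  have hP : Summable P := Summable.of_norm_bounded hab hPn
  -- The term n = ℓ vanishes because 0⁻¹ = 0.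
  have hsub : ∑' n : {n : ℤ // n ≠ ℓ}, P n = ∑' n, P n := by
    rw [show (∑' n : {n : ℤ // n ≠ ℓ}, P n) = ∑' n : ({n : ℤ | n ≠ ℓ} : Set ℤ), P n from rfl, tsum_subtype]
    refine tsum_congr fun n => ?_
    by_cases hn : n = ℓ
    · simp [hn, P]
    · exact Set.indicator_of_mem (s := {n : ℤ | n ≠ ℓ}) hn P
  change _ ≤ κ⁻¹ * ‖∑' n : {n : ℤ // n ≠ ℓ}, P n‖
  rw [hsub]
  let Φ : (H →L[ℂ] H) →L[ℂ] ℂ := innerSL ℂ (h k) ∘L ContinuousLinearMap.apply ℂ H (h l)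
  have hΦ : ∀ T, Φ T = ⟪h k, T (h l)⟫_ℂ := fun T => rfl
  have hterm : ∀ n m, M (j, k) (n, m) * X₀ (n, m) (ℓ, l) = (Complex.I * κ⁻¹) *
      (((ℓ - n : ℤ) : ℂ)⁻¹ * (⟪h k, W (j + n) (h m)⟫_ℂ * ⟪h m, W (ℓ + n) (h l)⟫_ℂ)) := fun n m => by
    rw [hX₀]
    by_cases hn : n = ℓ
    · simp [hn]
    · have h1 : ¬ κ * (n : ℝ) = κ * ℓ := fun e => hn (by exact_mod_cast mul_left_cancel₀ hκ.ne' e)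
      rw [if_neg h1, hM, hM]
      have h2 : (ℓ : ℂ) - n ≠ 0 := sub_ne_zero.2 fun e => hn (by exact_mod_cast e.symm)
      have h3 : (n : ℂ) - ℓ ≠ 0 := by rw [← neg_sub]; exact neg_ne_zero.2 h2
      have h4 : (κ : ℂ) ≠ 0 := by exact_mod_cast hκ.ne'
      dsimp only
      push_cast
      rw [add_comm n ℓ, ← mul_sub]
      field_simp
      rw [Complex.I_sq]
      ring
  have hΦP : ∀ n, ∑ m, M (j, k) (n, m) * X₀ (n, m) (ℓ, l) = (Complex.I * κ⁻¹) * Φ (P n) := fun n => by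
    simp only [hterm, ← Finset.mul_sum]
    rw [hΦ]
    change _ = _ * ⟪h k, ((ℓ - n : ℤ) : ℂ)⁻¹ • W (j + n) (W (ℓ + n) (h l))⟫_ℂ
    rw [inner_smul_right]
    congr 2
    rw [← ContinuousLinearMap.adjoint_inner_left, ← h.sum_inner_mul_inner]
    simp only [ContinuousLinearMap.adjoint_inner_left]
  have hsum : Summable fun q : ℤ × Fin d => M (j, k) q * X₀ q (ℓ, l) := by
    have h1 : Summable fun q : ℤ × Fin d => ‖W (j + q.1)‖ * ‖W (ℓ + q.1)‖ * κ⁻¹ :=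
      (hab.mul_right κ⁻¹).comp_fst_of_finite
    refine Summable.of_norm_bounded h1 ?_
    rintro ⟨n, m⟩
    rw [hterm, norm_mul, norm_mul, Complex.norm_I, one_mul, norm_mul, norm_mul, mul_comm,
      Complex.norm_real, Real.norm_of_nonneg (inv_nonneg.2 hκ.le)]
    refine mul_le_mul_of_nonneg_right ?_ (inv_nonneg.2 hκ.le)
    refine (mul_le_of_le_one_left (by positivity) ?_).trans ?_
    · rw [norm_inv]
      by_cases h0 : ℓ - n = 0
      · simp [h0]
      · refine inv_le_one_of_one_le₀ ?_
        rw [Complex.norm_intCast]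
        exact_mod_cast Int.one_le_abs h0
    · gcongr
      · exact h.norm_inner_apply_le _ _ _
      · exact h.norm_inner_apply_le _ _ _
  rw [hsum.tsum_prod]
  simp only [tsum_fintype, hΦP]
  rw [tsum_mul_left, ← Φ.map_tsum hP, norm_mul, norm_mul, Complex.norm_I, one_mul,
    Complex.norm_real, Real.norm_of_nonneg (inv_nonneg.2 hκ.le), hΦ]
  gcongr
  exact h.norm_inner_apply_le _ _ _

end Coefficients

/-! ### The Fourier basis of L²([0, ω], H) -/

section FourierBasis

open scoped InnerProductSpace Topology
open Filter

theorem invChar_add (ω : ℝ) (m n : ℤ) (s : ℝ) : invChar ω (m + n) s = invChar ω m s * invChar ω n s := by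
  rw [invChar, invChar, invChar, ← Complex.exp_add]
  congr 1
  push_cast
  ring

theorem invChar_zero (ω s : ℝ) : invChar ω 0 s = 1 := by simp [invChar]

theorem invChar_apply_zero (ω : ℝ) (n : ℤ) : invChar ω n 0 = 1 := by simp [invChar]

theorem invChar_eq_exp_ofReal_mul_I (ω : ℝ) (n : ℤ) (s : ℝ) :
    invChar ω n s = Complex.exp (((-(2 * Real.pi * n / ω * s) : ℝ) : ℂ) * Complex.I) := by
  rw [invChar]
  congr 1
  push_cast
  ring

theorem conj_invChar (ω : ℝ) (n : ℤ) (s : ℝ) : (starRingEnd ℂ) (invChar ω n s) = invChar ω (-n) s := by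
  rw [invChar_eq_exp_ofReal_mul_I, invChar_eq_exp_ofReal_mul_I, ← Complex.exp_conj, map_mul,
    Complex.conj_ofReal, Complex.conj_I]
  congr 1
  push_cast
  ring

theorem norm_invChar (ω : ℝ) (n : ℤ) (s : ℝ) : ‖invChar ω n s‖ = 1 := by
  rw [invChar_eq_exp_ofReal_mul_I, Complex.norm_exp_ofReal_mul_I]

theorem contDiff_invChar (ω : ℝ) (n : ℤ) : ContDiff ℝ 1 (invChar ω n) :=
  (contDiff_const.mul Complex.ofRealCLM.contDiff).neg.cexp

theorem continuous_invChar (ω : ℝ) (n : ℤ) : Continuous (invChar ω n) := (contDiff_invChar ω n).continuous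

theorem hasDerivAt_invChar (ω : ℝ) (n : ℤ) (s : ℝ) :
    HasDerivAt (invChar ω n) (-(Complex.I * (2 * Real.pi / ω * n : ℝ)) * invChar ω n s) s := by
  have h1 : HasDerivAt (fun s : ℝ => -(Complex.I * (2 * Real.pi * n / ω) * s))
      (-(Complex.I * (2 * Real.pi * n / ω) * 1)) s :=
    ((Complex.ofRealCLM.hasDerivAt (x := s)).const_mul _).neg
  convert! h1.cexp using 1
  rw [invChar]
  push_cast
  ring

theorem MeasureTheory.MemLp.invChar_smul {ω : ℝ} {H : Type*} [NormedAddCommGroup H]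
    [InnerProductSpace ℂ H] {f : ℝ → H} (hf : MemLp f 2 (invMeasure ω)) (n : ℤ) :
    MemLp (fun s => invChar ω n s • f s) 2 (invMeasure ω) := by
  have h : MemLp (invChar ω n) ⊤ (invMeasure ω) :=
    memLp_top_of_bound (continuous_invChar ω n).aestronglyMeasurable 1
      (Eventually.of_forall fun s => (norm_invChar ω n s).le)
  exact hf.smul h

variable {ω : ℝ} [hω : Fact (0 < ω)]

theorem invChar_apply_period (n : ℤ) : invChar ω n ω = 1 := by
  have h : (ω : ℂ) ≠ 0 := by exact_mod_cast hω.out.ne'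
  rw [invChar, Complex.exp_eq_one_iff]
  refine ⟨-n, ?_⟩
  push_cast
  field_simp

/-- This sign change, caused by the involution s ↦ ω - s, makes the matrix of the potential Hankel
rather than Toeplitz. -/
theorem invChar_reflect (n : ℤ) (s : ℝ) : invChar ω n (ω - s) = invChar ω (-n) s := by
  have h : invChar ω n (ω - s) = invChar ω n ω * invChar ω (-n) s := by
    rw [invChar, invChar, invChar, ← Complex.exp_add]
    congr 1
    push_cast
    ring
  rw [h, invChar_apply_period, one_mul]

theorem integral_invMeasure {F : Type*} [NormedAddCommGroup F] [NormedSpace ℝ F] (f : ℝ → F) :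
    ∫ s, f s ∂invMeasure ω = (1 / ω) • ∫ s in (0 : ℝ)..ω, f s := by
  rw [invMeasure, integral_smul_measure, integral_Icc_eq_integral_Ioc,
    intervalIntegral.integral_of_le hω.out.le, ENNReal.toReal_inv, ENNReal.toReal_ofReal hω.out.le, one_div]

theorem integral_invChar (n : ℤ) : ∫ s in (0 : ℝ)..ω, invChar ω n s = if n = 0 then (ω : ℂ) else 0 := by
  split_ifs with h
  · simp [h, invChar_zero]
  · have h0 : (-(Complex.I * (2 * Real.pi / ω * n : ℝ)) : ℂ) ≠ 0 := by
      have := hω.out.ne'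
      rw [neg_ne_zero, mul_ne_zero_iff]
      refine ⟨Complex.I_ne_zero, ?_⟩
      exact_mod_cast (by positivity : (2 * Real.pi / ω * n : ℝ) ≠ 0)
    have h1 := intervalIntegral.integral_eq_sub_of_hasDerivAt (a := 0) (b := ω)
      (fun s _ => hasDerivAt_invChar ω n s)
      ((continuous_const.mul (continuous_invChar ω n)).intervalIntegrable _ _)
    rw [invChar_apply_period, invChar_apply_zero, sub_self, intervalIntegral.integral_const_mul] at h1
    exact (mul_eq_zero.1 h1).resolve_left h0

variable {H : Type*} [NormedAddCommGroup H] [InnerProductSpace ℂ H]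

/-- The function `s ↦ e^{i (2πn/ω) s} x`. -/
noncomputable def fourierVec (ω : ℝ) [Fact (0 < ω)] (n : ℤ) (x : H) : InvL2 ω H :=
  ((memLp_const x).invChar_smul (-n)).toLp _

theorem fourierVec_ae_eq (n : ℤ) (x : H) :
    fourierVec ω n x =ᵐ[invMeasure ω] fun s => invChar ω (-n) s • x := MemLp.coeFn_toLp _

theorem inner_fourierVec {y : InvL2 ω H} {f : ℝ → H} (hf : y =ᵐ[invMeasure ω] f) (n : ℤ) (x : H) :
    ⟪fourierVec ω n x, y⟫_ℂ = (1 / ω) • ∫ s in (0 : ℝ)..ω, invChar ω n s * ⟪x, f s⟫_ℂ := by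
  rw [L2.inner_def, ← integral_invMeasure]
  refine integral_congr_ae ?_
  filter_upwards [fourierVec_ae_eq n x, hf] with s h1 h2
  rw [h1, h2, inner_smul_left, conj_invChar, neg_neg]

theorem inner_fourierVec_fourierVec (m n : ℤ) (x y : H) :
    ⟪fourierVec ω m x, fourierVec ω n y⟫_ℂ = if m = n then ⟪x, y⟫_ℂ else 0 := by
  rw [inner_fourierVec (fourierVec_ae_eq n y)]
  have h : ∀ s, invChar ω m s * ⟪x, invChar ω (-n) s • y⟫_ℂ = invChar ω (m - n) s * ⟪x, y⟫_ℂ := fun s => by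
    rw [inner_smul_right, ← mul_assoc, ← invChar_add, sub_eq_add_neg]
  simp only [h]
  rw [intervalIntegral.integral_mul_const, integral_invChar]
  have h0 : (ω : ℂ) ≠ 0 := by exact_mod_cast hω.out.ne'
  by_cases hmn : m = n
  · simp [hmn, h0]
  · simp [hmn, sub_eq_zero]

theorem MeasureTheory.MemLp.of_invMeasure {F : Type*} [NormedAddCommGroup F] {f : ℝ → F}
    (hf : MemLp f 2 (invMeasure ω)) : MemLp f 2 (volume.restrict (Ioc 0 ω)) := by
  have h0 : ENNReal.ofReal ω ≠ 0 := by simpa using hω.out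
  have h1 := hf.smul_measure (ENNReal.ofReal_ne_top (r := ω))
  rw [invMeasure, smul_smul, ENNReal.mul_inv_cancel h0 ENNReal.ofReal_ne_top, one_smul] at h1
  exact h1.mono_measure (Measure.restrict_mono Ioc_subset_Icc_self le_rfl)

/-- Parseval's identity for scalar Fourier series on [0, ω]. -/
theorem ae_eq_zero_of_fourier {g : ℝ → ℂ} (hg : MemLp g 2 (invMeasure ω))
    (h : ∀ n, ∫ s in (0 : ℝ)..ω, invChar ω n s * g s = 0) : g =ᵐ[invMeasure ω] 0 := by
  have hg' := hg.of_invMeasure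
  have h1 := tsum_sq_fourierCoeffOn hω.out hg'
  have h2 : ∀ n, fourierCoeffOn hω.out g n = 0 := fun n => by
    rw [fourierCoeffOn_eq_integral]
    have e : ∀ s : ℝ, fourier (-n) (s : AddCircle (ω - 0)) • g s = invChar ω n s * g s := fun s => by
      rw [fourier_coe_apply, invChar, smul_eq_mul, sub_zero]
      congr 2
      push_cast
      ring
    simp only [e, h, smul_zero]
  simp only [h2, norm_zero, ne_eq, OfNat.ofNat_ne_zero, not_false_eq_true, zero_pow, tsum_zero,
    sub_zero] at h1
  have h3 : ∫ s in Ioc 0 ω, ‖g s‖ ^ 2 = 0 := by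
    rw [← intervalIntegral.integral_of_le hω.out.le]
    exact (smul_eq_zero.1 h1.symm).resolve_left (inv_ne_zero hω.out.ne')
  rw [integral_eq_zero_iff_of_nonneg (fun _ => sq_nonneg _) (hg'.integrable_norm_pow two_ne_zero)] at h3
  refine (invMeasure_ac ω).ae_eq ?_
  rw [EventuallyEq, ← restrict_Ioc_eq_restrict_Icc]
  filter_upwards [h3] with s hs
  simpa using hs

theorem fourierVec_orthonormal {d : ℕ} (h : OrthonormalBasis (Fin d) ℂ H) :
    Orthonormal ℂ fun i : ℤ × Fin d => fourierVec ω i.1 (h i.2) := by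
  rw [orthonormal_iff_ite]
  rintro ⟨m, k⟩ ⟨n, l⟩
  rw [inner_fourierVec_fourierVec, orthonormal_iff_ite.1 h.orthonormal]
  by_cases h1 : m = n <;> by_cases h2 : k = l <;> simp [h1, h2]

theorem fourierVec_complete {d : ℕ} (h : OrthonormalBasis (Fin d) ℂ H) :
    (Submodule.span ℂ (range fun i : ℤ × Fin d => fourierVec ω i.1 (h i.2)))ᗮ = ⊥ := by
  rw [Submodule.eq_bot_iff]
  intro y hy
  have h1 : ∀ k, (fun s => ⟪h k, y s⟫_ℂ) =ᵐ[invMeasure ω] 0 := fun k => by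
    refine ae_eq_zero_of_fourier ((Lp.memLp y).const_inner (h k)) fun n => ?_
    have h2 := (Submodule.mem_orthogonal _ _).1 hy _ (Submodule.subset_span ⟨(n, k), rfl⟩)
    rw [inner_fourierVec (f := y) ae_eq_rfl] at h2
    exact (smul_eq_zero.1 h2).resolve_left (one_div_ne_zero hω.out.ne')
  refine Lp.ext ?_
  filter_upwards [ae_all_iff.2 h1, Lp.coeFn_zero H 2 (invMeasure ω)] with s hs h0
  rw [h0]
  refine h.repr.injective ?_
  ext k
  simpa [h.repr_apply_apply] using hs k

/-- The Fourier basis of `L²([0, ω], H)` built on an orthonormal basis of `H`. -/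
noncomputable def fourierHilbertBasis [CompleteSpace H] (ω : ℝ) [Fact (0 < ω)] {d : ℕ} (h : OrthonormalBasis (Fin d) ℂ H) :
    HilbertBasis (ℤ × Fin d) ℂ (InvL2 ω H) :=
  HilbertBasis.mkOfOrthogonalEqBot (fourierVec_orthonormal h) (fourierVec_complete h)

theorem fourierHilbertBasis_apply [CompleteSpace H] {d : ℕ} (h : OrthonormalBasis (Fin d) ℂ H) (i : ℤ × Fin d) :
    fourierHilbertBasis ω h i = fourierVec ω i.1 (h i.2) := by
  simp [fourierHilbertBasis]

end FourierBasis

/-! ### Integration by parts for absolutely continuous functions -/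

section IntegrationByParts

variable {F : Type*} [NormedAddCommGroup F]

theorem AbsolutelyContinuousOnInterval.of_dist_le {f : ℝ → F} {g : ℝ → ℝ} {a b : ℝ}
    (hg : AbsolutelyContinuousOnInterval g a b)
    (h : ∀ x ∈ uIcc a b, ∀ y ∈ uIcc a b, dist (f x) (f y) ≤ dist (g x) (g y)) :
    AbsolutelyContinuousOnInterval f a b := by
  rw [absolutelyContinuousOnInterval_iff] at hg ⊢
  intro ε hε
  obtain ⟨δ, hδ, H⟩ := hg ε hε
  refine ⟨δ, hδ, fun E hE hEδ => (Finset.sum_le_sum fun i hi => ?_).trans_lt (H E hE hEδ)⟩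
  exact h _ (hE.1 i hi).1 _ (hE.1 i hi).2

variable [NormedSpace ℝ F]

theorem IntervalIntegrable.absolutelyContinuousOnInterval_integral {f : ℝ → F} {a b : ℝ}
    (hf : IntervalIntegrable f volume a b) :
    AbsolutelyContinuousOnInterval (fun x => ∫ t in a..x, f t) a b := by
  refine (hf.norm.absolutelyContinuousOnInterval_intervalIntegral left_mem_uIcc).of_dist_le
    fun x hx y hy => ?_
  have hi : ∀ z ∈ uIcc a b, IntervalIntegrable f volume a z := fun z hz =>
    hf.mono_set (uIcc_subset_uIcc left_mem_uIcc hz)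
  rw [dist_eq_norm, Real.dist_eq, intervalIntegral.integral_interval_sub_left (hi x hx) (hi y hy),
    intervalIntegral.integral_interval_sub_left (hi x hx).norm (hi y hy).norm]
  exact intervalIntegral.norm_integral_le_abs_integral_norm

/-- G is differentiable only almost everywhere. The function c • G minus the integral of its
derivative is absolutely continuous with zero derivative a.e., hence constant. -/
theorem integral_smul_deriv_eq_sub [NormedSpace ℂ F] [CompleteSpace F] {c c' : ℝ → ℂ}
    (hc : ContDiff ℝ 1 c) (hc' : ∀ x, HasDerivAt c (c' x) x) (hcc : Continuous c') {D : ℝ → F} {a b : ℝ}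
    (hD : IntervalIntegrable D volume a b) {G : ℝ → F}
    (hG : ∀ x, G x = G a + ∫ t in a..x, D t) :
    ∫ x in a..b, (c' x • G x + c x • D x) = c b • G b - c a • G a := by
  have hGac : AbsolutelyContinuousOnInterval G a b := by
    have h1 : AbsolutelyContinuousOnInterval (fun _ : ℝ => G a) a b :=
      (contDiff_const (n := 1)).contDiffOn.absolutelyContinuousOnInterval
    rw [funext hG]
    exact h1.add hD.absolutelyContinuousOnInterval_integral
  have hi : IntervalIntegrable (fun x => c' x • G x + c x • D x) volume a b :=
    (hcc.continuousOn.smul hGac.continuousOn).intervalIntegrable.add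
      (hD.continuousOn_smul hc.continuous.continuousOn)
  have hac := (hc.contDiffOn.absolutelyContinuousOnInterval.smul hGac).sub
    hi.absolutelyContinuousOnInterval_integral
  obtain ⟨C, hC⟩ := hac.const_of_ae_hasDerivAt_zero (by
    filter_upwards [hi.ae_hasDerivAt_integral, hD.ae_hasDerivAt_integral] with x h1 h2 hx
    have h3 : HasDerivAt G (D x) x := by
      rw [funext hG]
      exact (h2 hx a left_mem_uIcc).const_add _
    have h4 := ((hc' x).smul h3).sub (h1 hx a left_mem_uIcc)
    convert! h4 using 1
    abel)
  have ha := hC a left_mem_uIcc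
  have hb := hC b right_mem_uIcc
  rw [← ha] at hb
  simp only [Pi.sub_apply, Pi.smul_apply', intervalIntegral.integral_same, sub_zero] at hb
  rw [← hb]
  abel

end IntegrationByParts

/-! ### The matrix of `L` in the Fourier basis -/

section InvolutionOperator

open scoped InnerProductSpace Topology
open Filter

variable {ω : ℝ} [hω : Fact (0 < ω)] {H : Type*} [NormedAddCommGroup H] [InnerProductSpace ℂ H]

/-- Integration by parts; y(0) = y(ω) and the periodicity of the exponential cancel the boundary
terms. -/
theorem inner_fourierVec_invDeriv [CompleteSpace H] (y : invDomain ω H) (n : ℤ) (x : H) :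
    ⟪fourierVec ω n x, invDeriv y⟫_ℂ =
      Complex.I * (2 * Real.pi / ω * n : ℝ) * ⟪fourierVec ω n x, (y : InvL2 ω H)⟫_ℂ := by
  have hy := invRep_spec y
  have hp : invRep y 0 = invRep y ω := y.2.choose_spec.choose_spec.2
  have hmem : ω ∈ Icc 0 ω := ⟨hω.out.le, le_rfl⟩
  have hDi := (invDeriv y).intervalIntegrable hmem
  -- The representative is an integral only on [0, ω]; G satisfies the integral formula everywhere.
  let G : ℝ → H := fun s => invRep y 0 + ∫ τ in (0 : ℝ)..s, invDeriv y τ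
  have hG0 : G 0 = invRep y 0 := by simp [G]
  have hGe : ∀ s ∈ Icc 0 ω, G s = invRep y s := fun s hs => (hy.eq_integral s hs).symm
  have hyG : (y : InvL2 ω H) =ᵐ[invMeasure ω] G := hy.ae_eq.trans ((invMeasure_ac ω).ae_le
    (ae_restrict_of_forall_mem measurableSet_Icc fun s hs => (hGe s hs).symm))
  have h1 := integral_smul_deriv_eq_sub (contDiff_invChar ω n) (hasDerivAt_invChar ω n)
    (continuous_const.mul (continuous_invChar ω n)) hDi (G := G) fun s => by rw [hG0]
  rw [invChar_apply_period, invChar_apply_zero, hG0, hGe ω hmem, hp, sub_self] at h1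
  have hGc : ContinuousOn G (uIcc 0 ω) := by
    rw [uIcc_of_le hω.out.le]
    exact hy.continuousOn.congr hGe
  have hi1 : IntervalIntegrable (fun s => invChar ω n s • G s) volume 0 ω :=
    ((continuous_invChar ω n).continuousOn.smul hGc).intervalIntegrable
  have hi2 : IntervalIntegrable (fun s => invChar ω n s • invDeriv y s) volume 0 ω :=
    hDi.continuousOn_smul (continuous_invChar ω n).continuousOn
  simp only [mul_smul] at h1
  have hi3 : IntervalIntegrable
      (fun s => (-(Complex.I * (2 * Real.pi / ω * n : ℝ)) : ℂ) • invChar ω n s • G s) volume 0 ω :=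
    hi1.smul _
  rw [intervalIntegral.integral_add hi3 hi2, intervalIntegral.integral_smul, neg_smul,
    neg_add_eq_zero] at h1
  have h2 := congrArg (innerSL ℂ x) h1
  rw [map_smul, ← ContinuousLinearMap.intervalIntegral_comp_comm _ hi1,
    ← ContinuousLinearMap.intervalIntegral_comp_comm _ hi2] at h2
  rw [inner_fourierVec (f := invDeriv y) ae_eq_rfl, inner_fourierVec hyG]
  simp only [innerSL_apply_apply, inner_smul_right, smul_eq_mul] at h2
  rw [← h2, mul_smul_comm]

variable [FiniteDimensional ℂ H] {V : ℝ → H →L[ℂ] H}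

/-- Moving 𝒱(s) to the other side of the inner product makes each row of B pairing with an L²
vector, hence defined on all of L² even where B is not. -/
theorem IsL2Potential.memLp_adjoint [CompleteSpace H] (hV : IsL2Potential ω V) (x : H) :
    MemLp (fun s => ContinuousLinearMap.adjoint (V s) x) 2 (invMeasure ω) := by
  let h := stdOrthonormalBasis ℂ H
  have e : (fun s => ContinuousLinearMap.adjoint (V s) x) =
      fun s => ∑ l, ⟪V s (h l), x⟫_ℂ • h l := by
    funext s
    conv_lhs => rw [← h.sum_repr (ContinuousLinearMap.adjoint (V s) x)]
    simp only [h.repr_apply_apply, ContinuousLinearMap.adjoint_inner_right]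
  rw [e]
  refine memLp_finsetSum _ fun l _ => ?_
  have h1 : MemLp (fun _ : ℝ => h l) ⊤ (invMeasure ω) := memLp_const _
  exact h1.smul ((hV (h l)).inner_const x)

/-- The rows of the potential term of the operator in the Fourier basis. -/
noncomputable def potentialRow [CompleteSpace H] (hV : IsL2Potential ω V) (n : ℤ) (x : H) : InvL2 ω H :=
  (((hV.memLp_adjoint x).comp_measurePreserving (measurePreserving_reflect ω)).invChar_smul n).toLp _

theorem inner_potentialRow [CompleteSpace H] (hV : IsL2Potential ω V) (n : ℤ) (x : H) {y : InvL2 ω H}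
    {f : ℝ → H} (hf : y =ᵐ[invMeasure ω] f) :
    ⟪potentialRow hV n x, y⟫_ℂ =
      (1 / ω) • ∫ s in (0 : ℝ)..ω, invChar ω n s * ⟪x, V s (f (ω - s))⟫_ℂ := by
  have h1 : ⟪potentialRow hV n x, y⟫_ℂ =
      (1 / ω) • ∫ s in (0 : ℝ)..ω, invChar ω n (ω - s) * ⟪x, V (ω - s) (f s)⟫_ℂ := by
    rw [L2.inner_def, ← integral_invMeasure]
    refine integral_congr_ae ?_
    filter_upwards [MemLp.coeFn_toLp (((hV.memLp_adjoint x).comp_measurePreserving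
      (measurePreserving_reflect ω)).invChar_smul n), hf] with s h1 h2
    rw [potentialRow, h1, h2, inner_smul_left, conj_invChar, invChar_reflect]
    simp only [Function.comp_apply, ContinuousLinearMap.adjoint_inner_left]
  rw [h1]
  have h2 := intervalIntegral.integral_comp_sub_left (a := 0) (b := ω)
    (fun s => invChar ω n s * ⟪x, V s (f (ω - s))⟫_ℂ) ω
  rw [sub_self, sub_zero] at h2
  rw [← h2]
  simp only [sub_sub_cancel]

theorem inner_potentialRow_domain [CompleteSpace H] (hV : IsL2Potential ω V) (n : ℤ) (x : H)
    (y : invDomain ω H) :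
    ⟪potentialRow hV n x, (y : InvL2 ω H)⟫_ℂ = ⟪fourierVec ω n x, (memLp_potential hV y).toLp _⟫_ℂ := by
  rw [inner_potentialRow hV n x (invRep_spec y).ae_eq, inner_fourierVec (MemLp.coeFn_toLp _)]

theorem inner_potentialRow_fourierVec [CompleteSpace H] (hV : IsL2Potential ω V) (m n : ℤ) (x y : H) :
    ⟪potentialRow hV m x, fourierVec ω n y⟫_ℂ = ⟪x, potentialCoeff V hV (m + n) y⟫_ℂ := by
  rw [inner_potentialRow hV m x (fourierVec_ae_eq n y)]
  change _ = ⟪x, (1 / ω : ℂ) • ∫ s in (0 : ℝ)..ω, invChar ω (m + n) s • V s y⟫_ℂ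
  have h := ContinuousLinearMap.intervalIntegral_comp_comm (innerSL ℂ x)
    (integrable_invChar_smul hV (m + n) y)
  rw [inner_smul_right]
  change _ = _ * innerSL ℂ x _
  rw [← h, Complex.real_smul]
  push_cast
  congr 2
  funext s
  rw [map_smul, invChar_reflect, neg_neg, inner_smul_right, innerSL_apply_apply, inner_smul_right,
    invChar_add]
  ring

theorem inner_fourierVec_invOperator [CompleteSpace H] (hV : IsL2Potential ω V) (n : ℤ) (x : H)
    (y : (invOperator V hV).domain) :
    ⟪fourierVec ω n x, invOperator V hV y⟫_ℂ =
      Complex.I * (2 * Real.pi / ω * n : ℝ) * ⟪fourierVec ω n x, (y : InvL2 ω H)⟫_ℂ -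
        ⟪potentialRow hV n x, (y : InvL2 ω H)⟫_ℂ := by
  have h1 := inner_fourierVec_invDeriv (ω := ω) y n x
  have h2 := inner_potentialRow_domain hV n x y
  exact (inner_sub_right _ _ _).trans (congrArg₂ (· - ·) h1 h2.symm)

end InvolutionOperator

/-! ### Assembly -/

section HankelPerturbation

open scoped InnerProductSpace

/-- Bounded mild solutions are almost periodic for a diagonal operator with clustered spectrum `κ ℤ`
perturbed by a block Hankel matrix with coefficients `W`. -/
theorem isBohrAlmostPeriodic_of_hankel {E H : Type*} [NormedAddCommGroup E] [InnerProductSpace ℂ E]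
    [CompleteSpace E] [NormedAddCommGroup H] [InnerProductSpace ℂ H] [CompleteSpace H] {d : ℕ}
    (b : HilbertBasis (ℤ × Fin d) ℂ E) (h : OrthonormalBasis (Fin d) ℂ H) {κ : ℝ} (hκ : 0 < κ)
    {W : ℤ → H →L[ℂ] H} {β : ℤ × Fin d → E} (hW : Summable fun n => ‖W n‖ ^ 2)
    (hβ : ∀ i j, ⟪β i, b j⟫_ℂ = ⟪h i.2, W (i.1 + j.1) (h j.2)⟫_ℂ)
    (hWW : Summable fun p : ℤ × ℤ => ‖∑' n : {n : ℤ // n ≠ p.2},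
      ((p.2 - (n : ℤ) : ℤ) : ℂ)⁻¹ • (W (p.1 + n) * W (p.2 + n))‖ ^ 2)
    {u : ℝ → E} (hu : Continuous u)
    (hD : ∀ t, ∃ D : E, ∀ i : ℤ × Fin d,
      ⟪b i, D⟫_ℂ = Complex.I * (κ * i.1 : ℝ) * ⟪b i, ∫ τ in (0 : ℝ)..t, u τ⟫_ℂ)
    (hsol : ∀ t, ∀ i : ℤ × Fin d, ⟪b i, u t⟫_ℂ = ⟪b i, u 0⟫_ℂ +
      (Complex.I * (κ * i.1 : ℝ) * ⟪b i, ∫ τ in (0 : ℝ)..t, u τ⟫_ℂ - ⟪β i, ∫ τ in (0 : ℝ)..t, u τ⟫_ℂ))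
    {K : ℝ} (hK : ∀ t, ‖u t‖ ≤ K) : IsBohrAlmostPeriodic u := by
  classical
  obtain ⟨X₀, hX₀⟩ : ∃ X₀ : ℤ × Fin d → ℤ × Fin d → ℂ, ∀ i j, X₀ i j = if κ * i.1 = κ * j.1 then 0 else
      ⟪β i, b j⟫_ℂ / (Complex.I * ((κ * i.1 : ℝ) - (κ * j.1 : ℝ))) := ⟨_, fun _ _ => rfl⟩
  let M : ℤ × Fin d → ℤ × Fin d → ℂ := fun i j => ⟪β i, b j⟫_ℂ
  have h1 := summable_commutator_solution (M := M) hκ hW hβ hX₀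
  have h2 := summable_hankel_diagonal (M := M) hκ hW hβ
  have h3 := summable_hankel_div (M := M) hκ hW hβ
  have h4 := summable_hankel_column (M := M) hW hβ
  have h5 := summable_hankel_product (M := M) hκ hW hβ hX₀ hWW
  obtain ⟨S, Y, C, hSY, hC, hv⟩ := exists_similar_solution b (fun i => κ * i.1) β X₀ hX₀ h1 h2 h3 h4 h5
    hu hD hsol
  have hAP : IsTrigApproximable fun t => Y (u t) :=
    -- The eigenvalue iκm of A belongs to the indices (m, k), k in `Fin d`, so all multiplicities
    -- are bounded by d.
    hv.isTrigApproximable (n := Prod.fst) hκ hC (fun m => Finset.univ.image fun k => (m, k))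
      (fun i => Finset.mem_image_of_mem _ (Finset.mem_univ i.2)) (fun m => Finset.card_image_le)
      (Y.continuous.comp hu) (K := ‖Y‖ * K) fun t => Y.le_opNorm_of_le (hK t)
  have hAP' := hAP.clm_comp S
  simp only [hSY] at hAP'
  exact hAP'.isBohrAlmostPeriodic hu

end HankelPerturbation

theorem mainTheorem10 (ω : ℝ) [Fact (0 < ω)] (H : Type*) [NormedAddCommGroup H]
    [InnerProductSpace ℂ H] [FiniteDimensional ℂ H]
    (V : ℝ → H →L[ℂ] H) (hV : IsL2Potential ω V)
    (hV₁ : CoeffSqSummable V hV) (hV₂ : CoeffProdSummable V hV)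
    (φ : InvL2 ω H) (u : ℝ → InvL2 ω H) (hu : IsMildSolution V hV φ u)
    (hbdd : ∃ C : ℝ, ∀ t : ℝ, ‖u t‖ ≤ C) :
    IsBohrAlmostPeriodic u := by
  have : CompleteSpace H := FiniteDimensional.complete ℂ H
  have hω : 0 < ω := Fact.out
  obtain ⟨K, hK⟩ := hbdd
  have hu0 : u 0 = φ := by
    obtain ⟨h0, e⟩ := hu.integral_eq 0
    have h1 : (⟨_, h0⟩ : (invOperator V hV).domain) = 0 :=
      Subtype.ext intervalIntegral.integral_same
    rwa [h1, LinearPMap.map_zero, add_zero] at e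
  have hb := fourierHilbertBasis_apply (ω := ω) (stdOrthonormalBasis ℂ H)
  -- The Hankel coefficients W are the 𝒱̂(n), and for the vector D, playing the role of A applied to
  -- the integral of u, one takes the derivative of that integral, which lies in D(L).
  refine isBohrAlmostPeriodic_of_hankel (fourierHilbertBasis ω (stdOrthonormalBasis ℂ H))
    (stdOrthonormalBasis ℂ H) (κ := 2 * Real.pi / ω) (by positivity)
    (β := fun i => potentialRow hV i.1 (stdOrthonormalBasis ℂ H i.2)) hV₁ (fun i j => ?_) hV₂
    hu.continuous (fun t => ?_) (fun t i => ?_) hK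
  · rw [hb]
    exact inner_potentialRow_fourierVec hV _ _ _ _
  · obtain ⟨ht, -⟩ := hu.integral_eq t
    refine ⟨invDeriv ⟨_, ht⟩, fun i => ?_⟩
    rw [hb]
    exact inner_fourierVec_invDeriv ⟨_, ht⟩ i.1 (stdOrthonormalBasis ℂ H i.2)
  · obtain ⟨ht, e⟩ := hu.integral_eq t
    rw [e, hu0, inner_add_right, hb]
    congr 1
    exact inner_fourierVec_invOperator hV i.1 (stdOrthonormalBasis ℂ H i.2) ⟨_, ht⟩
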